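/- **Setting.** Let $\bar{\mathbb Z}=\mathbb Z\setminus\{0\}$ and, for $p>0$, let $h_p$ be the space of complex sequences $z=(z_j)_{j\in\bar{\mathbb Z}}$ with $\|z\|_p^2=\sum_j|z_j|^2|j|^{2p}<\infty$; put $q=p+1$. A point $z$ is real if $z_{-j}=\bar z_j$ for all $j$. The symplectic form is $-i\sum_{j\ge1}dz_j\wedge dz_{-j}$. For a function $A$ on (an open subset of) $h_p$ put $X_A=\big(i\,\mathrm{sgn}(j)\,\partial A/\partial z_{-j}\big)_{j\in\bar{\mathbb Z}}$ and $\{A,B\}=dA(X_B)$. Let $\lambda_j=\frac{j}{1+j^2}$, $\delta_j=\sqrt{|j|/(1+j^2)}$ and $$H=\Lambda+G,\qquad \Lambda=\sum_{j\ge1}\lambda_jz_jz_{-j},\qquad G=\frac1{120\pi^2}\sum_{j_1+\dots+j_6=0}\delta_{j_1}\cdots\delta_{j_6}\,z_{j_1}\cdots z_{j_6}.$$ For positive integers $n_1,n_2$ let $S=\{\pm n_1,\pm n_2\}$, and let $\hat z$ be $z$ with the components $z_j$, $j\in S$, replaced by $0$. Call a tuple of even length *normal* if, up to a permutation, it is $(a,-a,b,-b,\dots)$.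 Write $G=\bar G+\tilde G+\hat G$, where $\bar G$ and $\tilde G$ collect the terms whose index tuple has at most two components outside $S$ and is normal, respectively not normal, and $\hat G$ collects the terms with at least three components outside $S$. Let $F=\sum F_{j_1\dots j_6}z_{j_1}\cdots z_{j_6}$, where $iF_{j_1\dots j_6}$ is the coefficient of $z_{j_1}\cdots z_{j_6}$ in $\tilde G$ (as summed above) divided by $\lambda_{j_1}+\dots+\lambda_{j_6}$, and $0$ for index tuples that do not occur in $\tilde G$. Split the polynomial of degree ten $$\{\bar G+\hat G+\tfrac12\tilde G,\,F\}=\bar R+\tilde R+\hat R,$$ where $\bar R$ collects the monomials $z_{j_1}\cdots z_{j_{10}}$ whose index tuple is normal with all components in $S$, $\tilde R$ those whose tuple is not normal and has at most one component outside $S$, and $\hat R$ those with at least two components outside $S$. By a *real analytic symplectic transformation* near the origin of $h_p$ we mean a map $\Phi$ from an open neighbourhood $U$ of $0$ in $h_p$ to $h_p$ with $\Phi(0)=0$ that is analytic, maps real points to real points, is bijective onto an open set with analytic inverse, preserves the symplectic form, and is such that $\Phi-\mathrm{id}$ is an analytic map from $U$ to $h_q$. **Proposition.** Let $1\ll n_1\ll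 n_2$; that is, $n_1\ge N_1$ for some absolute constant $N_1$, and $n_2\ge N_2$ for some $N_2=N_2(n_1)$. Then there are real numbers $R_0,\dots,R_5$ depending only on $n_1,n_2$ such that for every $p>0$ the following holds. The function $F$ is analytic on $h_p$, $X_F$ is analytic from $h_p$ to $h_q$, and the time-one map $\Phi_1$ of the flow of $X_F$ is a real analytic symplectic transformation near the origin of $h_p$. There is a further real analytic symplectic transformation $\Phi_2$ near the origin of $h_p$ such that, in a neighbourhood of the origin, $$H\circ\Phi_1\circ\Phi_2=\Lambda+\bar G+\hat G+\bar R+\hat R+T,$$ where $$\bar R=\sum_{k=0}^{5}R_k\,(z_{n_1}z_{-n_1})^{5-k}(z_{n_2}z_{-n_2})^{k},$$ that is, at real points, $$\bar R=R_0|z_{n_1}|^{10}+R_1|z_{n_1}|^8|z_{n_2}|^2+R_2|z_{n_1}|^6|z_{n_2}|^4+R_3|z_{n_1}|^4|z_{n_2}|^6+R_4|z_{n_1}|^2|z_{n_2}|^8+R_5|z_{n_2}|^{10},$$ and, as $z\to0$ in $h_p$, $$|\hat R|=O(\|z\|_p^8\|\hat z\|_p^2),\qquad |T|=O(\|z\|_p^{14}).$$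 The functions $\bar R,\hat R$ are analytic on $h_p$ and their Hamiltonian vector fields $X_{\bar R},X_{\hat R}$ are analytic from $h_p$ to $h_q$; $T$ is analytic in a neighbourhood of the origin of $h_p$, and $X_T$ is analytic from that neighbourhood to $h_q$. -/

import Mathlib

open scoped ENNReal Topology

noncomputable section

namespace GBBM

/-! ### Index set and sequence spaces -/

/-- The nonzero integers. -/
def Zbar : Type := {j : ℤ // j ≠ 0}

instance : DecidableEq Zbar := inferInstanceAs (DecidableEq {j : ℤ // j ≠ 0})

instance : Neg Zbar := ⟨fun j => ⟨-j.1, neg_ne_zero.mpr j.2⟩⟩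

/-- A positive integer, as a nonzero integer. -/
def pos (n : ℕ+) : Zbar := ⟨(n : ℤ), by exact_mod_cast n.ne_zero⟩

theorem one_le_abs (j : Zbar) : (1 : ℝ) ≤ |(j.1 : ℝ)| := by
  have h : (1 : ℤ) ≤ |j.1| := Int.one_le_abs j.2
  exact_mod_cast h

/-- The sequences `z = (z_j)`, `j` a nonzero integer, with `∑ |z_j|² |j|^{2p} < ∞`. -/
def hSubmodule (p : ℝ) : Submodule ℂ (Zbar → ℂ) where
  carrier := {z | Summable fun j : Zbar => ‖z j‖ ^ 2 * |(j.1 : ℝ)| ^ (2 * p)}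
  zero_mem' := by simp [summable_zero]
  add_mem' := by
    intro a b ha hb
    refine Summable.of_nonneg_of_le (fun j => by positivity) (fun j => ?_)
      ((ha.add hb).mul_left 2)
    have h1 : ‖(a + b) j‖ ≤ ‖a j‖ + ‖b j‖ := norm_add_le _ _
    have h2 : ‖(a + b) j‖ ^ 2 ≤ 2 * (‖a j‖ ^ 2 + ‖b j‖ ^ 2) := by
      nlinarith [sq_nonneg (‖a j‖ - ‖b j‖), norm_nonneg ((a + b) j), norm_nonneg (a j),
        norm_nonneg (b j)]
    have h3 : 0 ≤ |(j.1 : ℝ)| ^ (2 * p) := by positivity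
    nlinarith [mul_le_mul_of_nonneg_right h2 h3]
  smul_mem' := by
    intro c a ha
    refine (ha.mul_left (‖c‖ ^ 2)).congr (fun j => ?_)
    simp [mul_pow, mul_assoc]

/-- The space `h_p` (a type of its own, so that it carries the norm topology and not the topology
of pointwise convergence). -/
def SeqSpace (p : ℝ) : Type := hSubmodule p

instance (p : ℝ) : AddCommGroup (SeqSpace p) := inferInstanceAs (AddCommGroup (hSubmodule p))

instance (p : ℝ) : Module ℂ (SeqSpace p) := inferInstanceAs (Module ℂ (hSubmodule p))

instance (p : ℝ) : CoeFun (SeqSpace p) (fun _ => Zbar → ℂ) := ⟨fun z => z.1⟩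

/-- The weighted sequence `(|j|^p z_j)` as an element of `ℓ²`. -/
def toL2 (p : ℝ) : SeqSpace p →ₗ[ℂ] lp (fun _ : Zbar => ℂ) 2 where
  toFun z := ⟨fun j => ((|(j.1 : ℝ)| ^ p : ℝ) : ℂ) * z j, by
    refine (memℓp_gen_iff (by norm_num)).mpr (z.2.congr fun j => ?_)
    have h0 : (0 : ℝ) ≤ |(j.1 : ℝ)| := abs_nonneg _
    simp only [ENNReal.toReal_ofNat, Real.rpow_two, norm_mul, Complex.norm_real, Real.norm_eq_abs,
      mul_pow, sq_abs]
    rw [mul_comm 2 p, Real.rpow_mul h0, Real.rpow_two, mul_comm]⟩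
  map_add' a b := by
    ext j
    exact mul_add _ (a.1 j) (b.1 j)
  map_smul' c a := by
    ext j
    exact mul_left_comm _ c (a.1 j)

theorem toL2_injective (p : ℝ) : Function.Injective (toL2 p) := by
  intro a b h
  refine Subtype.ext (funext fun j => ?_)
  have h1 : ((|(j.1 : ℝ)| ^ p : ℝ) : ℂ) * a.1 j = ((|(j.1 : ℝ)| ^ p : ℝ) : ℂ) * b.1 j :=
    congrFun (congrArg Subtype.val h) j
  have h2 : (0 : ℝ) < |(j.1 : ℝ)| ^ p :=
    Real.rpow_pos_of_pos (lt_of_lt_of_le one_pos (one_le_abs j)) p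
  exact mul_left_cancel₀ (by exact_mod_cast h2.ne') h1

instance (p : ℝ) : NormedAddCommGroup (SeqSpace p) :=
  NormedAddCommGroup.induced (SeqSpace p) (lp (fun _ : Zbar => ℂ) 2) (toL2 p) (toL2_injective p)

instance (p : ℝ) : NormedSpace ℂ (SeqSpace p) :=
  NormedSpace.induced ℂ (SeqSpace p) (lp (fun _ : Zbar => ℂ) 2) (toL2 p)

/-- The norm of `h_p` is the usual one: `‖z‖_p² = ∑ |z_j|² |j|^{2p}`. -/
theorem norm_sq_eq (p : ℝ) (z : SeqSpace p) :
    ‖z‖ ^ 2 = ∑' j : Zbar, ‖z j‖ ^ 2 * |(j.1 : ℝ)| ^ (2 * p) := by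
  have h := lp.norm_rpow_eq_tsum (p := 2) (by norm_num) (toL2 p z)
  simp only [ENNReal.toReal_ofNat, Real.rpow_two] at h
  refine h.trans (tsum_congr fun j => ?_)
  have h0 : (0 : ℝ) ≤ |(j.1 : ℝ)| := abs_nonneg _
  change ‖((|(j.1 : ℝ)| ^ p : ℝ) : ℂ) * z.1 j‖ ^ 2 = _
  simp only [norm_mul, Complex.norm_real, Real.norm_eq_abs, mul_pow, sq_abs]
  rw [mul_comm 2 p, Real.rpow_mul h0, Real.rpow_two, mul_comm]

/-- The inclusion `h_q ⊆ h_p` for `q = p + 1`. -/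
def incl (p : ℝ) : SeqSpace (p + 1) →ₗ[ℂ] SeqSpace p where
  toFun z := ⟨z.1, by
    refine Summable.of_nonneg_of_le (fun j => by positivity) (fun j => ?_) z.2
    refine mul_le_mul_of_nonneg_left ?_ (by positivity)
    exact Real.rpow_le_rpow_of_exponent_le (one_le_abs j) (by linarith)⟩
  map_add' _ _ := rfl
  map_smul' _ _ := rfl

/-- The `j`-th unit vector of `h_p`. -/
def unitVec (p : ℝ) (j : Zbar) : SeqSpace p :=
  ⟨Pi.single j 1, summable_of_ne_finset_zero (s := {j}) (fun k hk => by
    have hkj : k ≠ j := by simpa using hk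
    simp [Pi.single_eq_of_ne hkj])⟩

/-- The real subspace `z_{-j} = conj z_j` of `h_p`. -/
def IsReal {p : ℝ} (z : SeqSpace p) : Prop := ∀ j : Zbar, z (-j) = starRingEnd ℂ (z j)

/-! ### Analytic Hamiltonian vector fields and symplectic transformations -/

/-- The sign `σ_j` of a nonzero integer. -/
def sgn (j : Zbar) : ℂ := ((Int.sign j.1 : ℤ) : ℂ)

/-- `F` is analytic on `U ⊆ h_p`, and `X` is its Hamiltonian vector field
`X_F = (i σ_j ∂F/∂z_{-j})_j`, which is analytic as a map from `U ⊆ h_p` to `h_{p+1}`. -/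
structure HasAnalyticField {p : ℝ} (F : SeqSpace p → ℂ) (X : SeqSpace p → SeqSpace (p + 1))
    (U : Set (SeqSpace p)) : Prop where
  analytic_fun : AnalyticOnNhd ℂ F U
  analytic_field : AnalyticOnNhd ℂ X U
  field_eq : ∀ z ∈ U, ∀ j : Zbar,
    (X z) j = Complex.I * sgn j * fderiv ℂ F z (unitVec p (-j))

/-- The symplectic form `-i ∑_{j ≥ 1} dz_j ∧ dz_{-j}`. -/
def sympForm {p : ℝ} (v w : SeqSpace p) : ℂ :=
  -Complex.I * ∑' j : ℕ+, (v (pos j) * w (-pos j) - v (-pos j) * w (pos j))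

/-- `Φ` is a real analytic symplectic coordinate transformation of the open neighbourhood `U` of
the origin of `h_p` onto an open set of `h_p`, of the form identity plus a map that is
analytic from `h_p` to `h_{p+1}`. Real analytic means: analytic on an open subset of
the complex space `h_p` and mapping real points to real points. -/
structure IsSymplecticTransformation {p : ℝ} (Φ : SeqSpace p → SeqSpace p) (U : Set (SeqSpace p)) :
    Prop where
  isOpen : IsOpen U
  zero_mem : (0 : SeqSpace p) ∈ U
  map_zero : Φ 0 = 0
  analytic : AnalyticOnNhd ℂ Φ U
  smoothing : ∃ Ψ : SeqSpace p → SeqSpace (p + 1), AnalyticOnNhd ℂ Ψ U ∧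
    ∀ z ∈ U, Φ z = z + incl p (Ψ z)
  real : ∀ z ∈ U, IsReal z → IsReal (Φ z)
  injOn : Set.InjOn Φ U
  isOpen_image : IsOpen (Φ '' U)
  analytic_inv : ∃ Φinv : SeqSpace p → SeqSpace p, AnalyticOnNhd ℂ Φinv (Φ '' U) ∧
    ∀ z ∈ U, Φinv (Φ z) = z
  symplectic : ∀ z ∈ U, ∀ v w : SeqSpace p,
    sympForm (fderiv ℂ Φ z v) (fderiv ℂ Φ z w) = sympForm v w

/-- `Φ` is, on `U`, the time-one map of the flow of the vector field `X`. -/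
def IsTimeOneMap {p : ℝ} (X : SeqSpace p → SeqSpace (p + 1)) (Φ : SeqSpace p → SeqSpace p)
    (U : Set (SeqSpace p)) : Prop :=
  ∀ z ∈ U, ∃ γ : ℝ → SeqSpace p, γ 0 = z ∧ γ 1 = Φ z ∧
    ∀ t ∈ Set.Icc (0 : ℝ) 1, HasDerivWithinAt γ (incl p (X (γ t))) (Set.Icc 0 1) t

/-! ### Homogeneous polynomials on sequences -/

/-- `∑_J c_J z_{J_1} ⋯ z_{J_m}`, the sum over all `m`-tuples of nonzero integers. -/
def poly {m : ℕ} (c : (Fin m → Zbar) → ℂ) {p : ℝ} (z : SeqSpace p) : ℂ :=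
  ∑' J : Fin m → Zbar, c J * ∏ i, z (J i)

/-- The coefficients of the Poisson bracket `{A, B} = dA(X_B) = ∑_j ∂A/∂z_j · i σ_j ∂B/∂z_{-j}`
of `A = ∑ a_J z^J` and `B = ∑ b_K z^K`. -/
def bracketCoeff {m n : ℕ} (a : (Fin (m + 1) → Zbar) → ℂ) (b : (Fin (n + 1) → Zbar) → ℂ)
    (L : Fin (m + n) → Zbar) : ℂ :=
  ∑' j : Zbar, Complex.I * sgn j *
    (∑ i : Fin (m + 1), a (i.insertNth j fun k => L (Fin.castAdd n k))) *
    (∑ i : Fin (n + 1), b (i.insertNth (-j) fun k => L (Fin.natAdd m k)))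

/-! ### The Hamiltonian of the generalized BBM equation -/

/-- `λ_j = j / (1 + j²)`. -/
def freq (j : Zbar) : ℝ := (j.1 : ℝ) / (1 + (j.1 : ℝ) ^ 2)

/-- `δ_j = √(|j| / (1 + j²))`. -/
def delta (j : Zbar) : ℝ := √(|(j.1 : ℝ)| / (1 + (j.1 : ℝ) ^ 2))

/-- `Λ = ∑_{j ≥ 1} λ_j z_j z_{-j}`. -/
def Lam {p : ℝ} (z : SeqSpace p) : ℂ :=
  ∑' j : ℕ+, (freq (pos j) : ℂ) * z (pos j) * z (-pos j)

/-- The coefficients of `G`: `δ_{j_1} ⋯ δ_{j_6} / (120 π²)` if `j_1 + ⋯ + j_6 = 0`, and `0`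
otherwise. -/
def gCoeff (J : Fin 6 → Zbar) : ℂ :=
  if ∑ i, (J i).1 = 0 then ((1 / (120 * Real.pi ^ 2) * ∏ i, delta (J i) : ℝ) : ℂ) else 0

/-- The Hamiltonian `H = Λ + G`. -/
def ham {p : ℝ} (z : SeqSpace p) : ℂ := Lam z + poly gCoeff z

/-! ### Index sets -/

/-- The tangential sites `{±n₁, ±n₂}`. -/
def sites (n₁ n₂ : ℕ+) : Set Zbar := {pos n₁, -pos n₁, pos n₂, -pos n₂}

/-- `z ↦ ẑ`: the components `z_j` with `j ∈ {±n₁, ±n₂}` are replaced by zero. -/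
def hat (n₁ n₂ : ℕ+) {p : ℝ} (z : SeqSpace p) : SeqSpace p :=
  ⟨(sites n₁ n₂)ᶜ.indicator z.1, by
    refine Summable.of_nonneg_of_le (fun j => by positivity) (fun j => ?_) z.2
    refine mul_le_mul_of_nonneg_right ?_ (by positivity)
    exact pow_le_pow_left₀ (norm_nonneg _) (norm_indicator_le_norm_self _ _) 2⟩

/-- The number of components of a tuple outside `{±n₁, ±n₂}`. -/
def numOutside (n₁ n₂ : ℕ+) {m : ℕ} (J : Fin m → Zbar) : ℕ :=
  Set.ncard {i | J i ∉ sites n₁ n₂}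

/-- The tuples with at most `k` components outside `{±n₁, ±n₂}`. -/
def atMost (n₁ n₂ : ℕ+) (m k : ℕ) : Set (Fin m → Zbar) := {J | numOutside n₁ n₂ J ≤ k}

/-- The tuples with at least `k` components outside `{±n₁, ±n₂}`. -/
def atLeast (n₁ n₂ : ℕ+) (m k : ℕ) : Set (Fin m → Zbar) := {J | k ≤ numOutside n₁ n₂ J}

/-- The normal form set (`m` even): up to a permutation, the tuple is
`(a, -a, b, -b, c, -c, …)`. -/
def normalSet (m : ℕ) : Set (Fin m → Zbar) :=
  {J | ∃ τ : Equiv.Perm (Fin m), ∀ (i : ℕ) (h : 2 * i + 1 < m),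
    J (τ ⟨2 * i, by omega⟩) = -J (τ ⟨2 * i + 1, h⟩)}

/-! ### The parts of `G`, the generating function `F` and the terms of order ten -/

/-- Coefficients of `Ḡ`, the normal form part of `G`. -/
def gBar (n₁ n₂ : ℕ+) : (Fin 6 → Zbar) → ℂ :=
  (atMost n₁ n₂ 6 2 ∩ normalSet 6).indicator gCoeff

/-- Coefficients of `G̃`. -/
def gTilde (n₁ n₂ : ℕ+) : (Fin 6 → Zbar) → ℂ :=
  (atMost n₁ n₂ 6 2 \ normalSet 6).indicator gCoeff

/-- Coefficients of `Ĝ`, the part of `G` with at least three components outside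
`{±n₁, ±n₂}`. -/
def gHat (n₁ n₂ : ℕ+) : (Fin 6 → Zbar) → ℂ :=
  (atLeast n₁ n₂ 6 3).indicator gCoeff

/-- Coefficients of `F`: `i F_J = G̃_J / (λ_{j_1} + ⋯ + λ_{j_6})`. -/
def fCoeff (n₁ n₂ : ℕ+) (J : Fin 6 → Zbar) : ℂ :=
  -Complex.I * (gTilde n₁ n₂ J / ((∑ i, freq (J i) : ℝ) : ℂ))

/-- Coefficients of `Ḡ + Ĝ + ½ G̃`. -/
def gMix (n₁ n₂ : ℕ+) : (Fin 6 → Zbar) → ℂ :=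
  fun J => gBar n₁ n₂ J + gHat n₁ n₂ J + 1 / 2 * gTilde n₁ n₂ J

/-- Coefficients of the term of order ten, `{Ḡ + Ĝ + ½ G̃, F}`. -/
def rCoeff (n₁ n₂ : ℕ+) : (Fin 10 → Zbar) → ℂ :=
  bracketCoeff (m := 5) (n := 5) (gMix n₁ n₂) (fCoeff n₁ n₂)

/-- Coefficients of `R̄`: all components in `{±n₁, ±n₂}`, and in the normal form set. -/
def rBar (n₁ n₂ : ℕ+) : (Fin 10 → Zbar) → ℂ :=
  (atMost n₁ n₂ 10 0 ∩ normalSet 10).indicator (rCoeff n₁ n₂)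

/-- Coefficients of `R̃`: at most one component outside `{±n₁, ±n₂}`, and not in the normal form
set. -/
def rTilde (n₁ n₂ : ℕ+) : (Fin 10 → Zbar) → ℂ :=
  (atMost n₁ n₂ 10 1 \ normalSet 10).indicator (rCoeff n₁ n₂)

/-- Coefficients of `R̂`: at least two components outside `{±n₁, ±n₂}`. -/
def rHat (n₁ n₂ : ℕ+) : (Fin 10 → Zbar) → ℂ :=
  (atLeast n₁ n₂ 10 2).indicator (rCoeff n₁ n₂)

end GBBM

end

open GBBM

open scoped ENNReal Topology

noncomputable section

namespace GBBM

/-! ### Diagonals of continuous multilinear maps -/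

section Diagonal

variable {E F : Type*} [NormedAddCommGroup E] [NormedSpace ℂ E] [NormedAddCommGroup F]
  [NormedSpace ℂ F] {m : ℕ}

/-- The derivative of `z ↦ M (z, …, z)`. -/
def diagDeriv (M : ContinuousMultilinearMap ℂ (fun _ : Fin m => E) F) (z : E) : E →L[ℂ] F :=
  (M.linearDeriv fun _ => z).comp (ContinuousLinearMap.pi fun _ => ContinuousLinearMap.id ℂ E)

theorem diagDeriv_apply (M : ContinuousMultilinearMap ℂ (fun _ : Fin m => E) F) (z w : E) :
    diagDeriv M z w = ∑ i, M (Function.update (fun _ => z) i w) := by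
  simp [diagDeriv, ContinuousMultilinearMap.linearDeriv_apply]

theorem hasStrictFDerivAt_diag (M : ContinuousMultilinearMap ℂ (fun _ : Fin m => E) F) (z : E) :
    HasStrictFDerivAt (fun z => M fun _ => z) (diagDeriv M z) z :=
  HasStrictFDerivAt.comp z (M.hasStrictFDerivAt (fun _ => z))
    (ContinuousLinearMap.pi fun _ : Fin m => ContinuousLinearMap.id ℂ E).hasStrictFDerivAt

theorem analyticAt_diag (M : ContinuousMultilinearMap ℂ (fun _ : Fin m => E) F) (z : E) :
    AnalyticAt ℂ (fun z => M fun _ => z) z :=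
  AnalyticAt.fun_comp (g := M) M.analyticAt
    ((ContinuousLinearMap.pi fun _ : Fin m => ContinuousLinearMap.id ℂ E).analyticAt z)

theorem norm_diag_le (M : ContinuousMultilinearMap ℂ (fun _ : Fin m => E) F) (z : E) :
    ‖M fun _ => z‖ ≤ ‖M‖ * ‖z‖ ^ m := by
  simpa using M.le_opNorm fun _ => z

theorem norm_update_le (M : ContinuousMultilinearMap ℂ (fun _ : Fin (m + 1) => E) F) (z w : E)
    (i : Fin (m + 1)) : ‖M (Function.update (fun _ => z) i w)‖ ≤ ‖M‖ * (‖z‖ ^ m * ‖w‖) := by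
  refine (M.le_opNorm _).trans_eq ?_
  rw [Fin.prod_univ_succAbove _ i]
  simp [Fin.succAbove_ne, mul_comm]

theorem norm_diagDeriv_apply_le (M : ContinuousMultilinearMap ℂ (fun _ : Fin (m + 1) => E) F)
    (z w : E) : ‖diagDeriv M z w‖ ≤ (m + 1) * ‖M‖ * ‖z‖ ^ m * ‖w‖ := by
  rw [diagDeriv_apply]
  refine (norm_sum_le _ _).trans ?_
  refine (Finset.sum_le_sum fun i _ => norm_update_le M z w i).trans_eq ?_
  simp
  ring

theorem diagDeriv_zero (M : ContinuousMultilinearMap ℂ (fun _ : Fin m => E) F) (hm : 2 ≤ m) :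
    diagDeriv M 0 = 0 := by
  ext w
  obtain ⟨k, rfl⟩ : ∃ k, m = k + 1 := ⟨m - 1, by omega⟩
  have h := norm_diagDeriv_apply_le M 0 w
  have hk : k ≠ 0 := by omega
  simpa [hk] using h

end Diagonal

/-! ### Curves on the unit interval -/

section Curves

set_option linter.unusedSectionVars false

variable {E F : Type*} [NormedAddCommGroup E] [NormedSpace ℂ E] [NormedAddCommGroup F]
  [NormedSpace ℂ F] {m : ℕ}

/-- The unit time interval. -/
abbrev UI : Type := Set.Icc (0 : ℝ) 1

/-- The extension of a curve on `[0, 1]` to the real line by constants. -/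
def extend (γ : C(UI, E)) : ℝ → E := Set.IccExtend zero_le_one γ

theorem continuous_extend (γ : C(UI, E)) : Continuous (extend γ) := γ.continuous.Icc_extend'

theorem extend_of_mem (γ : C(UI, E)) {t : ℝ} (ht : t ∈ Set.Icc (0 : ℝ) 1) :
    extend γ t = γ ⟨t, ht⟩ := Set.IccExtend_of_mem _ _ ht

theorem norm_extend_le (γ : C(UI, E)) (t : ℝ) : ‖extend γ t‖ ≤ ‖γ‖ := γ.norm_coe_le_norm _

/-- The primitive `t ↦ ∫₀ᵗ γ` of a curve, as a continuous linear map. -/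
def primitive (E : Type*) [NormedAddCommGroup E] [NormedSpace ℂ E] :
    C(UI, E) →L[ℂ] C(UI, E) :=
  LinearMap.mkContinuous
    { toFun := fun γ => ⟨fun t => ∫ s in (0 : ℝ)..t, extend γ s,
        (intervalIntegral.continuous_primitive
          (fun _ _ => (continuous_extend γ).intervalIntegrable _ _) 0).comp continuous_subtype_val⟩
      map_add' := fun γ γ' => by
        ext t
        exact intervalIntegral.integral_add ((continuous_extend γ).intervalIntegrable _ _)
          ((continuous_extend γ').intervalIntegrable _ _)
      map_smul' := fun c γ => by
        ext t
        exact intervalIntegral.integral_smul c (extend γ) }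
    1 (fun γ => by
      rw [one_mul, ContinuousMap.norm_le _ (norm_nonneg _)]
      intro t
      refine (intervalIntegral.norm_integral_le_of_norm_le_const
        (fun s _ => norm_extend_le γ s)).trans ?_
      rw [sub_zero, abs_of_nonneg t.2.1]
      exact mul_le_of_le_one_right (norm_nonneg _) t.2.2)

theorem primitive_apply (γ : C(UI, E)) (t : UI) :
    primitive E γ t = ∫ s in (0 : ℝ)..t, extend γ s := rfl

/-- A continuous multilinear map acts pointwise on curves. -/
def superpose (M : ContinuousMultilinearMap ℂ (fun _ : Fin m => E) F) :
    ContinuousMultilinearMap ℂ (fun _ : Fin m => C(UI, E)) C(UI, F) :=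
  MultilinearMap.mkContinuous
    { toFun := fun γ => ⟨fun t => M fun i => γ i t,
        M.cont.comp (continuous_pi fun i => (γ i).continuous)⟩
      map_update_add' := fun γ i x y => by
        ext t
        have h : ∀ w : C(UI, E), (fun k => (Function.update γ i w k) t)
            = Function.update (fun k => γ k t) i (w t) := fun w => by
          ext k
          by_cases hk : k = i
          · subst hk; simp
          · simp [hk]
        have h1 := M.map_update_add (fun k => γ k t) i (x t) (y t)
        rw [← ContinuousMap.add_apply, ← h, ← h, ← h] at h1
        exact h1
      map_update_smul' := fun γ i c x => by
        ext t
        have h : ∀ w : C(UI, E), (fun k => (Function.update γ i w k) t)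
            = Function.update (fun k => γ k t) i (w t) := fun w => by
          ext k
          by_cases hk : k = i
          · subst hk; simp
          · simp [hk]
        have h1 := M.map_update_smul (fun k => γ k t) i c (x t)
        rw [← ContinuousMap.smul_apply, ← h, ← h] at h1
        exact h1 }
    ‖M‖ (fun γ => by
      rw [ContinuousMap.norm_le _ (by positivity)]
      intro t
      refine (M.le_opNorm _).trans (mul_le_mul_of_nonneg_left ?_ (norm_nonneg _))
      exact Finset.prod_le_prod (fun _ _ => norm_nonneg _)
        fun i _ => (γ i).norm_coe_le_norm t)

theorem superpose_apply (M : ContinuousMultilinearMap ℂ (fun _ : Fin m => E) F)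
    (γ : Fin m → C(UI, E)) (t : UI) : superpose M γ t = M fun i => γ i t := rfl

theorem diagDeriv_superpose (M : ContinuousMultilinearMap ℂ (fun _ : Fin m => E) F)
    (γ η : C(UI, E)) (t : UI) :
    diagDeriv (superpose M) γ η t = diagDeriv M (γ t) (η t) := by
  rw [diagDeriv_apply, diagDeriv_apply, ContinuousMap.sum_apply]
  refine Finset.sum_congr rfl fun i _ => ?_
  rw [superpose_apply]
  congr 1
  ext k
  by_cases hk : k = i
  · subst hk; simp
  · simp [hk]

end Curves

/-! ### The flow of a homogeneous polynomial vector field near the origin -/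

section Flow

set_option linter.unusedSectionVars false

variable {E F : Type*} [NormedAddCommGroup E] [NormedSpace ℂ E] [NormedAddCommGroup F]
  [NormedSpace ℂ F] {m : ℕ}

/-- `γ` is an integral curve on `[0, 1]`, starting at `z`, of `z ↦ ι (M (z, …, z))`. -/
def IsFlowLine (M : ContinuousMultilinearMap ℂ (fun _ : Fin m => E) F) (ι : F →L[ℂ] E) (z : E)
    (γ : C(UI, E)) : Prop :=
  ∀ t : UI, γ t = z + ι (primitive F (superpose M fun _ => γ) t)

variable (E) in
/-- Constant curves. -/
def constCurve : E →L[ℂ] C(UI, E) :=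
  LinearMap.mkContinuous
    { toFun := fun z => ContinuousMap.const _ z
      map_add' := fun _ _ => rfl
      map_smul' := fun _ _ => rfl } 1 (fun z => by
      rw [one_mul, ContinuousMap.norm_le _ (norm_nonneg _)]
      intro t
      rfl)

/-- Postcomposition of curves with a continuous linear map. -/
def postcomp (ι : F →L[ℂ] E) : C(UI, F) →L[ℂ] C(UI, E) := ι.compLeftContinuous ℂ UI

variable [CompleteSpace E] [CompleteSpace F]

/-- The curves starting near the origin depend analytically on the initial value. -/
theorem exists_flow (M : ContinuousMultilinearMap ℂ (fun _ : Fin m => E) F) (hm : 2 ≤ m)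
    (ι : F →L[ℂ] E) :
    ∃ Γ : E → C(UI, E), AnalyticAt ℂ Γ 0 ∧ Γ 0 = 0 ∧ HasStrictFDerivAt Γ (constCurve E) 0 ∧
      (∀ᶠ z in 𝓝 0, IsFlowLine M ι z (Γ z)) ∧
      ∃ r > 0, ∀ z γ γ', ‖γ‖ < r → ‖γ'‖ < r → IsFlowLine M ι z γ → IsFlowLine M ι z γ' →
        γ = γ' := by
  set L : C(UI, F) →L[ℂ] C(UI, E) := (postcomp ι).comp (primitive F) with hL
  set N : C(UI, E) → C(UI, F) := fun γ => superpose M fun _ => γ with hN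
  set A : C(UI, E) → C(UI, E) := fun γ => γ - L (N γ) with hA
  have hfl : ∀ z γ, A γ = constCurve E z ↔ IsFlowLine M ι z γ := by
    intro z γ
    rw [hA, sub_eq_iff_eq_add, ContinuousMap.ext_iff]
    exact Iff.rfl
  have hNan : AnalyticAt ℂ N 0 := analyticAt_diag _ _
  have hAan : AnalyticAt ℂ A 0 := analyticAt_id.sub ((L.analyticAt _).comp hNan)
  have hA0 : A 0 = 0 := by
    have : N 0 = 0 := by
      have := norm_diag_le (superpose M) 0
      simpa [show m ≠ 0 by omega] using this
    simp [hA, this]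
  have hAd : HasStrictFDerivAt A
      ((ContinuousLinearEquiv.refl ℂ C(UI, E) : C(UI, E) ≃L[ℂ] C(UI, E)) :
        C(UI, E) →L[ℂ] C(UI, E)) 0 := by
    have h1 : HasStrictFDerivAt N (diagDeriv (superpose M) 0) 0 := hasStrictFDerivAt_diag _ _
    rw [diagDeriv_zero _ hm] at h1
    have h2 := (hasStrictFDerivAt_id (𝕜 := ℂ) (0 : C(UI, E))).sub (L.hasStrictFDerivAt.comp 0 h1)
    refine h2.congr_fderiv ?_
    ext γ t
    simp
  set g := hAd.localInverse with hg
  have hgan : AnalyticAt ℂ g 0 := by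
    have h := (hAan.contDiffAt (n := ⊤)).to_localInverse hAd.hasFDerivAt (by simp)
    rw [hA0] at h
    exact h.analyticAt
  have hg0 : g 0 = 0 := by
    have h := hAd.localInverse_apply_image
    rwa [hA0] at h
  have hgd := hAd.to_localInverse
  rw [hA0] at hgd
  have hright := hAd.eventually_right_inverse
  rw [hA0] at hright
  have hc0 : constCurve E 0 = 0 := map_zero _
  have hct : Filter.Tendsto (constCurve E) (𝓝 0) (𝓝 0) := by
    have h := (constCurve E).continuous.tendsto 0
    rwa [hc0] at h
  refine ⟨fun z => g (constCurve E z), ?_, ?_, ?_, ?_, ?_⟩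
  · exact AnalyticAt.fun_comp (by rwa [hc0]) ((constCurve E).analyticAt 0)
  · simp only [hc0, hg0]
  · have h := HasStrictFDerivAt.comp (f := constCurve E) (g := g) 0 (by rw [hc0]; exact hgd)
      (constCurve E).hasStrictFDerivAt
    exact h.congr_fderiv rfl
  · filter_upwards [hct.eventually hright] with z hz
    exact (hfl z _).1 hz
  · obtain ⟨r, hr, hball⟩ := Metric.eventually_nhds_iff_ball.1 hAd.eventually_left_inverse
    refine ⟨r, hr, fun z γ γ' hγ hγ' h h' => ?_⟩
    rw [← hball γ (by simpa using hγ), ← hball γ' (by simpa using hγ'), (hfl z γ).2 h,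
      (hfl z γ').2 h']

/-- A curve given by an integral equation is differentiable. -/
theorem hasDerivWithinAt_extend {ι : F →L[ℂ] E} {z : E} {γ : C(UI, E)} {ρ : C(UI, F)}
    (h : ∀ t : UI, γ t = z + ι (primitive F ρ t)) {t : ℝ} (ht : t ∈ Set.Icc (0 : ℝ) 1) :
    HasDerivWithinAt (extend γ) (ι (extend ρ t)) (Set.Icc 0 1) t := by
  have h1 : HasDerivAt (fun u => ∫ s in (0 : ℝ)..u, extend ρ s) (extend ρ t) t :=
    intervalIntegral.integral_hasDerivAt_right ((continuous_extend ρ).intervalIntegrable _ _)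
      ((continuous_extend ρ).stronglyMeasurableAtFilter _ _) (continuous_extend ρ).continuousAt
  have h2 := ((ι.restrictScalars ℝ).hasFDerivAt.comp_hasDerivAt t h1).const_add z
  refine h2.hasDerivWithinAt.congr_of_mem (fun s hs => ?_) ht
  rw [extend_of_mem γ hs, h]
  rfl

/-- The variational equation. -/
theorem fderiv_flow {M : ContinuousMultilinearMap ℂ (fun _ : Fin m => E) F} {ι : F →L[ℂ] E}
    {Γ : E → C(UI, E)} {z : E} (hΓ : DifferentiableAt ℂ Γ z)
    (h : ∀ᶠ y in 𝓝 z, IsFlowLine M ι y (Γ y)) (v : E) (t : UI) :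
    fderiv ℂ Γ z v t =
      v + ι (primitive F (diagDeriv (superpose M) (Γ z) (fderiv ℂ Γ z v)) t) := by
  have h1 : HasFDerivAt (fun y => constCurve E y +
      (postcomp ι).comp (primitive F) (superpose M fun _ => Γ y))
      (constCurve E + ((postcomp ι).comp (primitive F)).comp
        ((diagDeriv (superpose M) (Γ z)).comp (fderiv ℂ Γ z))) z :=
    (constCurve E).hasFDerivAt.add (((postcomp ι).comp (primitive F)).hasFDerivAt.comp z
      ((hasStrictFDerivAt_diag (superpose M) (Γ z)).hasFDerivAt.comp z hΓ.hasFDerivAt))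
  have h2 : Γ =ᶠ[𝓝 z] fun y => constCurve E y +
      (postcomp ι).comp (primitive F) (superpose M fun _ => Γ y) := by
    filter_upwards [h] with y hy
    ext t
    exact hy t
  have h3 := (h1.congr_of_eventuallyEq h2).fderiv
  conv_lhs => rw [h3]
  rfl

end Flow

/-! ### The Cauchy–Schwarz inequality for sums in `[0, ∞]` -/

theorem ENNReal_tsum_mul_sq_le {ι : Type*} (f g : ι → ℝ≥0∞) :
    (∑' i, f i * g i) ^ 2 ≤ (∑' i, f i ^ 2) * ∑' i, g i ^ 2 := by
  let _ : MeasurableSpace ι := ⊤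
  have h := ENNReal.lintegral_mul_le_Lp_mul_Lq (MeasureTheory.Measure.count : MeasureTheory.Measure ι)
    Real.HolderConjugate.two_two (f := f) (g := g) (measurable_from_top).aemeasurable
    (measurable_from_top).aemeasurable
  simp only [MeasureTheory.lintegral_count, Pi.mul_apply, ENNReal.rpow_two] at h
  calc (∑' i, f i * g i) ^ 2
      ≤ ((∑' i, f i ^ 2) ^ (1 / 2 : ℝ) * (∑' i, g i ^ 2) ^ (1 / 2 : ℝ)) ^ 2 := by gcongr
    _ = _ := by
        rw [mul_pow, ← ENNReal.rpow_two, ← ENNReal.rpow_two, ← ENNReal.rpow_mul,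
          ← ENNReal.rpow_mul]
        norm_num

theorem le_of_sq_le_sq {a b : ℝ≥0∞} (h : a ^ 2 ≤ b ^ 2) : a ≤ b :=
  (ENNReal.pow_right_strictMono two_ne_zero).le_iff_le.1 h

/-! ### The sequence spaces -/

instance : InvolutiveNeg Zbar := ⟨fun j => Subtype.ext (neg_neg j.1)⟩

theorem neg_val (j : Zbar) : (-j).1 = -j.1 := rfl

theorem abs_pos' (j : Zbar) : 0 < |(j.1 : ℝ)| := lt_of_lt_of_le one_pos (one_le_abs j)

theorem zbar_ext {j k : Zbar} (h : j.1 = k.1) : j = k := Subtype.ext h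

/-- The weight `|j|^s`. -/
def wt (s : ℝ) (j : Zbar) : ℝ≥0∞ := ENNReal.ofReal (|(j.1 : ℝ)| ^ s)

theorem wt_neg (s : ℝ) (j : Zbar) : wt s (-j) = wt s j := by simp [wt, neg_val]

theorem wt_add (s t : ℝ) (j : Zbar) : wt (s + t) j = wt s j * wt t j := by
  rw [wt, wt, wt, ← ENNReal.ofReal_mul (by positivity), Real.rpow_add (abs_pos' j)]

theorem wt_zero (j : Zbar) : wt 0 j = 1 := by simp [wt]

theorem wt_mono {s t : ℝ} (h : s ≤ t) (j : Zbar) : wt s j ≤ wt t j :=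
  ENNReal.ofReal_le_ofReal (Real.rpow_le_rpow_of_exponent_le (one_le_abs j) h)

theorem one_le_wt {s : ℝ} (h : 0 ≤ s) (j : Zbar) : 1 ≤ wt s j := by
  simpa [wt_zero] using wt_mono h j

theorem ofReal_weighted (p : ℝ) (f : Zbar → ℂ) (j : Zbar) :
    ENNReal.ofReal (‖f j‖ ^ 2 * |(j.1 : ℝ)| ^ (2 * p)) = (wt p j * ‖f j‖ₑ) ^ 2 := by
  rw [mul_comm 2 p, Real.rpow_mul (abs_nonneg _), Real.rpow_two, ← mul_pow,
    ENNReal.ofReal_pow (by positivity), ENNReal.ofReal_mul (by positivity), ofReal_norm, mul_comm,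
    wt]

theorem tsum_enorm_sq {p : ℝ} (z : SeqSpace p) : ∑' j, (wt p j * ‖z j‖ₑ) ^ 2 = ‖z‖ₑ ^ 2 := by
  rw [← ofReal_norm, ← ENNReal.ofReal_pow (norm_nonneg _), norm_sq_eq,
    ENNReal.ofReal_tsum_of_nonneg (fun j => by positivity) z.2]
  exact tsum_congr fun j => (ofReal_weighted p z j).symm

theorem mem_hSubmodule_of_tsum {p : ℝ} {f : Zbar → ℂ} (h : ∑' j, (wt p j * ‖f j‖ₑ) ^ 2 ≠ ∞) :
    f ∈ hSubmodule p := by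
  have h1 : ∑' j, ENNReal.ofReal (‖f j‖ ^ 2 * |(j.1 : ℝ)| ^ (2 * p)) ≠ ∞ := by
    rwa [tsum_congr (ofReal_weighted p f)]
  have h2 := ENNReal.summable_toReal h1
  refine h2.congr fun j => ?_
  rw [ENNReal.toReal_ofReal (by positivity)]

theorem seq_ext {p : ℝ} {a b : SeqSpace p} (h : ∀ j, a j = b j) : a = b :=
  Subtype.ext (funext h)

@[simp] theorem add_coord {p : ℝ} (a b : SeqSpace p) (j : Zbar) : (a + b) j = a j + b j := rfl

@[simp] theorem sub_coord {p : ℝ} (a b : SeqSpace p) (j : Zbar) : (a - b) j = a j - b j := rfl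

@[simp] theorem smul_coord {p : ℝ} (c : ℂ) (a : SeqSpace p) (j : Zbar) : (c • a) j = c * a j := rfl

/-- The weighted isometry onto `ℓ²`. -/
def toL2Equiv (p : ℝ) : SeqSpace p ≃ₗᵢ[ℂ] lp (fun _ : Zbar => ℂ) 2 :=
  { LinearEquiv.ofBijective (toL2 p) ⟨toL2_injective p, fun a => by
      have hw : ∀ j : Zbar, ((|(j.1 : ℝ)| ^ p : ℝ) : ℂ) ≠ 0 := fun j => by
        exact_mod_cast (Real.rpow_pos_of_pos (abs_pos' j) p).ne'
      have ha := (memℓp_gen_iff (p := 2) (by norm_num)).1 a.2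
      refine ⟨⟨fun j => ((|(j.1 : ℝ)| ^ p : ℝ) : ℂ)⁻¹ * a j, ?_⟩, ?_⟩
      · refine ha.congr fun j => ?_
        have h0 : (0 : ℝ) < |(j.1 : ℝ)| ^ p := Real.rpow_pos_of_pos (abs_pos' j) p
        simp only [ENNReal.toReal_ofNat, Real.rpow_two, norm_mul, norm_inv, Complex.norm_real,
          Real.norm_eq_abs, abs_of_pos h0]
        rw [mul_comm 2 p, Real.rpow_mul (abs_nonneg _), Real.rpow_two]
        field_simp
      · ext j
        exact mul_inv_cancel_left₀ (hw j) (a j)⟩ with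
    norm_map' := fun _ => rfl }

theorem toL2Equiv_apply (p : ℝ) (z : SeqSpace p) (j : Zbar) :
    toL2Equiv p z j = ((|(j.1 : ℝ)| ^ p : ℝ) : ℂ) * z j := rfl

instance (p : ℝ) : CompleteSpace (SeqSpace p) :=
  (toL2Equiv p).isometry.isUniformInducing.completeSpace_congr (toL2Equiv p).surjective |>.2
    inferInstance

/-- The coordinate functionals. -/
def coord (p : ℝ) (j : Zbar) : SeqSpace p →ₗ[ℂ] ℂ where
  toFun z := z j
  map_add' _ _ := rfl
  map_smul' _ _ := rfl

@[simp] theorem coord_apply (p : ℝ) (j : Zbar) (z : SeqSpace p) : coord p j z = z j := rfl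

theorem hasSum_unitVec {p : ℝ} (z : SeqSpace p) : HasSum (fun j => z j • unitVec p j) z := by
  have h := (lp.hasSum_single (p := 2) (by norm_num) (toL2Equiv p z)).mapL
    ((toL2Equiv p).symm : lp (fun _ : Zbar => ℂ) 2 →L[ℂ] SeqSpace p)
  have h2 : ((toL2Equiv p).symm : lp (fun _ : Zbar => ℂ) 2 →L[ℂ] SeqSpace p) (toL2Equiv p z) = z :=
    (toL2Equiv p).symm_apply_apply z
  rw [h2] at h
  refine h.congr_fun fun j => ?_
  refine ((toL2Equiv p).symm_apply_eq).2 ?_ |>.symm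
  ext k
  rw [toL2Equiv_apply]
  change (lp.single (E := fun _ : Zbar => ℂ) 2 j (toL2Equiv p z j)) k = _ * (z j * (Pi.single j 1 : Zbar → ℂ) k)
  by_cases hk : k = j
  · subst hk
    simp [toL2Equiv_apply]
  · simp [hk]

theorem hasSum_clm_unitVec {p : ℝ} (ℓ : SeqSpace p →L[ℂ] ℂ) (z : SeqSpace p) :
    HasSum (fun j => z j * ℓ (unitVec p j)) (ℓ z) := by
  simpa using (hasSum_unitVec z).mapL ℓ

theorem unitVec_same (p : ℝ) (j : Zbar) : (unitVec p j) j = 1 := Pi.single_eq_same j 1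

theorem unitVec_of_ne (p : ℝ) {j k : Zbar} (h : k ≠ j) : (unitVec p j) k = 0 :=
  Pi.single_eq_of_ne h 1

/-- The inclusion `h_{p+1} ⊆ h_p` is continuous. -/
def inclL (p : ℝ) : SeqSpace (p + 1) →L[ℂ] SeqSpace p :=
  (incl p).mkContinuous 1 (fun z => by
    have h : ‖incl p z‖ₑ ^ 2 ≤ ‖z‖ₑ ^ 2 := by
      rw [← tsum_enorm_sq, ← tsum_enorm_sq]
      refine ENNReal.tsum_le_tsum fun j => ?_
      exact pow_le_pow_left' (mul_le_mul_left (wt_mono (by linarith) j) _) 2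
    have h2 := le_of_sq_le_sq h
    rw [one_mul]
    exact enorm_le_iff_norm_le.1 h2)

@[simp] theorem inclL_apply (p : ℝ) (z : SeqSpace (p + 1)) : inclL p z = incl p z := rfl

@[simp] theorem incl_coord (p : ℝ) (z : SeqSpace (p + 1)) (j : Zbar) : (incl p z) j = z j := rfl

/-! ### The symplectic form -/

/-- A nonzero integer is plus or minus a positive integer. -/
def signEquiv : ℕ+ ⊕ ℕ+ ≃ Zbar :=
  Equiv.ofBijective (Sum.elim pos fun n => -pos n) (by
    constructor
    · rintro (a | a) (b | b) h
      · have := congrArg Subtype.val h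
        simp [pos] at this
        rw [this]
      · have h1 : (a : ℤ) = -(b : ℤ) := congrArg Subtype.val h
        have := a.pos; have := b.pos
        omega
      · have h1 : -(a : ℤ) = (b : ℤ) := congrArg Subtype.val h
        have := a.pos; have := b.pos
        omega
      · have h1 : -(a : ℤ) = -(b : ℤ) := congrArg Subtype.val h
        have : a = b := PNat.coe_injective (by omega)
        rw [this]
    · intro j
      rcases lt_or_gt_of_ne j.2 with h | h
      · refine ⟨Sum.inr ⟨(-j.1).toNat, by omega⟩, zbar_ext ?_⟩
        change -(((-j.1).toNat : ℕ) : ℤ) = j.1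
        omega
      · refine ⟨Sum.inl ⟨j.1.toNat, by omega⟩, zbar_ext ?_⟩
        change ((j.1.toNat : ℕ) : ℤ) = j.1
        omega)

theorem sgn_pos (n : ℕ+) : sgn (pos n) = 1 := by
  have : Int.sign (n : ℤ) = 1 := Int.sign_eq_one_of_pos (by exact_mod_cast n.pos)
  simp [sgn, pos, this]

theorem sgn_neg (j : Zbar) : sgn (-j) = -sgn j := by simp [sgn, neg_val, Int.sign_neg]

theorem sgn_mul_self (j : Zbar) : sgn j * sgn j = 1 := by
  rcases lt_or_gt_of_ne j.2 with h | h
  · simp [sgn, Int.sign_eq_neg_one_of_neg h]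
  · simp [sgn, Int.sign_eq_one_of_pos h]

theorem norm_sgn (j : Zbar) : ‖sgn j‖ = 1 := by
  rcases lt_or_gt_of_ne j.2 with h | h
  · simp [sgn, Int.sign_eq_neg_one_of_neg h]
  · simp [sgn, Int.sign_eq_one_of_pos h]

theorem tsum_zbar {f : Zbar → ℂ} (hf : Summable f) :
    ∑' j, f j = ∑' n : ℕ+, (f (pos n) + f (-pos n)) := by
  have hs := (signEquiv.summable_iff (f := f)).2 hf
  have h1 : Summable fun n : ℕ+ => f (pos n) := hs.comp_injective Sum.inl_injective
  have h2 : Summable fun n : ℕ+ => f (-pos n) := hs.comp_injective Sum.inr_injective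
  have h3 := Summable.tsum_sum (f := f ∘ signEquiv) h1 h2
  rw [h1.tsum_add h2]
  exact (signEquiv.tsum_eq f).symm.trans h3

theorem tsum_enorm_pairing_le {p : ℝ} (hp : 0 ≤ p) (v w : SeqSpace p) :
    ∑' j, ‖v j * w (-j)‖ₑ ≤ ‖v‖ₑ * ‖w‖ₑ := by
  have h1 : ∀ z : SeqSpace p, ∑' j, ‖z j‖ₑ ^ 2 ≤ ‖z‖ₑ ^ 2 := fun z => by
    rw [← tsum_enorm_sq]
    refine ENNReal.tsum_le_tsum fun j => pow_le_pow_left' ?_ 2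
    exact le_mul_of_one_le_left' (one_le_wt hp j)
  refine le_of_sq_le_sq ?_
  simp only [enorm_mul]
  refine (ENNReal_tsum_mul_sq_le _ _).trans ?_
  rw [mul_pow]
  refine mul_le_mul' (h1 v) (le_trans (le_of_eq ?_) (h1 w))
  exact (Equiv.neg Zbar).tsum_eq fun j => ‖w j‖ₑ ^ 2

theorem summable_pairing {p : ℝ} (hp : 0 ≤ p) (v w : SeqSpace p) :
    Summable fun j => sgn j * (v j * w (-j)) := by
  refine Summable.of_norm ?_
  simp only [norm_mul, norm_sgn, one_mul]
  simp only [← norm_mul]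
  refine tsum_enorm_ne_top_iff_summable_norm.1 (ne_top_of_le_ne_top ?_ (tsum_enorm_pairing_le hp v w))
  exact ENNReal.mul_ne_top enorm_ne_top enorm_ne_top

theorem sympForm_eq_tsum {p : ℝ} (hp : 0 ≤ p) (v w : SeqSpace p) :
    sympForm v w = -Complex.I * ∑' j, sgn j * (v j * w (-j)) := by
  rw [tsum_zbar (summable_pairing hp v w), sympForm]
  congr 1
  refine tsum_congr fun n => ?_
  rw [sgn_neg, sgn_pos, neg_neg]
  ring

/-- The symplectic form as a continuous bilinear form. -/
def sympL {p : ℝ} (hp : 0 ≤ p) : SeqSpace p →L[ℂ] SeqSpace p →L[ℂ] ℂ :=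
  LinearMap.mkContinuous₂
    (LinearMap.mk₂ ℂ sympForm
      (fun a b c => by
        simp only [sympForm_eq_tsum hp]
        rw [← mul_add, ← (summable_pairing hp a c).tsum_add (summable_pairing hp b c)]
        congr 1
        exact tsum_congr fun j => by simp; ring)
      (fun r a c => by
        simp only [sympForm_eq_tsum hp, smul_eq_mul]
        rw [mul_left_comm r, ← tsum_mul_left (a := r)]
        congr 1
        exact tsum_congr fun j => by simp; ring)
      (fun a b c => by
        simp only [sympForm_eq_tsum hp]
        rw [← mul_add, ← (summable_pairing hp a b).tsum_add (summable_pairing hp a c)]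
        congr 1
        exact tsum_congr fun j => by simp; ring)
      (fun r a c => by
        simp only [sympForm_eq_tsum hp, smul_eq_mul]
        rw [mul_left_comm r, ← tsum_mul_left (a := r)]
        congr 1
        exact tsum_congr fun j => by simp; ring))
    1 (fun v w => by
      rw [one_mul, LinearMap.mk₂_apply, sympForm_eq_tsum hp, norm_mul, norm_neg, Complex.norm_I,
        one_mul]
      have h : ‖∑' j, sgn j * (v j * w (-j))‖ₑ ≤ ‖v‖ₑ * ‖w‖ₑ := by
        refine enorm_tsum_le_tsum_enorm.trans (le_trans (le_of_eq ?_) (tsum_enorm_pairing_le hp v w))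
        refine tsum_congr fun j => ?_
        rw [enorm_mul, ← ofReal_norm (sgn j), norm_sgn, ENNReal.ofReal_one, one_mul]
      rw [← ofReal_norm, ← ofReal_norm, ← ofReal_norm, ← ENNReal.ofReal_mul (norm_nonneg _)] at h
      exact (ENNReal.ofReal_le_ofReal_iff (by positivity)).1 h)

@[simp] theorem sympL_apply {p : ℝ} (hp : 0 ≤ p) (v w : SeqSpace p) :
    sympL hp v w = sympForm v w := rfl

theorem sympForm_swap {p : ℝ} (v w : SeqSpace p) : sympForm v w = -sympForm w v := by
  rw [sympForm, sympForm, ← mul_neg, ← tsum_neg]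
  congr 1
  exact tsum_congr fun j => by ring

theorem sympForm_unitVec {p : ℝ} (hp : 0 ≤ p) (v : SeqSpace p) (j : Zbar) :
    sympForm v (unitVec p (-j)) = -Complex.I * sgn j * v j := by
  rw [sympForm_eq_tsum hp, tsum_eq_single j, unitVec_same]
  · ring
  · intro k hk
    rw [unitVec_of_ne p (fun h => hk (neg_injective h))]
    simp

/-! ### Bounds for `δ` -/

theorem delta_nonneg (j : Zbar) : 0 ≤ delta j := Real.sqrt_nonneg _

theorem delta_neg (j : Zbar) : delta (-j) = delta j := by simp [delta, neg_val]

theorem delta_sq (j : Zbar) : delta j ^ 2 = |(j.1 : ℝ)| / (1 + (j.1 : ℝ) ^ 2) :=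
  Real.sq_sqrt (by positivity)

theorem delta_le_rpow (j : Zbar) : delta j ≤ |(j.1 : ℝ)| ^ (-(1 / 2) : ℝ) := by
  have h := abs_pos' j
  rw [Real.rpow_neg h.le, ← Real.sqrt_eq_rpow, ← Real.sqrt_inv]
  refine Real.sqrt_le_sqrt ?_
  rw [div_le_iff₀ (by positivity), ← sq_abs, inv_mul_eq_div, le_div_iff₀ h]
  nlinarith

theorem delta_le_one (j : Zbar) : delta j ≤ 1 := by
  refine (delta_le_rpow j).trans (Real.rpow_le_one_of_one_le_of_nonpos (one_le_abs j) (by norm_num))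

/-- `δ_j` as an element of `[0, ∞]`. -/
def de (j : Zbar) : ℝ≥0∞ := ENNReal.ofReal (delta j)

theorem de_le_wt (j : Zbar) : de j ≤ wt (-(1 / 2)) j := ENNReal.ofReal_le_ofReal (delta_le_rpow j)

theorem de_le_one (j : Zbar) : de j ≤ 1 := by
  simpa [de] using ENNReal.ofReal_le_ofReal (delta_le_one j)

theorem wt_mul_de_le (s : ℝ) (j : Zbar) : wt (s + 1 / 2) j * de j ≤ wt s j := by
  calc wt (s + 1 / 2) j * de j ≤ wt (s + 1 / 2) j * wt (-(1 / 2)) j := by gcongr; exact de_le_wt j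
    _ = wt s j := by rw [← wt_add]; congr 1; ring

/-! ### Sums over tuples -/

theorem tsum_pi_prod {m : ℕ} (f : Fin m → Zbar → ℝ≥0∞) :
    ∑' J : Fin m → Zbar, ∏ i, f i (J i) = ∏ i, ∑' j, f i j := by
  induction m with
  | zero => simp
  | succ n ih =>
    rw [← (Fin.insertNthEquiv (fun _ => Zbar) 0).tsum_eq, ENNReal.tsum_prod', Fin.prod_univ_succ,
      ← ih, ← ENNReal.tsum_mul_right]
    refine tsum_congr fun a => ?_
    rw [← ENNReal.tsum_mul_left]
    refine tsum_congr fun L => ?_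
    rw [Fin.prod_univ_succ]
    simp

theorem tsum_ite_le_one {α : Type*} (P : α → Prop) [DecidablePred P]
    (h : ∀ a b, P a → P b → a = b) : ∑' a, (if P a then 1 else 0 : ℝ≥0∞) ≤ 1 := by
  by_cases hP : ∃ a, P a
  · obtain ⟨a, ha⟩ := hP
    rw [tsum_eq_single a fun b hb => if_neg fun hb' => hb (h b a hb' ha)]
    simp [ha]
  · push Not at hP
    simp [hP]

/-- The constant of the embedding of `δ h_p` into `ℓ¹`. -/
def ellConst (p : ℝ) : ℝ≥0∞ := (∑' j, wt (-(p + 1 / 2)) j ^ 2) ^ (1 / 2 : ℝ)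

theorem ellConst_ne_top {p : ℝ} (hp : 0 < p) : ellConst p ≠ ∞ := by
  refine ENNReal.rpow_ne_top_of_nonneg (by norm_num) ?_
  have h : Summable fun j : Zbar => |(j.1 : ℝ)| ^ (-(2 * p + 1)) :=
    (Real.summable_abs_int_rpow (b := 2 * p + 1) (by linarith)).comp_injective
      Subtype.val_injective
  have h2 : ∀ j : Zbar, wt (-(p + 1 / 2)) j ^ 2 = ENNReal.ofReal (|(j.1 : ℝ)| ^ (-(2 * p + 1))) :=
    fun j => by
      rw [sq, ← wt_add, wt]
      congr 2
      ring
  rw [tsum_congr h2]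
  exact h.tsum_ofReal_ne_top

theorem tsum_de_mul_le (p : ℝ) (z : SeqSpace p) :
    ∑' j, de j * ‖z j‖ₑ ≤ ellConst p * ‖z‖ₑ := by
  have h1 : ∀ j, de j * ‖z j‖ₑ ≤ wt (-(p + 1 / 2)) j * (wt p j * ‖z j‖ₑ) := fun j => by
    rw [← mul_assoc, ← wt_add]
    refine mul_le_mul_left ?_ _
    refine (de_le_wt j).trans_eq ?_
    congr 1
    ring
  refine (ENNReal.tsum_le_tsum h1).trans (le_of_sq_le_sq ?_)
  refine (ENNReal_tsum_mul_sq_le _ _).trans ?_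
  have h2 : ellConst p ^ 2 = ∑' j, wt (-(p + 1 / 2)) j ^ 2 := by
    rw [ellConst, ← ENNReal.rpow_natCast, ← ENNReal.rpow_mul]
    norm_num
  rw [tsum_enorm_sq, mul_pow, h2]

theorem tsum_form_le {p : ℝ} {m : ℕ} (v : Fin m → SeqSpace p) :
    ∑' J : Fin m → Zbar, ∏ k, de (J k) * ‖v k (J k)‖ₑ ≤ ellConst p ^ m * ∏ k, ‖v k‖ₑ := by
  rw [tsum_pi_prod fun k j => de j * ‖v k j‖ₑ]
  refine (Finset.prod_le_prod' fun k _ => tsum_de_mul_le p (v k)).trans_eq ?_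
  rw [Finset.prod_mul_distrib]
  simp

/-! ### The convolution estimate -/

theorem tsum_conv_sq_le {n : ℕ} (f : Zbar → ℝ≥0∞) (g : (Fin n → Zbar) → ℝ≥0∞) :
    ∑' j : Zbar, (∑' x : Zbar × (Fin n → Zbar),
      (if x.1.1 + ∑ i, (x.2 i).1 = j.1 then 1 else 0) * (f x.1 * g x.2)) ^ 2
      ≤ (∑' a, f a ^ 2) * (∑' L, g L) ^ 2 := by
  set ind : Zbar → Zbar × (Fin n → Zbar) → ℝ≥0∞ :=
    fun j x => if x.1.1 + ∑ i, (x.2 i).1 = j.1 then 1 else 0 with hind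
  have hind2 : ∀ j x, ind j x ^ 2 = ind j x := fun j x => by
    simp only [hind]; split_ifs <;> simp
  have hroot : ∀ a : ℝ≥0∞, (a ^ (1 / 2 : ℝ)) ^ 2 = a := fun a => by
    rw [← ENNReal.rpow_two, ← ENNReal.rpow_mul]; norm_num
  have h1 : ∀ j, (∑' x, ind j x * (f x.1 * g x.2)) ^ 2
      ≤ (∑' x, ind j x * (f x.1 ^ 2 * g x.2)) * ∑' L, g L := fun j => by
    have e : ∀ x : Zbar × (Fin n → Zbar), ind j x * (f x.1 * g x.2)
        = (ind j x * f x.1 * g x.2 ^ (1 / 2 : ℝ)) * (ind j x * g x.2 ^ (1 / 2 : ℝ)) := fun x => by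
      conv_lhs => rw [← hind2, ← hroot (g x.2)]
      ring
    rw [tsum_congr e]
    refine (ENNReal_tsum_mul_sq_le _ _).trans (mul_le_mul' (le_of_eq ?_) ?_)
    · refine tsum_congr fun x => ?_
      rw [mul_pow, mul_pow, hroot, hind2, mul_assoc]
    · calc ∑' x, (ind j x * g x.2 ^ (1 / 2 : ℝ)) ^ 2 = ∑' x, ind j x * g x.2 := by
            refine tsum_congr fun x => ?_
            rw [mul_pow, hroot, hind2]
        _ = ∑' L, ∑' a, ind j (a, L) * g L := by
            rw [ENNReal.tsum_prod', ENNReal.tsum_comm]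
        _ ≤ ∑' L, g L := by
            refine ENNReal.tsum_le_tsum fun L => ?_
            rw [ENNReal.tsum_mul_right]
            refine mul_le_of_le_one_left' (tsum_ite_le_one _ fun a b ha hb => zbar_ext ?_)
            linarith
  calc ∑' j, (∑' x, ind j x * (f x.1 * g x.2)) ^ 2
      ≤ ∑' j, (∑' x, ind j x * (f x.1 ^ 2 * g x.2)) * ∑' L, g L := ENNReal.tsum_le_tsum h1
    _ = (∑' x, ∑' j, ind j x * (f x.1 ^ 2 * g x.2)) * ∑' L, g L := by
        rw [ENNReal.tsum_mul_right, ENNReal.tsum_comm]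
    _ ≤ (∑' x : Zbar × (Fin n → Zbar), f x.1 ^ 2 * g x.2) * ∑' L, g L := by
        refine mul_le_mul_left (ENNReal.tsum_le_tsum fun x => ?_) _
        rw [ENNReal.tsum_mul_right]
        refine mul_le_of_le_one_left' (tsum_ite_le_one _ fun a b ha hb => zbar_ext ?_)
        linarith
    _ = (∑' a, f a ^ 2) * (∑' L, g L) ^ 2 := by
        rw [ENNReal.tsum_prod']
        simp only [ENNReal.tsum_mul_left, ENNReal.tsum_mul_right]
        ring

theorem wt_sum_le {m : ℕ} {s : ℝ} (hs : 0 ≤ s) (L : Fin m → Zbar) (j : Zbar)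
    (h : ∑ k, (L k).1 = j.1) : wt s j ≤ ENNReal.ofReal ((m : ℝ) ^ s) * ∑ k, wt s (L k) := by
  have hne : (Finset.univ : Finset (Fin m)).Nonempty := by
    by_contra h0
    rw [Finset.not_nonempty_iff_eq_empty] at h0
    rw [h0, Finset.sum_empty] at h
    exact j.2 h.symm
  obtain ⟨k, -, hk⟩ := Finset.exists_max_image Finset.univ (fun k => |((L k).1 : ℝ)|) hne
  have h1 : |(j.1 : ℝ)| ≤ m * |((L k).1 : ℝ)| := by
    rw [← h]
    push_cast
    refine (Finset.abs_sum_le_sum_abs _ _).trans ?_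
    refine (Finset.sum_le_sum hk).trans_eq ?_
    simp
  have h2 : wt s j ≤ ENNReal.ofReal ((m : ℝ) ^ s) * wt s (L k) := by
    rw [wt, wt, ← ENNReal.ofReal_mul (by positivity), ← Real.mul_rpow (by positivity) (by positivity)]
    exact ENNReal.ofReal_le_ofReal (Real.rpow_le_rpow (abs_nonneg _) h1 hs)
  refine h2.trans (mul_le_mul_right ?_ _)
  exact Finset.single_le_sum (f := fun k => wt s (L k)) (fun _ _ => zero_le) (Finset.mem_univ k)

/-- The constant of the convolution estimate. -/
def convConst (p : ℝ) (m : ℕ) : ℝ≥0∞ :=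
  ENNReal.ofReal ((m : ℝ) ^ (p + 1 / 2)) * m * ellConst p ^ (m - 1)

theorem convConst_ne_top {p : ℝ} (hp : 0 < p) (m : ℕ) : convConst p m ≠ ∞ :=
  ENNReal.mul_ne_top (ENNReal.mul_ne_top ENNReal.ofReal_ne_top (ENNReal.natCast_ne_top m))
    (ENNReal.pow_ne_top (ellConst_ne_top hp))

theorem tsum_field_le {p : ℝ} (hp : 0 < p) {m : ℕ} (v : Fin m → SeqSpace p) :
    ∑' j : Zbar, (wt (p + 1) j * (de j * ∑' L : Fin m → Zbar,
      (if ∑ k, (L k).1 = j.1 then 1 else 0) * ∏ k, (de (L k) * ‖v k (L k)‖ₑ))) ^ 2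
      ≤ (convConst p m * ∏ k, ‖v k‖ₑ) ^ 2 := by
  set s : ℝ := p + 1 / 2 with hs
  set A : ℝ≥0∞ := ENNReal.ofReal ((m : ℝ) ^ s) with hA
  set u : Fin m → Zbar → ℝ≥0∞ := fun k j => de j * ‖v k j‖ₑ with hu
  set S : Fin m → Zbar → ℝ≥0∞ := fun k j => ∑' L : Fin m → Zbar,
      (if ∑ k, (L k).1 = j.1 then 1 else 0) * (wt s (L k) * ∏ k, u k (L k)) with hS
  have h1 : ∀ j : Zbar, wt (p + 1) j * (de j * ∑' L : Fin m → Zbar,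
      (if ∑ k, (L k).1 = j.1 then 1 else 0) * ∏ k, u k (L k)) ≤ A * ∑ k, S k j := fun j => by
    calc _ ≤ wt s j * ∑' L : Fin m → Zbar,
          (if ∑ k, (L k).1 = j.1 then 1 else 0) * ∏ k, u k (L k) := by
          rw [← mul_assoc]
          refine mul_le_mul_left ?_ _
          have := wt_mul_de_le s j
          rwa [show s + 1 / 2 = p + 1 by rw [hs]; ring] at this
      _ ≤ _ := by
          rw [← ENNReal.tsum_mul_left, ← Summable.tsum_finsetSum (fun _ _ => ENNReal.summable),
            ← ENNReal.tsum_mul_left]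
          refine ENNReal.tsum_le_tsum fun L => ?_
          split_ifs with h
          · simp only [one_mul]
            rw [← Finset.sum_mul, ← mul_assoc]
            exact mul_le_mul_left (wt_sum_le (by rw [hs]; linarith) L j h) _
          · simp
  have h2 : ∀ k, ∑' j, S k j ^ 2 ≤ (ellConst p ^ (m - 1) * ∏ k, ‖v k‖ₑ) ^ 2 := fun k => by
    obtain ⟨n, rfl⟩ : ∃ n, m = n + 1 := ⟨m - 1, by have := k.2; omega⟩
    have e : ∀ j, S k j = ∑' x : Zbar × (Fin n → Zbar),
        (if x.1.1 + ∑ i, (x.2 i).1 = j.1 then 1 else 0) *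
          ((wt s x.1 * u k x.1) * ∏ i, u (k.succAbove i) (x.2 i)) := fun j => by
      simp only [hS]
      rw [← (Fin.insertNthEquiv (fun _ => Zbar) k).tsum_eq]
      refine tsum_congr fun x => ?_
      rw [Fin.sum_univ_succAbove _ k, Fin.prod_univ_succAbove _ k]
      simp [mul_assoc]
    rw [tsum_congr fun j => congrArg (· ^ 2) (e j)]
    refine (tsum_conv_sq_le (fun a => wt s a * u k a)
      fun L => ∏ i, u (k.succAbove i) (L i)).trans ?_
    have hf : ∑' a, (wt s a * u k a) ^ 2 ≤ ‖v k‖ₑ ^ 2 := by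
      rw [← tsum_enorm_sq]
      refine ENNReal.tsum_le_tsum fun a => pow_le_pow_left' ?_ 2
      simp only [hu, ← mul_assoc]
      exact mul_le_mul_left (wt_mul_de_le p a) _
    have hg := tsum_form_le fun i => v (k.succAbove i)
    refine (mul_le_mul' hf (pow_le_pow_left' hg 2)).trans_eq ?_
    rw [Fin.prod_univ_succAbove _ k]
    simp only [Nat.add_sub_cancel]
    ring
  have h3 : ∀ j, (∑ k, S k j) ^ 2 ≤ m * ∑ k, S k j ^ 2 := fun j => by
    have := ENNReal_tsum_mul_sq_le (fun _ : Fin m => 1) fun k => S k j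
    simpa [tsum_fintype] using this
  calc _ ≤ ∑' j, (A * ∑ k, S k j) ^ 2 := ENNReal.tsum_le_tsum fun j => pow_le_pow_left' (h1 j) 2
    _ ≤ ∑' j, A ^ 2 * (m * ∑ k, S k j ^ 2) := by
        refine ENNReal.tsum_le_tsum fun j => ?_
        rw [mul_pow]
        exact mul_le_mul_right (h3 j) _
    _ = A ^ 2 * (m * ∑ k, ∑' j, S k j ^ 2) := by
        rw [ENNReal.tsum_mul_left, ENNReal.tsum_mul_left,
          Summable.tsum_finsetSum (fun _ _ => ENNReal.summable)]
    _ ≤ A ^ 2 * (m * ∑ k : Fin m, (ellConst p ^ (m - 1) * ∏ k, ‖v k‖ₑ) ^ 2) := by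
        gcongr with k
        exact h2 k
    _ = _ := by
        rw [Finset.sum_const, Finset.card_univ, Fintype.card_fin, nsmul_eq_mul, convConst]
        ring

/-! ### Admissible coefficients -/

/-- `δ_{j_1} ⋯ δ_{j_m}` if `j_1 + ⋯ + j_m = 0`, and `0` otherwise. -/
def majorant {m : ℕ} (J : Fin m → Zbar) : ℝ :=
  if ∑ i, (J i).1 = 0 then ∏ i, delta (J i) else 0

theorem majorant_nonneg {m : ℕ} (J : Fin m → Zbar) : 0 ≤ majorant J := by
  unfold majorant
  split_ifs
  · exact Finset.prod_nonneg fun i _ => delta_nonneg _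
  · exact le_rfl

/-- Coefficients bounded by a multiple of `majorant`. -/
def Good {m : ℕ} (c : (Fin m → Zbar) → ℂ) : Prop :=
  ∃ C : ℝ, 0 ≤ C ∧ ∀ J, ‖c J‖ ≤ C * majorant J

theorem Good.of_le {m : ℕ} {c d : (Fin m → Zbar) → ℂ} (hd : Good d) {K : ℝ}
    (h : ∀ J, ‖c J‖ ≤ K * ‖d J‖) : Good c := by
  obtain ⟨C, hC, hd⟩ := hd
  refine ⟨|K| * C, by positivity, fun J => (h J).trans ?_⟩
  rw [mul_assoc]
  exact mul_le_mul (le_abs_self K) (hd J) (norm_nonneg _) (abs_nonneg K)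

theorem Good.indicator {m : ℕ} {c : (Fin m → Zbar) → ℂ} (hc : Good c) (s : Set (Fin m → Zbar)) :
    Good (s.indicator c) :=
  hc.of_le (K := 1) fun J => by simpa using norm_indicator_le_norm_self c J

theorem Good.add {m : ℕ} {c d : (Fin m → Zbar) → ℂ} (hc : Good c) (hd : Good d) :
    Good fun J => c J + d J := by
  obtain ⟨C, hC, hc⟩ := hc
  obtain ⟨D, hD, hd⟩ := hd
  refine ⟨C + D, by positivity, fun J => (norm_add_le _ _).trans ?_⟩
  rw [add_mul]
  exact add_le_add (hc J) (hd J)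

theorem Good.const_mul {m : ℕ} {c : (Fin m → Zbar) → ℂ} (hc : Good c) (a : ℂ) :
    Good fun J => a * c J :=
  hc.of_le (K := ‖a‖) fun J => by rw [norm_mul]

theorem Good.eq_zero {m : ℕ} {c : (Fin m → Zbar) → ℂ} (hc : Good c) {J : Fin m → Zbar}
    (h : ∑ i, (J i).1 ≠ 0) : c J = 0 := by
  obtain ⟨C, -, hc⟩ := hc
  have := hc J
  rw [majorant, if_neg h, mul_zero] at this
  exact norm_le_zero_iff.1 this

/-- Admissible kernels of vector fields. -/
def GoodKernel {m : ℕ} (d : Zbar → (Fin m → Zbar) → ℂ) : Prop :=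
  ∃ C : ℝ, 0 ≤ C ∧ ∀ j L, ‖d j L‖ ≤
    C * if ∑ k, (L k).1 = j.1 then delta j * ∏ k, delta (L k) else 0

/-- The kernel of the Hamiltonian vector field of `∑ c_J z^J`. -/
def kern {m : ℕ} (c : (Fin (m + 1) → Zbar) → ℂ) (j : Zbar) (L : Fin m → Zbar) : ℂ :=
  Complex.I * sgn j * ∑ i : Fin (m + 1), c (i.insertNth (-j) L)

theorem majorant_insertNth {m : ℕ} (i : Fin (m + 1)) (j : Zbar) (L : Fin m → Zbar) :
    majorant (i.insertNth (-j) L : Fin (m + 1) → Zbar)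
      = if ∑ k, (L k).1 = j.1 then delta j * ∏ k, delta (L k) else 0 := by
  have h1 : ∑ k, ((i.insertNth (-j) L : Fin (m + 1) → Zbar) k).1 = -j.1 + ∑ k, (L k).1 := by
    rw [Fin.sum_univ_succAbove _ i]; simp [neg_val]
  have h2 : ∏ k, delta ((i.insertNth (-j) L : Fin (m + 1) → Zbar) k)
      = delta j * ∏ k, delta (L k) := by
    rw [Fin.prod_univ_succAbove _ i]; simp [delta_neg]
  rw [majorant, h1, h2]
  refine if_congr ?_ rfl rfl
  constructor <;> intro h <;> linarith

theorem Good.kern {m : ℕ} {c : (Fin (m + 1) → Zbar) → ℂ} (hc : Good c) :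
    GoodKernel (kern c) := by
  obtain ⟨C, hC, hc⟩ := hc
  refine ⟨(m + 1) * C, by positivity, fun j L => ?_⟩
  rw [GBBM.kern, norm_mul, norm_mul, Complex.norm_I, norm_sgn, one_mul, one_mul]
  refine (norm_sum_le _ _).trans ((Finset.sum_le_sum fun i _ => hc _).trans_eq ?_)
  simp only [majorant_insertNth]
  simp [mul_assoc]

/-! ### The multilinear maps attached to admissible coefficients -/

/-- `v ↦ v_1(J_1) ⋯ v_m(J_m)`. -/
def mono (p : ℝ) {m : ℕ} (J : Fin m → Zbar) :
    MultilinearMap ℂ (fun _ : Fin m => SeqSpace p) ℂ :=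
  (MultilinearMap.mkPiAlgebra ℂ (Fin m) ℂ).compLinearMap fun k => coord p (J k)

theorem mono_apply {p : ℝ} {m : ℕ} (J : Fin m → Zbar) (v : Fin m → SeqSpace p) :
    mono p J v = ∏ k, v k (J k) := by simp [mono]

theorem enorm_le_of_norm_le_mul {E F : Type*} [NormedAddCommGroup E] [NormedAddCommGroup F]
    {m : ℕ} {x : E} {v : Fin m → F}
    {K : ℝ≥0∞} (hK : K ≠ ∞) (h : ‖x‖ₑ ≤ K * ∏ k, ‖v k‖ₑ) : ‖x‖ ≤ K.toReal * ∏ k, ‖v k‖ := by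
  have hfin : K * ∏ k, ‖v k‖ₑ ≠ ∞ :=
    ENNReal.mul_ne_top hK (ENNReal.prod_ne_top fun _ _ => enorm_ne_top)
  have := ENNReal.toReal_mono hfin h
  simpa [ENNReal.toReal_mul, ENNReal.toReal_prod] using this

theorem enorm_coeff_mul_le {p : ℝ} {m : ℕ} {c : ℂ} {J : Fin m → Zbar} {C : ℝ} (hC : 0 ≤ C)
    (hc : ‖c‖ ≤ C * majorant J) (v : Fin m → SeqSpace p) :
    ‖c * ∏ k, v k (J k)‖ₑ ≤ ENNReal.ofReal C * ∏ k, de (J k) * ‖v k (J k)‖ₑ := by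
  have h1 : majorant J ≤ ∏ k, delta (J k) := by
    unfold majorant
    split_ifs
    · exact le_rfl
    · exact Finset.prod_nonneg fun i _ => delta_nonneg _
  have h2 : ‖c‖ₑ ≤ ENNReal.ofReal C * ∏ k, de (J k) := by
    simp only [de]
    rw [← ENNReal.ofReal_prod_of_nonneg (fun i _ => delta_nonneg _), ← ENNReal.ofReal_mul hC,
      ← ofReal_norm]
    exact ENNReal.ofReal_le_ofReal (hc.trans (mul_le_mul_of_nonneg_left h1 hC))
  rw [enorm_mul, Finset.prod_mul_distrib, ← mul_assoc]
  refine mul_le_mul' h2 (le_of_eq ?_)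
  rw [← ofReal_norm, norm_prod, ENNReal.ofReal_prod_of_nonneg (fun _ _ => norm_nonneg _)]
  simp

theorem tsum_enorm_coeff_le {p : ℝ} {m : ℕ} {c : (Fin m → Zbar) → ℂ} {C : ℝ} (hC : 0 ≤ C)
    (hc : ∀ J, ‖c J‖ ≤ C * majorant J) (v : Fin m → SeqSpace p) :
    ∑' J, ‖c J * ∏ k, v k (J k)‖ₑ ≤ (ENNReal.ofReal C * ellConst p ^ m) * ∏ k, ‖v k‖ₑ := by
  refine (ENNReal.tsum_le_tsum fun J => enorm_coeff_mul_le hC (hc J) v).trans ?_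
  rw [ENNReal.tsum_mul_left, mul_assoc]
  exact mul_le_mul_right (tsum_form_le v) _

theorem summable_form {p : ℝ} (hp : 0 < p) {m : ℕ} {c : (Fin m → Zbar) → ℂ} (hc : Good c)
    (v : Fin m → SeqSpace p) : Summable fun J => c J * ∏ k, v k (J k) := by
  obtain ⟨C, hC, hc⟩ := hc
  refine Summable.of_norm (tsum_enorm_ne_top_iff_summable_norm.1
    (ne_top_of_le_ne_top ?_ (tsum_enorm_coeff_le hC hc v)))
  exact ENNReal.mul_ne_top (ENNReal.mul_ne_top ENNReal.ofReal_ne_top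
    (ENNReal.pow_ne_top (ellConst_ne_top hp))) (ENNReal.prod_ne_top fun _ _ => enorm_ne_top)

/-- The multilinear form `∑_J c_J v_1(J_1) ⋯ v_m(J_m)`. -/
def formMap {p : ℝ} (hp : 0 < p) {m : ℕ} {c : (Fin m → Zbar) → ℂ} (hc : Good c) :
    ContinuousMultilinearMap ℂ (fun _ : Fin m => SeqSpace p) ℂ :=
  MultilinearMap.mkContinuous
    { toFun := fun v => ∑' J, c J * mono p J v
      map_update_add' := fun v i x y => by
        have hs : ∀ v : Fin m → SeqSpace p, Summable fun J => c J * mono p J v := fun v => by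
          simpa only [mono_apply] using summable_form hp hc v
        rw [← (hs _).tsum_add (hs _)]
        exact tsum_congr fun J => by rw [MultilinearMap.map_update_add, mul_add]
      map_update_smul' := fun v i a x => by
        rw [smul_eq_mul, ← tsum_mul_left]
        exact tsum_congr fun J => by
          rw [MultilinearMap.map_update_smul, smul_eq_mul, mul_left_comm] }
    (ENNReal.ofReal hc.choose * ellConst p ^ m).toReal
    (fun v => by
      refine enorm_le_of_norm_le_mul (ENNReal.mul_ne_top ENNReal.ofReal_ne_top
        (ENNReal.pow_ne_top (ellConst_ne_top hp))) ?_
      refine enorm_tsum_le_tsum_enorm.trans ?_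
      simp only [mono_apply]
      exact tsum_enorm_coeff_le hc.choose_spec.1 hc.choose_spec.2 v)

theorem formMap_apply {p : ℝ} (hp : 0 < p) {m : ℕ} {c : (Fin m → Zbar) → ℂ} (hc : Good c)
    (v : Fin m → SeqSpace p) : formMap hp hc v = ∑' J, c J * ∏ k, v k (J k) := by
  change ∑' J, c J * mono p J v = _
  simp only [mono_apply]

theorem poly_eq_formMap {p : ℝ} (hp : 0 < p) {m : ℕ} {c : (Fin m → Zbar) → ℂ} (hc : Good c) :
    poly (p := p) c = fun z => formMap hp hc fun _ => z := by
  ext z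
  rw [formMap_apply, poly]

theorem enorm_kernel_mul_le {p : ℝ} {m : ℕ} {d : ℂ} {j : Zbar} {L : Fin m → Zbar} {C : ℝ}
    (hC : 0 ≤ C)
    (hd : ‖d‖ ≤ C * if ∑ k, (L k).1 = j.1 then delta j * ∏ k, delta (L k) else 0)
    (v : Fin m → SeqSpace p) :
    ‖d * ∏ k, v k (L k)‖ₑ ≤ ENNReal.ofReal C * (de j *
      ((if ∑ k, (L k).1 = j.1 then 1 else 0) * ∏ k, (de (L k) * ‖v k (L k)‖ₑ))) := by
  split_ifs at hd ⊢ with h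
  · have h2 : ‖d‖ₑ ≤ ENNReal.ofReal C * (de j * ∏ k, de (L k)) := by
      simp only [de]
      rw [← ENNReal.ofReal_prod_of_nonneg (fun i _ => delta_nonneg _),
        ← ENNReal.ofReal_mul (delta_nonneg j), ← ENNReal.ofReal_mul hC, ← ofReal_norm]
      exact ENNReal.ofReal_le_ofReal hd
    rw [enorm_mul, Finset.prod_mul_distrib, one_mul]
    refine (mul_le_mul' h2 (le_of_eq (b := ∏ k, ‖v k (L k)‖ₑ) ?_)).trans_eq (by ring)
    rw [← ofReal_norm, norm_prod, ENNReal.ofReal_prod_of_nonneg (fun _ _ => norm_nonneg _)]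
    simp
  · rw [mul_zero, norm_le_zero_iff] at hd
    simp [hd]

theorem tsum_enorm_kernel_le {p : ℝ} (hp : 0 < p) {m : ℕ} {d : Zbar → (Fin m → Zbar) → ℂ} {C : ℝ}
    (hC : 0 ≤ C)
    (hd : ∀ j L, ‖d j L‖ ≤ C * if ∑ k, (L k).1 = j.1 then delta j * ∏ k, delta (L k) else 0)
    (v : Fin m → SeqSpace p) :
    ∑' j, (wt (p + 1) j * ∑' L, ‖d j L * ∏ k, v k (L k)‖ₑ) ^ 2
      ≤ ((ENNReal.ofReal C * convConst p m) * ∏ k, ‖v k‖ₑ) ^ 2 := by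
  calc _ ≤ ∑' j : Zbar, ENNReal.ofReal C ^ 2 * (wt (p + 1) j * (de j * ∑' L : Fin m → Zbar,
      (if ∑ k, (L k).1 = j.1 then 1 else 0) * ∏ k, (de (L k) * ‖v k (L k)‖ₑ))) ^ 2 := by
        refine ENNReal.tsum_le_tsum fun j => ?_
        rw [← mul_pow]
        refine pow_le_pow_left' ?_ 2
        rw [mul_left_comm]
        refine mul_le_mul_right ?_ _
        rw [← ENNReal.tsum_mul_left, ← ENNReal.tsum_mul_left]
        exact ENNReal.tsum_le_tsum fun L => enorm_kernel_mul_le hC (hd j L) v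
    _ ≤ _ := by
        rw [ENNReal.tsum_mul_left]
        refine (mul_le_mul_right (tsum_field_le hp v) _).trans_eq ?_
        ring

theorem wt_pos (s : ℝ) (j : Zbar) : wt s j ≠ 0 := by
  rw [wt, Ne, ENNReal.ofReal_eq_zero, not_le]
  exact Real.rpow_pos_of_pos (abs_pos' j) s

theorem kernConst_ne_top {p : ℝ} (hp : 0 < p) (C : ℝ) (m : ℕ) :
    ENNReal.ofReal C * convConst p m ≠ ∞ :=
  ENNReal.mul_ne_top ENNReal.ofReal_ne_top (convConst_ne_top hp m)

theorem summable_kernel {p : ℝ} (hp : 0 < p) {m : ℕ} {d : Zbar → (Fin m → Zbar) → ℂ}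
    (hd : GoodKernel d) (v : Fin m → SeqSpace p) (j : Zbar) :
    Summable fun L => d j L * ∏ k, v k (L k) := by
  obtain ⟨C, hC, hd⟩ := hd
  refine Summable.of_norm (tsum_enorm_ne_top_iff_summable_norm.1 fun h => ?_)
  have h1 := tsum_enorm_kernel_le hp hC hd v
  have h2 : ∑' j, (wt (p + 1) j * ∑' L, ‖d j L * ∏ k, v k (L k)‖ₑ) ^ 2 ≠ ∞ :=
    ne_top_of_le_ne_top (ENNReal.pow_ne_top (ENNReal.mul_ne_top (kernConst_ne_top hp C m)
      (ENNReal.prod_ne_top fun _ _ => enorm_ne_top))) h1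
  refine ENNReal.ne_top_of_tsum_ne_top h2 j ?_
  rw [h, ENNReal.mul_top (wt_pos _ j)]
  rfl

theorem tsum_enorm_field_le {p : ℝ} (hp : 0 < p) {m : ℕ} {d : Zbar → (Fin m → Zbar) → ℂ} {C : ℝ}
    (hC : 0 ≤ C)
    (hd : ∀ j L, ‖d j L‖ ≤ C * if ∑ k, (L k).1 = j.1 then delta j * ∏ k, delta (L k) else 0)
    (v : Fin m → SeqSpace p) :
    ∑' j, (wt (p + 1) j * ‖∑' L, d j L * mono p L v‖ₑ) ^ 2
      ≤ ((ENNReal.ofReal C * convConst p m) * ∏ k, ‖v k‖ₑ) ^ 2 := by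
  refine le_trans (ENNReal.tsum_le_tsum fun j => pow_le_pow_left' (mul_le_mul_right ?_ _) 2)
    (tsum_enorm_kernel_le hp hC hd v)
  simp only [mono_apply]
  exact enorm_tsum_le_tsum_enorm

/-- The multilinear vector field with a given kernel. -/
def fieldMap {p : ℝ} (hp : 0 < p) {m : ℕ} {d : Zbar → (Fin m → Zbar) → ℂ} (hd : GoodKernel d) :
    ContinuousMultilinearMap ℂ (fun _ : Fin m => SeqSpace p) (SeqSpace (p + 1)) :=
  MultilinearMap.mkContinuous
    { toFun := fun v => ⟨fun j => ∑' L, d j L * mono p L v, mem_hSubmodule_of_tsum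
        (ne_top_of_le_ne_top (ENNReal.pow_ne_top (ENNReal.mul_ne_top (kernConst_ne_top hp _ m)
          (ENNReal.prod_ne_top fun _ _ => enorm_ne_top)))
          (tsum_enorm_field_le hp hd.choose_spec.1 hd.choose_spec.2 v))⟩
      map_update_add' := fun v i x y => by
        have hs : ∀ (v : Fin m → SeqSpace p) j, Summable fun L => d j L * mono p L v :=
          fun v j => by simpa only [mono_apply] using summable_kernel hp hd v j
        refine seq_ext fun j => ?_
        refine Eq.trans ?_ ((hs _ j).tsum_add (hs _ j))
        exact tsum_congr fun J => by rw [MultilinearMap.map_update_add, mul_add]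
      map_update_smul' := fun v i a x => by
        refine seq_ext fun j => ?_
        refine Eq.trans ?_ tsum_mul_left
        exact tsum_congr fun J => by
          rw [MultilinearMap.map_update_smul, smul_eq_mul, mul_left_comm] }
    (ENNReal.ofReal hd.choose * convConst p m).toReal
    (fun v => by
      refine enorm_le_of_norm_le_mul (kernConst_ne_top hp _ m) (le_of_sq_le_sq ?_)
      rw [← tsum_enorm_sq]
      exact tsum_enorm_field_le hp hd.choose_spec.1 hd.choose_spec.2 v)

theorem fieldMap_coord {p : ℝ} (hp : 0 < p) {m : ℕ} {d : Zbar → (Fin m → Zbar) → ℂ}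
    (hd : GoodKernel d) (v : Fin m → SeqSpace p) (j : Zbar) :
    (fieldMap hp hd v) j = ∑' L, d j L * ∏ k, v k (L k) := by
  change ∑' L, d j L * mono p L v = _
  simp only [mono_apply]

/-! ### Polynomials with admissible coefficients and their Hamiltonian vector fields -/

theorem hasFDerivAt_poly {p : ℝ} (hp : 0 < p) {m : ℕ} {c : (Fin m → Zbar) → ℂ} (hc : Good c)
    (z : SeqSpace p) : HasFDerivAt (poly c) (diagDeriv (formMap hp hc) z) z := by
  rw [poly_eq_formMap hp hc]
  exact (hasStrictFDerivAt_diag _ z).hasFDerivAt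

theorem analyticAt_poly {p : ℝ} (hp : 0 < p) {m : ℕ} {c : (Fin m → Zbar) → ℂ} (hc : Good c)
    (z : SeqSpace p) : AnalyticAt ℂ (poly c) z := by
  rw [poly_eq_formMap hp hc]
  exact analyticAt_diag _ z

theorem formMap_update_unitVec {p : ℝ} (hp : 0 < p) {m : ℕ} {c : (Fin (m + 1) → Zbar) → ℂ}
    (hc : Good c) (z : SeqSpace p) (i : Fin (m + 1)) (j : Zbar) :
    formMap hp hc (Function.update (fun _ => z) i (unitVec p j))
      = ∑' L : Fin m → Zbar, c (i.insertNth j L) * ∏ k, z (L k) := by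
  rw [formMap_apply]
  have hinj : Function.Injective fun L : Fin m → Zbar => (i.insertNth j L : Fin (m + 1) → Zbar) :=
    Fin.insertNth_right_injective (α := fun _ => Zbar) j
  rw [← hinj.tsum_eq]
  · refine tsum_congr fun L => ?_
    rw [Fin.prod_univ_succAbove _ i]
    simp [Fin.succAbove_ne, unitVec_same]
  · intro J hJ
    refine ⟨i.removeNth J, ?_⟩
    have : J i = j := by
      by_contra h
      apply hJ
      have : ∏ k, (Function.update (fun _ => z) i (unitVec p j) k : SeqSpace p) (J k) = 0 :=
        Finset.prod_eq_zero (Finset.mem_univ i) (by simp [unitVec_of_ne p h])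
      exact mul_eq_zero_of_right _ this
    rw [← this]
    exact Fin.insertNth_self_removeNth i J

/-- The Hamiltonian vector field of `∑ c_J z^J`. -/
def polyField {p : ℝ} (hp : 0 < p) {m : ℕ} {c : (Fin (m + 1) → Zbar) → ℂ} (hc : Good c)
    (z : SeqSpace p) : SeqSpace (p + 1) := fieldMap hp hc.kern fun _ => z

theorem hasAnalyticField_poly {p : ℝ} (hp : 0 < p) {m : ℕ} {c : (Fin (m + 1) → Zbar) → ℂ}
    (hc : Good c) : HasAnalyticField (poly c) (polyField hp hc) Set.univ where
  analytic_fun z _ := analyticAt_poly hp hc z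
  analytic_field z _ := analyticAt_diag _ z
  field_eq z _ j := by
    rw [(hasFDerivAt_poly hp hc z).fderiv, diagDeriv_apply, polyField, fieldMap_coord]
    simp only [formMap_update_unitVec, kern]
    have hs : ∀ i : Fin (m + 1), Summable fun L : Fin m → Zbar =>
        c (i.insertNth (-j) L) * ∏ k, z (L k) := fun i => by
      have h := summable_form hp hc (Function.update (fun _ => z) i (unitVec p (-j)))
      have hinj : Function.Injective fun L : Fin m → Zbar =>
          (i.insertNth (-j) L : Fin (m + 1) → Zbar) :=
        Fin.insertNth_right_injective (α := fun _ => Zbar) (-j)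
      refine (h.comp_injective hinj).congr fun L => ?_
      simp only [Function.comp_apply]
      rw [Fin.prod_univ_succAbove _ i]
      simp [Fin.succAbove_ne, unitVec_same]
    rw [← Summable.tsum_finsetSum fun i _ => hs i, ← tsum_mul_left]
    exact tsum_congr fun L => by rw [← Finset.sum_mul, mul_assoc]

theorem HasAnalyticField.sympForm_eq {p : ℝ} (hp : 0 ≤ p) {F : SeqSpace p → ℂ}
    {X : SeqSpace p → SeqSpace (p + 1)} {U : Set (SeqSpace p)} (h : HasAnalyticField F X U)
    {z : SeqSpace p} (hz : z ∈ U) (w : SeqSpace p) :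
    sympForm (incl p (X z)) w = fderiv ℂ F z w := by
  rw [sympForm_eq_tsum hp, ← (hasSum_clm_unitVec (fderiv ℂ F z) w).tsum_eq, ← tsum_mul_left,
    ← (Equiv.neg Zbar).tsum_eq]
  refine tsum_congr fun j => ?_
  simp only [Equiv.neg_apply, neg_neg]
  rw [incl_coord, h.field_eq z hz, sgn_neg, neg_neg]
  linear_combination (w j * fderiv ℂ F z (unitVec p j)) *
    (sgn j * sgn j * (-Complex.I_mul_I) + sgn_mul_self j)

/-! ### The Poisson bracket -/

/-- The kernel of the gradient of `∑ a_J z^J`. -/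
def gradKern {m : ℕ} (a : (Fin (m + 1) → Zbar) → ℂ) (j : Zbar) (L : Fin m → Zbar) : ℂ :=
  ∑ i : Fin (m + 1), a (i.insertNth j L)

theorem norm_gradKern_le {m : ℕ} {a : (Fin (m + 1) → Zbar) → ℂ} {C : ℝ}
    (ha : ∀ J, ‖a J‖ ≤ C * majorant J) (j : Zbar) (L : Fin m → Zbar) :
    ‖gradKern a j L‖ ≤ (m + 1) * C *
      if ∑ k, (L k).1 = -j.1 then delta j * ∏ k, delta (L k) else 0 := by
  refine (norm_sum_le _ _).trans ((Finset.sum_le_sum fun i _ => ha _).trans_eq ?_)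
  have h : ∀ i : Fin (m + 1), majorant (i.insertNth j L : Fin (m + 1) → Zbar)
      = if ∑ k, (L k).1 = -j.1 then delta j * ∏ k, delta (L k) else 0 := fun i => by
    have := majorant_insertNth i (-j) L
    rwa [neg_neg, delta_neg, neg_val] at this
  simp only [h]
  simp [mul_assoc]

theorem bracketCoeff_eq {m n : ℕ} (a : (Fin (m + 1) → Zbar) → ℂ) (b : (Fin (n + 1) → Zbar) → ℂ)
    (L : Fin (m + n) → Zbar) : bracketCoeff a b L =
      ∑' j, gradKern a j (fun k => L (Fin.castAdd n k)) * kern b j (fun k => L (Fin.natAdd m k)) :=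
  tsum_congr fun j => by rw [gradKern, kern]; ring

theorem Good.bracket {m n : ℕ} {a : (Fin (m + 1) → Zbar) → ℂ} {b : (Fin (n + 1) → Zbar) → ℂ}
    (ha : Good a) (hb : Good b) : Good (bracketCoeff a b) := by
  obtain ⟨C, hC, ha⟩ := ha
  obtain ⟨D, hD, hb⟩ := hb.kern
  have hA : ∀ j L, ‖gradKern a j L‖ ≤ (m + 1) * C *
      if ∑ k, (L k).1 = -j.1 then delta j * ∏ k, delta (L k) else 0 := norm_gradKern_le ha
  refine ⟨(m + 1) * C * D, by positivity, fun L => ?_⟩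
  rw [bracketCoeff_eq]
  set L₁ : Fin m → Zbar := fun k => L (Fin.castAdd n k)
  set L₂ : Fin n → Zbar := fun k => L (Fin.natAdd m k)
  have hsum : ∑ i, (L i).1 = ∑ k, (L₁ k).1 + ∑ k, (L₂ k).1 := Fin.sum_univ_add _
  have hprod : ∏ i, delta (L i) = (∏ k, delta (L₁ k)) * ∏ k, delta (L₂ k) := Fin.prod_univ_add _
  have h0 : ∀ j : Zbar, ¬(∑ k, (L₁ k).1 = -j.1 ∧ ∑ k, (L₂ k).1 = j.1) →
      gradKern a j L₁ * GBBM.kern b j L₂ = 0 := fun j hj => by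
    rw [not_and_or] at hj
    rcases hj with hj | hj
    · have := hA j L₁
      rw [if_neg hj, mul_zero, norm_le_zero_iff] at this
      rw [this, zero_mul]
    · have := hb j L₂
      rw [if_neg hj, mul_zero, norm_le_zero_iff] at this
      rw [this, mul_zero]
  by_cases hex : ∃ j : Zbar, ∑ k, (L₁ k).1 = -j.1 ∧ ∑ k, (L₂ k).1 = j.1
  · obtain ⟨j, hj⟩ := hex
    rw [tsum_eq_single j fun k hk => h0 k fun hk' => hk (zbar_ext (hk'.2.symm.trans hj.2)),
      norm_mul, majorant, if_pos (by rw [hsum, hj.1, hj.2]; ring), hprod]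
    have h1 := hA j L₁
    have h2 := hb j L₂
    rw [if_pos hj.1] at h1
    rw [if_pos hj.2] at h2
    have hp1 : 0 ≤ ∏ k, delta (L₁ k) := Finset.prod_nonneg fun i _ => delta_nonneg _
    have hp2 : 0 ≤ ∏ k, delta (L₂ k) := Finset.prod_nonneg fun i _ => delta_nonneg _
    have hd1 : delta j * ∏ k, delta (L₁ k) ≤ ∏ k, delta (L₁ k) :=
      mul_le_of_le_one_left hp1 (delta_le_one j)
    have hd2 : delta j * ∏ k, delta (L₂ k) ≤ ∏ k, delta (L₂ k) :=
      mul_le_of_le_one_left hp2 (delta_le_one j)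
    calc _ ≤ ((m + 1) * C * ∏ k, delta (L₁ k)) * (D * ∏ k, delta (L₂ k)) := by
          refine mul_le_mul (h1.trans ?_) (h2.trans ?_) (norm_nonneg _) (by positivity)
          · exact mul_le_mul_of_nonneg_left hd1 (by positivity)
          · exact mul_le_mul_of_nonneg_left hd2 hD
      _ = _ := by ring
  · push Not at hex
    rw [tsum_congr fun j => h0 j fun hj => hex j hj.1 hj.2, tsum_zero, norm_zero]
    exact mul_nonneg (by positivity) (majorant_nonneg L)

theorem kern_eq_gradKern {m : ℕ} (c : (Fin (m + 1) → Zbar) → ℂ) (j : Zbar) (L : Fin m → Zbar) :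
    kern c j L = Complex.I * sgn j * gradKern c (-j) L := rfl

theorem gradKern_eq_kern {m : ℕ} (c : (Fin (m + 1) → Zbar) → ℂ) (j : Zbar) (L : Fin m → Zbar) :
    gradKern c j L = Complex.I * sgn j * kern c (-j) L := by
  rw [kern_eq_gradKern, neg_neg, sgn_neg]
  linear_combination gradKern c j L *
    (sgn j * sgn j * Complex.I_mul_I - sgn_mul_self j)

theorem fderiv_poly_unitVec {p : ℝ} (hp : 0 < p) {m : ℕ} {c : (Fin (m + 1) → Zbar) → ℂ}
    (hc : Good c) (z : SeqSpace p) (j : Zbar) :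
    fderiv ℂ (poly c) z (unitVec p j) = ∑' L : Fin m → Zbar, gradKern c j L * ∏ k, z (L k) := by
  have h := (hasAnalyticField_poly hp hc).field_eq z (Set.mem_univ z) (-j)
  rw [neg_neg, polyField, fieldMap_coord] at h
  simp only [gradKern_eq_kern, mul_assoc, tsum_mul_left] at h ⊢
  rw [h, sgn_neg]
  linear_combination (fderiv ℂ (poly c) z (unitVec p j)) *
    (sgn j * sgn j * Complex.I_mul_I - sgn_mul_self j)

theorem summable_bracket {p : ℝ} (hp : 0 < p) {m n : ℕ} {a : (Fin (m + 1) → Zbar) → ℂ}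
    {b : (Fin (n + 1) → Zbar) → ℂ} (ha : Good a) (hb : Good b) (z : SeqSpace p) :
    Summable fun x : Zbar × ((Fin m → Zbar) × (Fin n → Zbar)) =>
      (gradKern a x.1 x.2.1 * ∏ k, z (x.2.1 k)) * (kern b x.1 x.2.2 * ∏ k, z (x.2.2 k)) := by
  obtain ⟨C, hC, ha⟩ := ha
  obtain ⟨D, hD, hb⟩ := hb.kern
  have hA := norm_gradKern_le ha
  have hC' : 0 ≤ ((m : ℝ) + 1) * C := by positivity
  have h1 : ∀ j (L : Fin m → Zbar), ‖gradKern a j L * ∏ k, z (L k)‖ₑ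
      ≤ ENNReal.ofReal ((m + 1) * C) * ∏ k, (de (L k) * ‖z (L k)‖ₑ) := fun j L => by
    have h := hA j L
    rw [← neg_val] at h
    have h' := enorm_kernel_mul_le (j := -j) hC' (by rw [delta_neg]; exact h) fun _ => z
    refine h'.trans (mul_le_mul_right ?_ _)
    refine (mul_le_of_le_one_left' (de_le_one _)).trans (mul_le_of_le_one_left' ?_)
    split_ifs <;> simp
  have h2 : ∀ j (L : Fin n → Zbar), ‖kern b j L * ∏ k, z (L k)‖ₑ
      ≤ (if ∑ k, (L k).1 = j.1 then 1 else 0) *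
        (ENNReal.ofReal D * ∏ k, (de (L k) * ‖z (L k)‖ₑ)) := fun j L => by
    refine (enorm_kernel_mul_le hD (hb j L) fun _ => z).trans ?_
    rw [mul_left_comm (ite _ _ _)]
    exact mul_le_mul_right (mul_le_of_le_one_left' (de_le_one _)) _
  refine Summable.of_norm (tsum_enorm_ne_top_iff_summable_norm.1 ?_)
  set u : (k : ℕ) → (Fin k → Zbar) → ℝ≥0∞ := fun k L => ∏ i, (de (L i) * ‖z (L i)‖ₑ)
  have hfin : ∀ k, ∑' L, u k L ≠ ∞ := fun k =>
    ne_top_of_le_ne_top (ENNReal.mul_ne_top (ENNReal.pow_ne_top (ellConst_ne_top hp))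
      (ENNReal.prod_ne_top fun _ _ => enorm_ne_top)) (tsum_form_le fun _ : Fin k => z)
  refine ne_top_of_le_ne_top (b := (ENNReal.ofReal ((m + 1) * C) * ∑' L, u m L) *
    (ENNReal.ofReal D * ∑' L, u n L)) (ENNReal.mul_ne_top
      (ENNReal.mul_ne_top ENNReal.ofReal_ne_top (hfin m))
      (ENNReal.mul_ne_top ENNReal.ofReal_ne_top (hfin n))) ?_
  rw [ENNReal.tsum_prod', ENNReal.tsum_comm, ENNReal.tsum_prod', ← ENNReal.tsum_mul_left,
    ← ENNReal.tsum_mul_left, ← ENNReal.tsum_mul_right]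
  refine ENNReal.tsum_le_tsum fun L₁ => ?_
  rw [← ENNReal.tsum_mul_left]
  refine ENNReal.tsum_le_tsum fun L₂ => ?_
  refine (ENNReal.tsum_le_tsum fun j => (enorm_mul _ _).le.trans
    (mul_le_mul' (h1 j L₁) (h2 j L₂))).trans ?_
  rw [ENNReal.tsum_mul_left, ENNReal.tsum_mul_right]
  refine mul_le_mul_right (mul_le_of_le_one_left' (tsum_ite_le_one _ fun i j hi hj => ?_)) _
  exact zbar_ext (hi.symm.trans hj)

theorem tsum_append {m n : ℕ} (f : (Fin (m + n) → Zbar) → ℂ) :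
    ∑' L, f L = ∑' x : (Fin m → Zbar) × (Fin n → Zbar), f (Fin.append x.1 x.2) :=
  ((Fin.appendEquiv m n).tsum_eq f).symm

/-- The derivative of `A` along the Hamiltonian vector field of `B` is the Poisson bracket. -/
theorem fderiv_poly_polyField {p : ℝ} (hp : 0 < p) {m n : ℕ} {a : (Fin (m + 1) → Zbar) → ℂ}
    {b : (Fin (n + 1) → Zbar) → ℂ} (ha : Good a) (hb : Good b) (z : SeqSpace p) :
    fderiv ℂ (poly a) z (incl p (polyField hp hb z)) = poly (bracketCoeff a b) z := by
  have hsA : ∀ j, Summable fun L : Fin m → Zbar => gradKern a j L * ∏ k, z (L k) := fun j => by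
    simp only [gradKern_eq_kern, mul_assoc]
    exact ((summable_kernel hp ha.kern (fun _ => z) (-j)).mul_left (sgn j)).mul_left Complex.I
  have hsB : ∀ j, Summable fun L : Fin n → Zbar => kern b j L * ∏ k, z (L k) :=
    summable_kernel hp hb.kern fun _ => z
  set f : Zbar → (Fin m → Zbar) × (Fin n → Zbar) → ℂ := fun j x =>
    (gradKern a j x.1 * ∏ k, z (x.1 k)) * (kern b j x.2 * ∏ k, z (x.2 k)) with hf
  have hs : Summable (Function.uncurry f) := summable_bracket hp ha hb z
  have h1 : ∀ j, (incl p (polyField hp hb z)) j * fderiv ℂ (poly a) z (unitVec p j)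
      = ∑' x, f j x := fun j => by
    rw [fderiv_poly_unitVec hp ha, incl_coord, polyField, fieldMap_coord, mul_comm]
    exact tsum_mul_tsum_of_summable_norm (hsA j).norm (hsB j).norm
  have h2 : ∀ x, ∑' j, f j x = bracketCoeff a b (Fin.append x.1 x.2) *
      ∏ k, z (Fin.append x.1 x.2 k) := fun x => by
    rw [bracketCoeff_eq, ← tsum_mul_right]
    refine tsum_congr fun j => ?_
    rw [Fin.prod_univ_add]
    simp only [Fin.append_left, Fin.append_right, hf]
    ring
  have h3 : ∑' j, ∑' x, f j x = ∑' x, ∑' j, f j x := (hs.tsum_comm).symm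
  rw [← (hasSum_clm_unitVec (fderiv ℂ (poly a) z) _).tsum_eq, tsum_congr h1, h3, tsum_congr h2,
    poly, tsum_append]

/-! ### The quadratic part -/

theorem abs_freq (j : Zbar) : |freq j| = delta j ^ 2 := by
  rw [delta_sq, freq, abs_div, abs_of_pos (by positivity : (0 : ℝ) < 1 + (j.1 : ℝ) ^ 2)]

theorem freq_neg (j : Zbar) : freq (-j) = -freq j := by
  simp [freq, neg_val, neg_div]

theorem sgn_mul_abs_freq (j : Zbar) : sgn j * (|freq j| : ℝ) = freq j := by
  rcases lt_or_gt_of_ne j.2 with h | h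
  · have h' : (j.1 : ℝ) < 0 := by exact_mod_cast h
    have h2 : freq j < 0 := div_neg_of_neg_of_pos h' (by positivity)
    rw [abs_of_neg h2, sgn, Int.sign_eq_neg_one_of_neg h]
    push_cast
    ring
  · have h' : (0 : ℝ) < j.1 := by exact_mod_cast h
    have h2 : 0 < freq j := div_pos h' (by positivity)
    rw [abs_of_pos h2, sgn, Int.sign_eq_one_of_pos h]
    simp

/-- The symmetric coefficients of `Λ`. -/
def lamCoeff (J : Fin 2 → Zbar) : ℂ := if J 1 = -J 0 then ((|freq (J 0)| / 2 : ℝ) : ℂ) else 0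

theorem good_lamCoeff : Good lamCoeff := by
  refine ⟨1, zero_le_one, fun J => ?_⟩
  rw [lamCoeff, one_mul]
  split_ifs with h
  · have h1 : ∑ i, (J i).1 = 0 := by rw [Fin.sum_univ_two, h, neg_val]; ring
    rw [majorant, if_pos h1, Fin.prod_univ_two, h, delta_neg, Complex.norm_real, Real.norm_eq_abs,
      abs_freq, abs_of_nonneg (by positivity)]
    nlinarith [delta_nonneg (J 0)]
  · rw [norm_zero]
    exact majorant_nonneg J

theorem Lam_eq_poly {p : ℝ} (hp : 0 < p) : Lam (p := p) = poly lamCoeff := by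
  ext z
  have hinj : Function.Injective fun j : Zbar => (![j, -j] : Fin 2 → Zbar) := fun a b h => by
    simpa using congrFun h 0
  have e : ∀ j : Zbar, lamCoeff ![j, -j] * ∏ k, z ((![j, -j] : Fin 2 → Zbar) k)
      = ((|freq j| / 2 : ℝ) : ℂ) * (z j * z (-j)) := fun j => by
    rw [Fin.prod_univ_two]
    simp [lamCoeff]
  have hs : Summable fun j : Zbar => ((|freq j| / 2 : ℝ) : ℂ) * (z j * z (-j)) := by
    refine ((summable_form hp good_lamCoeff fun _ => z).comp_injective hinj).congr fun j => ?_
    exact e j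
  have h1 : poly lamCoeff z = ∑' j : Zbar, ((|freq j| / 2 : ℝ) : ℂ) * (z j * z (-j)) := by
    rw [poly, ← hinj.tsum_eq]
    · exact tsum_congr e
    · intro J hJ
      refine ⟨J 0, ?_⟩
      have : J 1 = -J 0 := by
        by_contra h
        exact hJ (mul_eq_zero_of_left (if_neg h) _)
      ext k : 1
      fin_cases k
      · rfl
      · exact this.symm
  rw [h1, tsum_zbar hs, Lam]
  refine tsum_congr fun n => ?_
  have h2 : |freq (pos n)| = freq (pos n) := by
    have := sgn_mul_abs_freq (pos n)
    rw [sgn_pos, one_mul] at this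
    exact_mod_cast this
  rw [freq_neg, abs_neg, neg_neg, h2]
  push_cast
  ring

theorem polyField_lam_coord {p : ℝ} (hp : 0 < p) (z : SeqSpace p) (j : Zbar) :
    (polyField hp good_lamCoeff z) j = Complex.I * freq j * z j := by
  rw [polyField, fieldMap_coord, tsum_eq_single fun _ => j]
  · rw [kern, Fin.sum_univ_two]
    have h0 : lamCoeff ((0 : Fin 2).insertNth (-j) fun _ => j) = ((|freq j| / 2 : ℝ) : ℂ) := by
      have h2 : ((0 : Fin 2).insertNth (-j) (fun _ => j) : Fin 2 → Zbar) = ![-j, j] := by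
        ext k : 1
        fin_cases k <;> rfl
      rw [h2]
      simp [lamCoeff, freq_neg]
    have h1 : lamCoeff ((1 : Fin 2).insertNth (-j) fun _ => j) = ((|freq j| / 2 : ℝ) : ℂ) := by
      have h2 : ((1 : Fin 2).insertNth (-j) (fun _ => j) : Fin 2 → Zbar) = ![j, -j] := by
        ext k : 1
        fin_cases k <;> rfl
      rw [h2]
      simp [lamCoeff]
    rw [h0, h1, ← sgn_mul_abs_freq j, Fin.prod_univ_one]
    push_cast
    ring
  · intro L hL
    have hL0 : L 0 ≠ j := fun h => hL (by ext k : 1; rw [Fin.fin_one_eq_zero k, h])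
    refine mul_eq_zero_of_left ?_ _
    rw [kern, Fin.sum_univ_two]
    have h0 : lamCoeff ((0 : Fin 2).insertNth (-j) L) = 0 := by
      have h2 : ((0 : Fin 2).insertNth (-j) L : Fin 2 → Zbar) = ![-j, L 0] := by
        ext k : 1
        fin_cases k <;> rfl
      rw [h2]
      simp [lamCoeff, hL0]
    have h1 : lamCoeff ((1 : Fin 2).insertNth (-j) L) = 0 := by
      have h2 : ((1 : Fin 2).insertNth (-j) L : Fin 2 → Zbar) = ![L 0, -j] := by
        ext k : 1
        fin_cases k <;> rfl
      rw [h2]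
      simp [lamCoeff, Ne.symm hL0]
    rw [h0, h1]
    simp

/-- The bracket with the quadratic part is diagonal on monomials. -/
theorem fderiv_lam_polyField {p : ℝ} (hp : 0 < p) {m : ℕ} {c : (Fin (m + 1) → Zbar) → ℂ}
    (hc : Good c) (z : SeqSpace p) :
    fderiv ℂ Lam z (incl p (polyField hp hc z))
      = poly (fun J => -Complex.I * ((∑ i, freq (J i) : ℝ) : ℂ) * c J) z := by
  have hL := hasAnalyticField_poly hp good_lamCoeff
  have hF := hasAnalyticField_poly hp hc
  rw [Lam_eq_poly hp, ← hL.sympForm_eq hp.le (Set.mem_univ z), sympForm_swap,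
    hF.sympForm_eq hp.le (Set.mem_univ z), (hasFDerivAt_poly hp hc z).fderiv, diagDeriv_apply]
  set w := incl p (polyField hp good_lamCoeff z) with hw
  have hwj : ∀ j, w j = Complex.I * freq j * z j := fun j => polyField_lam_coord hp z j
  have e : ∀ (i : Fin (m + 1)) (J : Fin (m + 1) → Zbar),
      c J * ∏ k, (Function.update (fun _ => z) i w k : SeqSpace p) (J k)
        = (Complex.I * freq (J i)) * (c J * ∏ k, z (J k)) := fun i J => by
    rw [Fin.prod_univ_succAbove _ i, Fin.prod_univ_succAbove _ i]
    simp only [Function.update_self, hwj, Function.update_of_ne (Fin.succAbove_ne i _)]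
    ring
  have hs : ∀ i : Fin (m + 1), Summable fun J : Fin (m + 1) → Zbar =>
      (Complex.I * freq (J i)) * (c J * ∏ k, z (J k)) := fun i =>
    (summable_form hp hc (Function.update (fun _ => z) i w)).congr (e i)
  simp only [formMap_apply]
  rw [Finset.sum_congr rfl fun i _ => tsum_congr (e i), ← Summable.tsum_finsetSum fun i _ => hs i,
    ← tsum_neg, poly]
  refine tsum_congr fun J => ?_
  rw [← Finset.sum_mul, ← Finset.mul_sum]
  push_cast
  ring

/-! ### Restriction and composition -/

theorem IsSymplecticTransformation.mono {p : ℝ} {Φ : SeqSpace p → SeqSpace p}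
    {U V : Set (SeqSpace p)} (h : IsSymplecticTransformation Φ V) (hU : IsOpen U) (hUV : U ⊆ V)
    (h0 : (0 : SeqSpace p) ∈ U) : IsSymplecticTransformation Φ U where
  isOpen := hU
  zero_mem := h0
  map_zero := h.map_zero
  analytic := h.analytic.mono hUV
  smoothing := by
    obtain ⟨Ψ, hΨ, hΦ⟩ := h.smoothing
    exact ⟨Ψ, hΨ.mono hUV, fun z hz => hΦ z (hUV hz)⟩
  real z hz := h.real z (hUV hz)
  injOn := h.injOn.mono hUV
  isOpen_image := by
    obtain ⟨Φinv, hinv, hΦ⟩ := h.analytic_inv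
    have : Φ '' U = Φ '' V ∩ Φinv ⁻¹' U := by
      ext w
      constructor
      · rintro ⟨z, hz, rfl⟩
        exact ⟨⟨z, hUV hz, rfl⟩, by rw [Set.mem_preimage, hΦ z (hUV hz)]; exact hz⟩
      · rintro ⟨⟨z, hz, rfl⟩, hw⟩
        rw [Set.mem_preimage, hΦ z hz] at hw
        exact ⟨z, hw, rfl⟩
    rw [this]
    exact hinv.continuousOn.isOpen_inter_preimage h.isOpen_image hU
  analytic_inv := by
    obtain ⟨Φinv, hinv, hΦ⟩ := h.analytic_inv
    exact ⟨Φinv, hinv.mono (Set.image_mono hUV), fun z hz => hΦ z (hUV hz)⟩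
  symplectic z hz := h.symplectic z (hUV hz)

theorem hasAnalyticField_of_sympForm {p : ℝ} (hp : 0 ≤ p) {F : SeqSpace p → ℂ}
    {X : SeqSpace p → SeqSpace (p + 1)} {U : Set (SeqSpace p)} (hF : AnalyticOnNhd ℂ F U)
    (hX : AnalyticOnNhd ℂ X U)
    (h : ∀ z ∈ U, ∀ w, sympForm (incl p (X z)) w = fderiv ℂ F z w) : HasAnalyticField F X U where
  analytic_fun := hF
  analytic_field := hX
  field_eq z hz j := by
    rw [← h z hz, sympForm_unitVec hp, incl_coord]
    linear_combination ((X z) j) * (sgn j * sgn j * Complex.I_mul_I - sgn_mul_self j)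

/-- Symplectic transformations carry Hamiltonian vector fields to Hamiltonian vector fields. -/
theorem HasAnalyticField.comp {p : ℝ} (hp : 0 ≤ p) {F : SeqSpace p → ℂ}
    {X : SeqSpace p → SeqSpace (p + 1)} {U W : Set (SeqSpace p)} {Φ : SeqSpace p → SeqSpace p}
    (hF : HasAnalyticField F X W) (hΦ : IsSymplecticTransformation Φ U) (hUW : Set.MapsTo Φ U W) :
    ∃ Y, HasAnalyticField (fun z => F (Φ z)) Y U := by
  obtain ⟨Ψ, hΨ, hΦΨ⟩ := hΦ.smoothing
  obtain ⟨Φinv, hinv, hleft⟩ := hΦ.analytic_inv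
  set Θ : SeqSpace p → SeqSpace (p + 1) := fun w => -Ψ (Φinv w) with hΘ
  have hΘan : AnalyticOnNhd ℂ Θ (Φ '' U) := fun w hw => by
    obtain ⟨z, hz, rfl⟩ := hw
    refine AnalyticAt.fun_neg (AnalyticAt.fun_comp ?_ (hinv _ ⟨z, hz, rfl⟩))
    rw [hleft z hz]
    exact hΨ z hz
  have hinvΘ : ∀ w ∈ Φ '' U, Φinv w = w + inclL p (Θ w) := by
    rintro _ ⟨z, hz, rfl⟩
    rw [hΘ]
    simp only [hleft z hz, map_neg, inclL_apply]
    rw [← sub_eq_add_neg, eq_sub_iff_add_eq]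
    exact (hΦΨ z hz).symm
  refine ⟨fun z => X (Φ z) + fderiv ℂ Θ (Φ z) (incl p (X (Φ z))),
    hasAnalyticField_of_sympForm hp (fun z hz => ?_) (fun z hz => ?_) fun z hz w => ?_⟩
  · exact (hF.analytic_fun _ (hUW hz)).fun_comp (hΦ.analytic z hz)
  · have h1 : AnalyticAt ℂ (fun z => X (Φ z)) z :=
      (hF.analytic_field _ (hUW hz)).fun_comp (hΦ.analytic z hz)
    have h2 : AnalyticAt ℂ (fun z => fderiv ℂ Θ (Φ z)) z :=
      (hΘan _ ⟨z, hz, rfl⟩).fderiv.fun_comp (hΦ.analytic z hz)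
    have h3 : AnalyticAt ℂ (fun z => inclL p (X (Φ z))) z :=
      ((inclL p).analyticAt _).fun_comp h1
    exact h1.fun_add (AnalyticAt.fun_comp (f := fun z => (fderiv ℂ Θ (Φ z), inclL p (X (Φ z))))
      ((ContinuousLinearMap.id ℂ (SeqSpace p →L[ℂ] SeqSpace (p + 1))).analyticAt_bilinear _)
      (h2.prod h3))
  · have hz' : Φ z ∈ Φ '' U := ⟨z, hz, rfl⟩
    have hnhds : Φ '' U ∈ 𝓝 (Φ z) := hΦ.isOpen_image.mem_nhds hz'
    set a := incl p (X (Φ z)) with ha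
    have hd1 : HasFDerivAt Φinv (ContinuousLinearMap.id ℂ _ + (inclL p).comp (fderiv ℂ Θ (Φ z)))
        (Φ z) := by
      have h := (hasFDerivAt_id (𝕜 := ℂ) (Φ z)).add
        ((inclL p).hasFDerivAt.comp (Φ z) (hΘan _ hz').differentiableAt.hasFDerivAt)
      refine h.congr_of_eventuallyEq ?_
      filter_upwards [hnhds] with w hw
      exact hinvΘ w hw
    have hd2 : HasFDerivAt Φ (fderiv ℂ Φ z) z := (hΦ.analytic z hz).differentiableAt.hasFDerivAt
    have hd3 : (fderiv ℂ Φ z).comp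
        (ContinuousLinearMap.id ℂ _ + (inclL p).comp (fderiv ℂ Θ (Φ z)))
          = ContinuousLinearMap.id ℂ _ := by
      have h : HasFDerivAt (fun w => Φ (Φinv w)) ((fderiv ℂ Φ z).comp
          (ContinuousLinearMap.id ℂ _ + (inclL p).comp (fderiv ℂ Θ (Φ z)))) (Φ z) := by
        refine HasFDerivAt.comp (Φ z) ?_ hd1
        rw [hleft z hz]
        exact hd2
      refine h.unique ((hasFDerivAt_id (Φ z)).congr_of_eventuallyEq ?_)
      filter_upwards [hnhds] with w hw
      obtain ⟨y, hy, rfl⟩ := hw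
      simp [hleft y hy]
    have hd4 : fderiv ℂ Φ z (incl p (X (Φ z) + fderiv ℂ Θ (Φ z) a)) = a := by
      have := congrArg (fun ℓ : SeqSpace p →L[ℂ] SeqSpace p => ℓ a) hd3
      simpa [map_add, ← ha] using this
    rw [← hΦ.symplectic z hz, hd4, ha, hF.sympForm_eq hp (hUW hz)]
    have h := HasFDerivAt.comp z (hF.analytic_fun _ (hUW hz)).differentiableAt.hasFDerivAt hd2
    have h' : fderiv ℂ (fun z => F (Φ z)) z = (fderiv ℂ F (Φ z)).comp (fderiv ℂ Φ z) := h.fderiv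
    rw [h']
    rfl

theorem HasAnalyticField.sub {p : ℝ} {F G : SeqSpace p → ℂ} {X Y : SeqSpace p → SeqSpace (p + 1)}
    {U : Set (SeqSpace p)} (hF : HasAnalyticField F X U) (hG : HasAnalyticField G Y U) :
    HasAnalyticField (fun z => F z - G z) (fun z => X z - Y z) U where
  analytic_fun := hF.analytic_fun.sub hG.analytic_fun
  analytic_field := hF.analytic_field.sub hG.analytic_field
  field_eq z hz j := by
    rw [sub_coord, hF.field_eq z hz, hG.field_eq z hz,
      fderiv_fun_sub (hF.analytic_fun z hz).differentiableAt (hG.analytic_fun z hz).differentiableAt]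
    simp
    ring

theorem HasAnalyticField.add {p : ℝ} {F G : SeqSpace p → ℂ} {X Y : SeqSpace p → SeqSpace (p + 1)}
    {U : Set (SeqSpace p)} (hF : HasAnalyticField F X U) (hG : HasAnalyticField G Y U) :
    HasAnalyticField (fun z => F z + G z) (fun z => X z + Y z) U where
  analytic_fun := hF.analytic_fun.add hG.analytic_fun
  analytic_field := hF.analytic_field.add hG.analytic_field
  field_eq z hz j := by
    rw [add_coord, hF.field_eq z hz, hG.field_eq z hz,
      fderiv_fun_add (hF.analytic_fun z hz).differentiableAt (hG.analytic_fun z hz).differentiableAt]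
    simp
    ring

theorem HasAnalyticField.mono {p : ℝ} {F : SeqSpace p → ℂ} {X : SeqSpace p → SeqSpace (p + 1)}
    {U V : Set (SeqSpace p)} (hF : HasAnalyticField F X V) (h : U ⊆ V) : HasAnalyticField F X U where
  analytic_fun := hF.analytic_fun.mono h
  analytic_field := hF.analytic_field.mono h
  field_eq z hz := hF.field_eq z (h hz)

/-- A germ at the origin that is tangent to the identity, smoothing, real and symplectic is a
symplectic transformation of a small neighbourhood. -/
theorem exists_isSymplecticTransformation {p : ℝ} {Φ : SeqSpace p → SeqSpace p}
    {Ψ : SeqSpace p → SeqSpace (p + 1)} (h0 : Φ 0 = 0) (hΦ : AnalyticAt ℂ Φ 0)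
    (hΨ : AnalyticAt ℂ Ψ 0)
    (hd : HasStrictFDerivAt Φ (ContinuousLinearMap.id ℂ (SeqSpace p)) 0)
    (hΦΨ : ∀ᶠ z in 𝓝 0, Φ z = z + incl p (Ψ z)) (hreal : ∀ᶠ z in 𝓝 0, IsReal z → IsReal (Φ z))
    (hsymp : ∀ᶠ z in 𝓝 0, ∀ v w : SeqSpace p,
      sympForm (fderiv ℂ Φ z v) (fderiv ℂ Φ z w) = sympForm v w)
    {P : SeqSpace p → Prop} (hP : ∀ᶠ z in 𝓝 0, P z) :
    ∃ V, IsSymplecticTransformation Φ V ∧ ∀ z ∈ V, P z := by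
  have hd' : HasStrictFDerivAt Φ ((ContinuousLinearEquiv.refl ℂ (SeqSpace p) :
      SeqSpace p ≃L[ℂ] SeqSpace p) : SeqSpace p →L[ℂ] SeqSpace p) 0 := hd
  set e := hd'.toOpenPartialHomeomorph Φ with he
  have heΦ : ∀ z, e z = Φ z := fun z => rfl
  have hinv0 : AnalyticAt ℂ e.symm 0 := by
    have h := (hΦ.contDiffAt (n := ⊤)).to_localInverse hd'.hasFDerivAt (by simp)
    rw [h0] at h
    exact h.analyticAt
  have hinv : ∀ᶠ z in 𝓝 0, AnalyticAt ℂ e.symm (Φ z) := by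
    have h := hΦ.continuousAt.tendsto
    rw [h0] at h
    exact h.eventually hinv0.eventually_analyticAt
  obtain ⟨S, hS, hSo, h0S⟩ := eventually_nhds_iff.1 (hP.and (hΦ.eventually_analyticAt.and
    (hΨ.eventually_analyticAt.and (hΦΨ.and (hreal.and (hsymp.and hinv))))))
  have hsub : S ∩ e.source ⊆ e.source := Set.inter_subset_right
  refine ⟨S ∩ e.source, ?_, fun z hz => (hS z hz.1).1⟩
  exact {
    isOpen := hSo.inter e.open_source
    zero_mem := ⟨h0S, hd'.mem_toOpenPartialHomeomorph_source⟩
    map_zero := h0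
    analytic := fun z hz => (hS z hz.1).2.1
    smoothing := ⟨Ψ, fun z hz => (hS z hz.1).2.2.1, fun z hz => (hS z hz.1).2.2.2.1⟩
    real := fun z hz => (hS z hz.1).2.2.2.2.1
    injOn := e.injOn.mono hsub
    isOpen_image := e.isOpen_image_of_subset_source (hSo.inter e.open_source) hsub
    analytic_inv := by
      refine ⟨e.symm, ?_, fun z hz => e.left_inv hz.2⟩
      rintro _ ⟨z, hz, rfl⟩
      exact (hS z hz.1).2.2.2.2.2.2
    symplectic := fun z hz => (hS z hz.1).2.2.2.2.2.1 }

/-! ### Reality -/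

/-- The antilinear involution whose fixed points are the real points. -/
def conjSeq (p : ℝ) : SeqSpace p →ₗᵢ[ℝ] SeqSpace p where
  toFun z := ⟨fun j => starRingEnd ℂ (z (-j)), by
    refine mem_hSubmodule_of_tsum (ne_top_of_le_ne_top (b := ‖z‖ₑ ^ 2) (by simp) (le_of_eq ?_))
    rw [← tsum_enorm_sq z, ← (Equiv.neg Zbar).tsum_eq]
    exact tsum_congr fun j => by simp [wt_neg]⟩
  map_add' a b := seq_ext fun j => map_add (starRingEnd ℂ) (a (-j)) (b (-j))
  map_smul' r a := seq_ext fun j => by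
    change starRingEnd ℂ ((r : ℂ) * a (-j)) = (r : ℂ) * starRingEnd ℂ (a (-j))
    simp
  norm_map' z := by
    have h : ∀ a b : SeqSpace p, ‖a‖ₑ ^ 2 = ‖b‖ₑ ^ 2 → ‖a‖ = ‖b‖ := fun a b hab => by
      have := le_antisymm (le_of_sq_le_sq hab.le) (le_of_sq_le_sq hab.ge)
      rw [← toReal_enorm, this, toReal_enorm]
    refine h _ _ ?_
    rw [← tsum_enorm_sq, ← tsum_enorm_sq z, ← (Equiv.neg Zbar).tsum_eq]
    refine tsum_congr fun j => ?_
    change (wt p (-j) * ‖starRingEnd ℂ (z (- -j))‖ₑ) ^ 2 = _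
    simp [wt_neg]

theorem conjSeq_coord {p : ℝ} (z : SeqSpace p) (j : Zbar) :
    (conjSeq p z) j = starRingEnd ℂ (z (-j)) := rfl

theorem isReal_iff {p : ℝ} {z : SeqSpace p} : IsReal z ↔ conjSeq p z = z := by
  constructor
  · intro h
    exact seq_ext fun j => by rw [conjSeq_coord, h j, Complex.conj_conj]
  · intro h j
    conv_lhs => rw [← h]
    rw [conjSeq_coord, neg_neg]

/-- Coefficients of functions that are real at real points. -/
def RealCoeff {m : ℕ} (c : (Fin m → Zbar) → ℂ) : Prop :=
  ∀ J, c (fun i => -J i) = starRingEnd ℂ (c J)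

theorem gradKern_neg {m : ℕ} {c : (Fin (m + 1) → Zbar) → ℂ} (hc : RealCoeff c) (j : Zbar)
    (L : Fin m → Zbar) : gradKern c (-j) (fun i => -L i) = starRingEnd ℂ (gradKern c j L) := by
  rw [gradKern, gradKern, map_sum]
  refine Finset.sum_congr rfl fun i _ => ?_
  rw [← hc]
  congr 1
  ext k : 1
  refine Fin.succAboveCases i ?_ (fun k => ?_) k <;> simp

theorem kern_neg {m : ℕ} {c : (Fin (m + 1) → Zbar) → ℂ} (hc : RealCoeff c) (j : Zbar)
    (L : Fin m → Zbar) : kern c (-j) (fun i => -L i) = starRingEnd ℂ (kern c j L) := by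
  have hs : starRingEnd ℂ (sgn j) = sgn j := by simp [sgn]
  rw [kern_eq_gradKern, gradKern_neg hc, kern_eq_gradKern, map_mul, map_mul, Complex.conj_I, hs,
    sgn_neg]
  ring

theorem RealCoeff.bracket {m n : ℕ} {a : (Fin (m + 1) → Zbar) → ℂ} {b : (Fin (n + 1) → Zbar) → ℂ}
    (ha : RealCoeff a) (hb : RealCoeff b) : RealCoeff (bracketCoeff a b) := fun L => by
  rw [bracketCoeff_eq, bracketCoeff_eq, Complex.conj_tsum, ← (Equiv.neg Zbar).tsum_eq]
  refine tsum_congr fun j => ?_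
  rw [map_mul, ← gradKern_neg ha, ← kern_neg hb]
  rfl

theorem fieldMap_conj {p : ℝ} (hp : 0 < p) {m : ℕ} {c : (Fin (m + 1) → Zbar) → ℂ} (hc : Good c)
    (hr : RealCoeff c) (v : Fin m → SeqSpace p) :
    fieldMap hp hc.kern (fun k => conjSeq p (v k)) = conjSeq (p + 1) (fieldMap hp hc.kern v) := by
  refine seq_ext fun j => ?_
  rw [conjSeq_coord, fieldMap_coord, fieldMap_coord, Complex.conj_tsum,
    ← (Equiv.piCongrRight fun _ : Fin m => Equiv.neg Zbar).tsum_eq]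
  refine tsum_congr fun L => ?_
  rw [map_mul, map_prod, ← kern_neg hr, neg_neg]
  simp only [conjSeq_coord]
  congr 1
  refine Finset.prod_congr rfl fun k _ => ?_
  change starRingEnd ℂ ((v k) (- -L k)) = _
  rw [neg_neg]

theorem isFlowLine_conj {p : ℝ} {m : ℕ}
    {M : ContinuousMultilinearMap ℂ (fun _ : Fin m => SeqSpace p) (SeqSpace (p + 1))}
    (hM : ∀ v, M (fun k => conjSeq p (v k)) = conjSeq (p + 1) (M v)) {z : SeqSpace p}
    {γ : C(UI, SeqSpace p)} (h : IsFlowLine M (inclL p) z γ) :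
    IsFlowLine M (inclL p) (conjSeq p z)
      ((⟨conjSeq p, (conjSeq p).continuous⟩ : C(SeqSpace p, SeqSpace p)).comp γ) := by
  intro t
  set γ' := (⟨conjSeq p, (conjSeq p).continuous⟩ : C(SeqSpace p, SeqSpace p)).comp γ with hγ'
  have h1 : primitive _ (superpose M fun _ => γ') t
      = conjSeq (p + 1) (primitive _ (superpose M fun _ => γ) t) := by
    rw [primitive_apply, primitive_apply, ← LinearIsometry.intervalIntegral_comp_comm]
    congr 1
    ext s : 1
    exact hM _
  rw [h1]
  change conjSeq p (γ t) = _
  rw [h t, map_add]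
  rfl

/-! ### The Hamiltonian flow -/

theorem sympForm_diagDeriv_comm {p : ℝ} (hp : 0 < p) {m : ℕ} {c : (Fin (m + 1) → Zbar) → ℂ}
    (hc : Good c) (z a b : SeqSpace p) :
    sympForm (incl p (diagDeriv (fieldMap hp hc.kern) z a)) b
      = sympForm (incl p (diagDeriv (fieldMap hp hc.kern) z b)) a := by
  have hF := hasAnalyticField_poly hp hc
  have key : ∀ a b : SeqSpace p, sympForm (incl p (diagDeriv (fieldMap hp hc.kern) z a)) b
      = fderiv ℂ (fderiv ℂ (poly c)) z a b := fun a b => by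
    have h1 : HasFDerivAt (fun y => fderiv ℂ (poly c) y b)
        ((ContinuousLinearMap.apply ℂ ℂ b).comp (fderiv ℂ (fderiv ℂ (poly c)) z)) z :=
      (ContinuousLinearMap.apply ℂ ℂ b).hasFDerivAt.comp z
        (analyticAt_poly hp hc z).fderiv.differentiableAt.hasFDerivAt
    have h2 : HasFDerivAt (fun y => sympL hp.le (inclL p (polyField hp hc y)) b)
        ((((sympL hp.le).flip b).comp (inclL p)).comp (diagDeriv (fieldMap hp hc.kern) z)) z :=
      (((sympL hp.le).flip b).comp (inclL p)).hasFDerivAt.comp z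
        (hasStrictFDerivAt_diag (fieldMap hp hc.kern) z).hasFDerivAt
    have h3 : (fun y => sympL hp.le (inclL p (polyField hp hc y)) b)
        = fun y => fderiv ℂ (poly c) y b := by
      ext y
      exact hF.sympForm_eq hp.le (Set.mem_univ y) b
    rw [h3] at h2
    exact congrArg (fun ℓ : SeqSpace p →L[ℂ] ℂ => ℓ a) (h2.unique h1)
  rw [key, key]
  exact ((analyticAt_poly hp hc z).contDiffAt (n := ⊤)).isSymmSndFDerivAt_of_omega a b

theorem hasDerivWithinAt_extend_flow {p : ℝ} (hp : 0 < p) {m : ℕ} {c : (Fin (m + 1) → Zbar) → ℂ}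
    (hc : Good c) {z : SeqSpace p} {γ : C(UI, SeqSpace p)}
    (h : IsFlowLine (fieldMap hp hc.kern) (inclL p) z γ) {t : ℝ} (ht : t ∈ Set.Icc (0 : ℝ) 1) :
    HasDerivWithinAt (extend γ) (incl p (polyField hp hc (extend γ t))) (Set.Icc 0 1) t := by
  have h1 := hasDerivWithinAt_extend h ht
  rw [extend_of_mem _ ht] at h1
  rw [extend_of_mem _ ht]
  exact h1

theorem sympForm_fderiv_flow {p : ℝ} (hp : 0 < p) {m : ℕ} {c : (Fin (m + 1) → Zbar) → ℂ}
    (hc : Good c) {Γ : SeqSpace p → C(UI, SeqSpace p)} {z : SeqSpace p}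
    (hΓ : DifferentiableAt ℂ Γ z)
    (h : ∀ᶠ y in 𝓝 z, IsFlowLine (fieldMap hp hc.kern) (inclL p) y (Γ y)) (v w : SeqSpace p) :
    sympForm (fderiv ℂ Γ z v ⟨1, by simp⟩) (fderiv ℂ Γ z w ⟨1, by simp⟩) = sympForm v w := by
  set M := fieldMap hp hc.kern with hM
  set η : SeqSpace p → ℝ → SeqSpace p := fun v => extend (fderiv ℂ Γ z v) with hη
  set γ : ℝ → SeqSpace p := extend (Γ z) with hγ
  have hd : ∀ v, ∀ t ∈ Set.Icc (0 : ℝ) 1,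
      HasDerivWithinAt (η v) (inclL p (diagDeriv M (γ t) (η v t))) (Set.Icc 0 1) t := by
    intro v t ht
    have h1 := hasDerivWithinAt_extend (fderiv_flow hΓ h v) ht
    rw [extend_of_mem _ ht, diagDeriv_superpose] at h1
    rw [hγ, hη]
    simp only [extend_of_mem _ ht]
    exact h1
  have h0 : ∀ v, η v 0 = v := fun v => by
    rw [hη]
    simp only
    rw [extend_of_mem _ (by simp : (0 : ℝ) ∈ Set.Icc (0 : ℝ) 1), fderiv_flow hΓ h v,
      primitive_apply]
    simp
  have hω : ∀ t ∈ Set.Icc (0 : ℝ) 1, HasDerivWithinAt (fun t => sympL hp.le (η v t) (η w t))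
      ((fun _ => (0 : ℂ)) t) (Set.Icc 0 1) t := by
    intro t ht
    have h1 := ((sympL hp.le).bilinearRestrictScalars ℝ).hasFDerivWithinAt_of_bilinear
      (hd v t ht).hasFDerivWithinAt (hd w t ht).hasFDerivWithinAt
    have h2 := h1.hasDerivWithinAt
    refine h2.congr_deriv ?_
    change sympForm (η v t) ((1 : ℝ) • incl p (diagDeriv M (γ t) (η w t)))
      + sympForm ((1 : ℝ) • incl p (diagDeriv M (γ t) (η v t))) (η w t) = 0
    rw [one_smul, one_smul, sympForm_swap (η v t), sympForm_diagDeriv_comm hp hc, neg_add_cancel]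
  have hconst := norm_image_sub_le_of_norm_deriv_le_segment' hω (C := 0) (by simp) 1 (by simp)
  rw [zero_mul, norm_le_zero_iff, sub_eq_zero] at hconst
  simp only [h0] at hconst
  rw [← sympL_apply hp.le v w, ← hconst, hη]
  simp only [extend_of_mem _ (by simp : (1 : ℝ) ∈ Set.Icc (0 : ℝ) 1)]
  rfl

/-- The time-one map of the flow of a Hamiltonian of degree at least three with admissible
coefficients. -/
theorem exists_timeOneMap {p : ℝ} (hp : 0 < p) {m : ℕ} (hm : 2 ≤ m)
    {c : (Fin (m + 1) → Zbar) → ℂ} (hc : Good c) (hr : RealCoeff c) :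
    ∃ (Φ : SeqSpace p → SeqSpace p) (V : Set (SeqSpace p)) (K : ℝ),
      IsSymplecticTransformation Φ V ∧ 0 ≤ K ∧
      ∀ z ∈ V, ∃ γ : ℝ → SeqSpace p, γ 0 = z ∧ γ 1 = Φ z ∧
        (∀ t ∈ Set.Icc (0 : ℝ) 1,
          HasDerivWithinAt γ (incl p (polyField hp hc (γ t))) (Set.Icc 0 1) t) ∧
        ∀ t, ‖γ t‖ ≤ K * ‖z‖ := by
  obtain ⟨Γ, hΓan, hΓ0, hΓd, hΓflow, r, hr0, huniq⟩ := exists_flow (fieldMap hp hc.kern) hm (inclL p)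
  set one : UI := ⟨1, by simp⟩ with hone
  have ev : ∀ (E : Type) [NormedAddCommGroup E] [NormedSpace ℂ E],
      ∃ e : C(UI, E) →L[ℂ] E, ∀ γ, e γ = γ one := fun E _ _ =>
    ⟨ContinuousMap.evalCLM ℂ one, fun γ => rfl⟩
  obtain ⟨e, he⟩ := ev (SeqSpace p)
  obtain ⟨e', he'⟩ := ev (SeqSpace (p + 1))
  obtain ⟨K, hK⟩ := hΓd.hasFDerivAt.isBigO_sub.bound
  simp only [hΓ0, sub_zero] at hK
  obtain ⟨V, hV, hVP⟩ := exists_isSymplecticTransformation (Φ := fun z => e (Γ z))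
    (Ψ := fun z => e' (primitive _ (superpose (fieldMap hp hc.kern) fun _ => Γ z)))
    (P := fun z => IsFlowLine (fieldMap hp hc.kern) (inclL p) z (Γ z) ∧ ‖Γ z‖ ≤ K * ‖z‖)
    (by rw [hΓ0, map_zero]) ((e.analyticAt _).fun_comp hΓan)
    (by
      have h := AnalyticAt.fun_comp (f := Γ)
        (analyticAt_diag (superpose (fieldMap hp hc.kern)) (Γ 0)) hΓan
      exact ((e'.comp (primitive (SeqSpace (p + 1)))).analyticAt _).fun_comp h)
    (by
      refine (e.hasStrictFDerivAt.comp 0 hΓd).congr_fderiv ?_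
      ext z : 1
      exact he _)
    (by
      filter_upwards [hΓflow] with z hz
      rw [he, he', hz one]
      rfl)
    (by
      have hsmall : ∀ᶠ z in 𝓝 0, ‖Γ z‖ < r := by
        have h := hΓan.continuousAt.norm.tendsto
        rw [hΓ0, norm_zero] at h
        exact h.eventually_lt_const hr0
      filter_upwards [hΓflow, hsmall] with z hz hzr hreal
      have h1 := isFlowLine_conj (fieldMap_conj hp hc hr) hz
      rw [isReal_iff.1 hreal] at h1
      have h2 := huniq z _ _ (lt_of_le_of_lt ?_ hzr) hzr h1 hz
      · rw [isReal_iff, he]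
        exact congrArg (fun γ : C(UI, SeqSpace p) => γ one) h2
      · refine (ContinuousMap.norm_le _ (norm_nonneg _)).2 fun t => ?_
        exact ((conjSeq p).norm_map _).trans_le ((Γ z).norm_coe_le_norm t))
    (by
      filter_upwards [hΓflow.eventually_nhds, hΓan.eventually_analyticAt] with z hz hza v w
      have h1 : fderiv ℂ (fun z => e (Γ z)) z = e.comp (fderiv ℂ Γ z) :=
        (e.hasFDerivAt.comp z hza.differentiableAt.hasFDerivAt).fderiv
      rw [h1, ContinuousLinearMap.comp_apply, ContinuousLinearMap.comp_apply, he, he]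
      exact sympForm_fderiv_flow hp hc hza.differentiableAt hz v w)
    (hΓflow.and hK)
  refine ⟨_, V, |K|, hV, abs_nonneg K, fun z hz => ⟨extend (Γ z), ?_, ?_, fun t ht => ?_, fun t => ?_⟩⟩
  · rw [extend_of_mem _ (by simp : (0 : ℝ) ∈ Set.Icc (0 : ℝ) 1), (hVP z hz).1, primitive_apply]
    simp
  · rw [extend_of_mem _ (by simp : (1 : ℝ) ∈ Set.Icc (0 : ℝ) 1), he]
  · exact hasDerivWithinAt_extend_flow hp hc (hVP z hz).1 ht
  · exact (norm_extend_le _ t).trans ((hVP z hz).2.trans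
      (mul_le_mul_of_nonneg_right (le_abs_self K) (norm_nonneg z)))

/-! ### Lie expansions -/

theorem norm_poly_le {p : ℝ} (hp : 0 < p) {m : ℕ} {c : (Fin m → Zbar) → ℂ} (hc : Good c) :
    ∃ C : ℝ, 0 ≤ C ∧ ∀ z : SeqSpace p, ‖poly c z‖ ≤ C * ‖z‖ ^ m :=
  ⟨‖formMap hp hc‖, norm_nonneg _, fun z => by
    rw [poly_eq_formMap hp hc]
    exact norm_diag_le _ z⟩

/-- On `V`, the map `Φ` is the time-one map of the Hamiltonian vector field of `∑ c_J z^J`, and the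
flow lines are bounded by a multiple of the initial values. -/
def IsFlowOn {p : ℝ} (hp : 0 < p) {m : ℕ} {c : (Fin (m + 1) → Zbar) → ℂ} (hc : Good c)
    (Φ : SeqSpace p → SeqSpace p) (V : Set (SeqSpace p)) (K : ℝ) : Prop :=
  ∀ z ∈ V, ∃ γ : ℝ → SeqSpace p, γ 0 = z ∧ γ 1 = Φ z ∧
    (∀ t ∈ Set.Icc (0 : ℝ) 1,
      HasDerivWithinAt γ (incl p (polyField hp hc (γ t))) (Set.Icc 0 1) t) ∧
    ∀ t, ‖γ t‖ ≤ K * ‖z‖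

theorem hasDerivWithinAt_poly_comp {p : ℝ} (hp : 0 < p) {m n : ℕ}
    {a : (Fin (m + 1) → Zbar) → ℂ} {c : (Fin (n + 1) → Zbar) → ℂ} (ha : Good a) (hc : Good c)
    {γ : ℝ → SeqSpace p} {t : ℝ} {s : Set ℝ}
    (h : HasDerivWithinAt γ (incl p (polyField hp hc (γ t))) s t) :
    HasDerivWithinAt (fun t => poly a (γ t)) (poly (bracketCoeff a c) (γ t)) s t := by
  have h1 := (hasFDerivAt_poly hp ha (γ t)).restrictScalars ℝ
  rw [← fderiv_poly_polyField hp ha hc, (hasFDerivAt_poly hp ha (γ t)).fderiv]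
  exact h1.comp_hasDerivWithinAt t h

theorem hasDerivWithinAt_lam_comp {p : ℝ} (hp : 0 < p) {n : ℕ}
    {g c : (Fin (n + 1) → Zbar) → ℂ} (hc : Good c)
    (hg : ∀ J, -Complex.I * ((∑ i, freq (J i) : ℝ) : ℂ) * c J = -g J)
    {γ : ℝ → SeqSpace p} {t : ℝ} {s : Set ℝ}
    (h : HasDerivWithinAt γ (incl p (polyField hp hc (γ t))) s t) :
    HasDerivWithinAt (fun t => Lam (γ t)) (-poly g (γ t)) s t := by
  have h1 := (hasFDerivAt_poly hp good_lamCoeff (γ t)).restrictScalars ℝ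
  have h2 := fderiv_lam_polyField hp hc (γ t)
  have h3 : poly (fun J => -Complex.I * ((∑ i, freq (J i) : ℝ) : ℂ) * c J) (γ t)
      = -poly g (γ t) := by
    rw [poly, poly, ← tsum_neg]
    exact tsum_congr fun J => by rw [hg, neg_mul]
  rw [h3, Lam_eq_poly hp, (hasFDerivAt_poly hp good_lamCoeff (γ t)).fderiv] at h2
  rw [← h2, Lam_eq_poly hp]
  exact h1.comp_hasDerivWithinAt t h

theorem IsFlowOn.norm_poly_sub_le {p : ℝ} {hp : 0 < p} {m n : ℕ} {a : (Fin (m + 1) → Zbar) → ℂ}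
    {c : (Fin (n + 1) → Zbar) → ℂ} {hc : Good c} {Φ : SeqSpace p → SeqSpace p}
    {V : Set (SeqSpace p)} {K : ℝ} (hΦ : IsFlowOn hp hc Φ V K) (ha : Good a) :
    ∃ C : ℝ, 0 ≤ C ∧ ∀ z ∈ V, ‖poly a (Φ z) - poly a z‖ ≤ C * (K * ‖z‖) ^ (m + n) := by
  obtain ⟨C, hC, hbd⟩ := norm_poly_le hp (ha.bracket hc)
  refine ⟨C, hC, fun z hz => ?_⟩
  obtain ⟨γ, h0, h1, hd, hK⟩ := hΦ z hz
  have h := norm_image_sub_le_of_norm_deriv_le_segment'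
    (fun t ht => hasDerivWithinAt_poly_comp hp ha hc (hd t ht))
    (C := C * (K * ‖z‖) ^ (m + n))
    (fun t _ => (hbd _).trans (mul_le_mul_of_nonneg_left
      (pow_le_pow_left₀ (norm_nonneg _) (hK t) _) hC)) 1 (by simp)
  rw [h0, h1] at h
  simpa using h

/-- The first-order Lie expansion. -/
theorem IsFlowOn.norm_lam_add_poly_sub_le {p : ℝ} {hp : 0 < p} {n : ℕ}
    {g c : (Fin (n + 1) → Zbar) → ℂ} {hc : Good c} {Φ : SeqSpace p → SeqSpace p}
    {V : Set (SeqSpace p)} {K : ℝ} (hΦ : IsFlowOn hp hc Φ V K) (hg : Good g)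
    (hgc : ∀ J, -Complex.I * ((∑ i, freq (J i) : ℝ) : ℂ) * c J = -g J) :
    ∃ C : ℝ, 0 ≤ C ∧ ∀ z ∈ V,
      ‖Lam (Φ z) + poly g (Φ z) - Lam z‖ ≤ C * (K * ‖z‖) ^ (n + n) := by
  obtain ⟨C, hC, hbd⟩ := norm_poly_le hp (hg.bracket hc)
  refine ⟨C, hC, fun z hz => ?_⟩
  obtain ⟨γ, h0, h1, hd, hK⟩ := hΦ z hz
  have hder : ∀ t ∈ Set.Icc (0 : ℝ) 1, HasDerivWithinAt
      (fun t : ℝ => Lam (γ t) + (t : ℂ) * poly g (γ t))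
      ((t : ℂ) * poly (bracketCoeff g c) (γ t)) (Set.Icc 0 1) t := fun t ht => by
    have hid : HasDerivWithinAt (fun t : ℝ => (t : ℂ)) 1 (Set.Icc 0 1) t :=
      Complex.ofRealCLM.hasDerivAt.hasDerivWithinAt
    refine ((hasDerivWithinAt_lam_comp hp hc hgc (hd t ht)).add
      (hid.mul (hasDerivWithinAt_poly_comp hp hg hc (hd t ht)))).congr_deriv ?_
    ring
  have h := norm_image_sub_le_of_norm_deriv_le_segment' hder (C := C * (K * ‖z‖) ^ (n + n))
    (fun t ht => by
      rw [norm_mul, Complex.norm_real, Real.norm_eq_abs, abs_of_nonneg ht.1]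
      refine (mul_le_of_le_one_left (norm_nonneg _) ht.2.le).trans ?_
      exact (hbd _).trans (mul_le_mul_of_nonneg_left
        (pow_le_pow_left₀ (norm_nonneg _) (hK t) _) hC)) 1 (by simp)
  rw [h0, h1] at h
  simpa using h

/-- The second-order Lie expansion. -/
theorem IsFlowOn.norm_ham_sub_le {p : ℝ} {hp : 0 < p} {b g c : (Fin 6 → Zbar) → ℂ}
    {hc : Good (m := 5 + 1) c} {Φ : SeqSpace p → SeqSpace p}
    {V : Set (SeqSpace p)} {K : ℝ} (hΦ : IsFlowOn hp hc Φ V K) (hb : Good b) (hg : Good g)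
    (hgc : ∀ J, -Complex.I * ((∑ i, freq (J i) : ℝ) : ℂ) * c J = -g J) :
    ∃ C : ℝ, 0 ≤ C ∧ ∀ z ∈ V,
      ‖Lam (Φ z) + poly b (Φ z) + poly g (Φ z) - (Lam z + poly b z
        + poly (bracketCoeff (m := 5) (n := 5) b c) z
        + 1 / 2 * poly (bracketCoeff (m := 5) (n := 5) g c) z)‖ ≤ C * (K * ‖z‖) ^ 14 := by
  have hB2 : Good (m := 9 + 1) (bracketCoeff (m := 5) (n := 5) b c) := hb.bracket (m := 5) hc
  have hB1 : Good (m := 9 + 1) (bracketCoeff (m := 5) (n := 5) g c) := hg.bracket (m := 5) hc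
  obtain ⟨C₁, hC₁, hbd1⟩ := norm_poly_le hp (hB1.bracket hc)
  obtain ⟨C₂, hC₂, hbd2⟩ := norm_poly_le hp (hB2.bracket hc)
  refine ⟨C₂ + C₁, by positivity, fun z hz => ?_⟩
  obtain ⟨γ, h0, h1, hd, hK⟩ := hΦ z hz
  have hder : ∀ t ∈ Set.Icc (0 : ℝ) 1, HasDerivWithinAt
      (fun t : ℝ => Lam (γ t) + poly b (γ t) + (t : ℂ) * poly g (γ t)
        + (1 - (t : ℂ)) * poly (bracketCoeff (m := 5) (n := 5) b c) (γ t)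
        + ((1 - (t : ℂ) * t) / 2) * poly (bracketCoeff (m := 5) (n := 5) g c) (γ t))
      ((1 - (t : ℂ)) * poly (bracketCoeff (m := 9) (n := 5)
          (bracketCoeff (m := 5) (n := 5) b c) c) (γ t)
        + ((1 - (t : ℂ) * t) / 2) * poly (bracketCoeff (m := 9) (n := 5)
          (bracketCoeff (m := 5) (n := 5) g c) c) (γ t)) (Set.Icc 0 1) t := fun t ht => by
    have hid : HasDerivWithinAt (fun t : ℝ => (t : ℂ)) 1 (Set.Icc 0 1) t :=
      Complex.ofRealCLM.hasDerivAt.hasDerivWithinAt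
    have e1 := hasDerivWithinAt_lam_comp hp hc hgc (hd t ht)
    have e2 := hasDerivWithinAt_poly_comp (m := 5) hp hb hc (hd t ht)
    have e3 := hasDerivWithinAt_poly_comp (m := 5) hp hg hc (hd t ht)
    have e4 := hasDerivWithinAt_poly_comp hp hB2 hc (hd t ht)
    have e5 := hasDerivWithinAt_poly_comp hp hB1 hc (hd t ht)
    have e6 : HasDerivWithinAt (fun t : ℝ => (1 - (t : ℂ) * t) / 2) (-(t : ℂ)) (Set.Icc 0 1) t :=
      (((hid.mul hid).const_sub 1).div_const 2).congr_deriv (by ring)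
    refine ((((e1.add e2).add (hid.mul e3)).add ((hid.const_sub 1).mul e4)).add
      (e6.mul e5)).congr_deriv ?_
    ring
  have h := norm_image_sub_le_of_norm_deriv_le_segment' hder (C := (C₂ + C₁) * (K * ‖z‖) ^ 14)
    (fun t ht => by
      have ht0 := ht.1
      have ht1 := ht.2
      have n1 : ‖1 - (t : ℂ)‖ ≤ 1 := by
        rw [← Complex.ofReal_one, ← Complex.ofReal_sub, Complex.norm_real, Real.norm_eq_abs,
          abs_le]
        constructor <;> linarith
      have n2 : ‖(1 - (t : ℂ) * t) / 2‖ ≤ 1 := by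
        have : (1 - (t : ℂ) * t) / 2 = (((1 - t * t) / 2 : ℝ) : ℂ) := by push_cast; ring
        rw [this, Complex.norm_real, Real.norm_eq_abs, abs_le]
        constructor <;> nlinarith
      have hpow : ‖γ t‖ ^ 14 ≤ (K * ‖z‖) ^ 14 := pow_le_pow_left₀ (norm_nonneg _) (hK t) _
      refine (norm_add_le _ _).trans ?_
      rw [norm_mul, norm_mul, add_mul]
      refine add_le_add ?_ ?_
      · refine (mul_le_of_le_one_left (norm_nonneg _) n1).trans ?_
        exact (hbd2 _).trans (mul_le_mul_of_nonneg_left hpow hC₂)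
      · refine (mul_le_of_le_one_left (norm_nonneg _) n2).trans ?_
        exact (hbd1 _).trans (mul_le_mul_of_nonneg_left hpow hC₁)) 1 (by simp)
  rw [h0, h1] at h
  refine le_trans (le_of_eq ?_) (h.trans_eq (by ring))
  congr 1
  push_cast
  ring

/-! ### The two normal form steps -/

theorem exists_normalForm {p : ℝ} (hp : 0 < p) {b g f : (Fin 6 → Zbar) → ℂ}
    {rb rt rh f₂ : (Fin 10 → Zbar) → ℂ} (hb : Good b) (hg : Good g) (hf : Good (m := 5 + 1) f)
    (hrb : Good rb) (hrt : Good rt) (hrh : Good rh) (hf₂ : Good (m := 9 + 1) f₂)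
    (hfr : RealCoeff f) (hf₂r : RealCoeff f₂)
    (hgf : ∀ J, -Complex.I * ((∑ i, freq (J i) : ℝ) : ℂ) * f J = -g J)
    (hrf : ∀ J, -Complex.I * ((∑ i, freq (J i) : ℝ) : ℂ) * f₂ J = -rt J)
    (hsplit : ∀ z : SeqSpace p, poly (bracketCoeff (m := 5) (n := 5) b f) z
      + 1 / 2 * poly (bracketCoeff (m := 5) (n := 5) g f) z = poly rb z + poly rt z + poly rh z) :
    ∃ (Φ₁ Φ₂ : SeqSpace p → SeqSpace p) (V U : Set (SeqSpace p)) (T : SeqSpace p → ℂ),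
      IsSymplecticTransformation Φ₁ V ∧ IsTimeOneMap (polyField hp hf) Φ₁ V ∧
      IsSymplecticTransformation Φ₂ U ∧ Set.MapsTo Φ₂ U V ∧
      (∀ z ∈ U, Lam (Φ₁ (Φ₂ z)) + poly b (Φ₁ (Φ₂ z)) + poly g (Φ₁ (Φ₂ z)) =
        Lam z + poly b z + poly rb z + poly rh z + T z) ∧
      Asymptotics.IsBigO (𝓝 (0 : SeqSpace p)) T (fun z => ‖z‖ ^ 14) ∧
      ∃ X : SeqSpace p → SeqSpace (p + 1), HasAnalyticField T X U := by
  obtain ⟨Φ₁, V, K₁, hΦ₁, hK₁, hflow₁⟩ := exists_timeOneMap hp (by norm_num) hf hfr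
  obtain ⟨Φ₂, W, K₂, hΦ₂, hK₂, hflow₂⟩ := exists_timeOneMap hp (by norm_num) hf₂ hf₂r
  have hF₁ : IsFlowOn hp hf Φ₁ V K₁ := hflow₁
  have hF₂ : IsFlowOn hp hf₂ Φ₂ W K₂ := hflow₂
  set U := W ∩ Φ₂ ⁻¹' V with hU
  have hUo : IsOpen U := hΦ₂.analytic.continuousOn.isOpen_inter_preimage hΦ₂.isOpen hΦ₁.isOpen
  have h0U : (0 : SeqSpace p) ∈ U :=
    ⟨hΦ₂.zero_mem, by rw [Set.mem_preimage, hΦ₂.map_zero]; exact hΦ₁.zero_mem⟩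
  have hΦ₂U := hΦ₂.mono hUo Set.inter_subset_left h0U
  have hmaps : Set.MapsTo Φ₂ U V := fun z hz => hz.2
  refine ⟨Φ₁, Φ₂, V, U, fun z => (Lam (Φ₁ (Φ₂ z)) + poly b (Φ₁ (Φ₂ z)) + poly g (Φ₁ (Φ₂ z)))
    - (Lam z + poly b z + poly rb z + poly rh z), hΦ₁, ?_, hΦ₂U, hmaps, fun z _ => by ring, ?_, ?_⟩
  · intro z hz
    obtain ⟨γ, h0, h1, hd, -⟩ := hflow₁ z hz
    exact ⟨γ, h0, h1, hd⟩
  · obtain ⟨C₁, hC₁, e₁⟩ := hF₁.norm_ham_sub_le hb hg hgf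
    obtain ⟨C₂, hC₂, e₂⟩ := hF₂.norm_lam_add_poly_sub_le hrt hrf
    obtain ⟨C₃, hC₃, e₃⟩ := hF₂.norm_poly_sub_le (m := 5) hb
    obtain ⟨C₄, hC₄, e₄⟩ := hF₂.norm_poly_sub_le (m := 9) hrb
    obtain ⟨C₅, hC₅, e₅⟩ := hF₂.norm_poly_sub_le (m := 9) hrh
    refine Asymptotics.IsBigO.of_bound (C₁ * (K₁ * K₂) ^ 14 + C₃ * K₂ ^ 14
      + (C₂ + C₄ + C₅) * K₂ ^ 18) ?_
    have hball : ∀ᶠ z : SeqSpace p in 𝓝 0, ‖z‖ ≤ 1 := by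
      filter_upwards [Metric.ball_mem_nhds (0 : SeqSpace p) one_pos] with z hz
      simpa using (mem_ball_zero_iff.1 hz).le
    filter_upwards [hUo.mem_nhds h0U, hball] with z hz hz1
    obtain ⟨γ, h0, h1, -, hbd⟩ := hflow₂ z hz.1
    have hΦz : ‖Φ₂ z‖ ≤ K₂ * ‖z‖ := by rw [← h1]; exact hbd 1
    have a₁ := e₁ (Φ₂ z) hz.2
    have a₁' : C₁ * (K₁ * ‖Φ₂ z‖) ^ 14 ≤ C₁ * (K₁ * K₂) ^ 14 * ‖z‖ ^ 14 := by
      rw [mul_assoc, ← mul_pow, mul_assoc K₁]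
      gcongr
    have a₂ := e₂ z hz.1
    have a₃ := e₃ z hz.1
    have a₄ := e₄ z hz.1
    have a₅ := e₅ z hz.1
    have hpow : (K₂ * ‖z‖) ^ 18 ≤ K₂ ^ 18 * ‖z‖ ^ 14 := by
      rw [mul_pow]
      exact mul_le_mul_of_nonneg_left
        (pow_le_pow_of_le_one (norm_nonneg _) hz1 (by norm_num)) (by positivity)
    have hsp := hsplit (Φ₂ z)
    rw [norm_pow, norm_norm]
    set y := Φ₂ z with hy
    set A₁ := Lam (Φ₁ y) + poly b (Φ₁ y) + poly g (Φ₁ y) - (Lam y + poly b y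
        + poly (bracketCoeff (m := 5) (n := 5) b f) y
        + 1 / 2 * poly (bracketCoeff (m := 5) (n := 5) g f) y) with hA₁
    have hT : (Lam (Φ₁ y) + poly b (Φ₁ y) + poly g (Φ₁ y))
        - (Lam z + poly b z + poly rb z + poly rh z)
        = A₁ + (Lam y + poly rt y - Lam z) + (poly b y - poly b z) + (poly rb y - poly rb z)
          + (poly rh y - poly rh z) := by
      rw [hA₁]
      linear_combination hsp
    rw [hT]
    have t1 := norm_add_le (A₁ + (Lam y + poly rt y - Lam z) + (poly b y - poly b z)
      + (poly rb y - poly rb z)) (poly rh y - poly rh z)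
    have t2 := norm_add_le (A₁ + (Lam y + poly rt y - Lam z) + (poly b y - poly b z))
      (poly rb y - poly rb z)
    have t3 := norm_add_le (A₁ + (Lam y + poly rt y - Lam z)) (poly b y - poly b z)
    have t4 := norm_add_le A₁ (Lam y + poly rt y - Lam z)
    have b2 := a₂.trans (mul_le_mul_of_nonneg_left hpow hC₂)
    have b4 := a₄.trans (mul_le_mul_of_nonneg_left hpow hC₄)
    have b5 := a₅.trans (mul_le_mul_of_nonneg_left hpow hC₅)
    have b3 : ‖poly b y - poly b z‖ ≤ C₃ * (K₂ ^ 14 * ‖z‖ ^ 14) := by rwa [← mul_pow]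
    have b1 := a₁.trans a₁'
    calc _ ≤ C₁ * (K₁ * K₂) ^ 14 * ‖z‖ ^ 14 + C₂ * (K₂ ^ 18 * ‖z‖ ^ 14)
          + C₃ * (K₂ ^ 14 * ‖z‖ ^ 14) + C₄ * (K₂ ^ 18 * ‖z‖ ^ 14)
          + C₅ * (K₂ ^ 18 * ‖z‖ ^ 14) := by linarith
      _ = _ := by ring
  · have hHam := ((hasAnalyticField_poly hp good_lamCoeff).add
      (hasAnalyticField_poly (m := 5) hp hb)).add (hasAnalyticField_poly (m := 5) hp hg)
    obtain ⟨Y₁, hY₁⟩ := hHam.comp hp.le hΦ₁ (Set.mapsTo_univ _ _)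
    obtain ⟨Y₂, hY₂⟩ := hY₁.comp hp.le hΦ₂U hmaps
    have hN := (((hasAnalyticField_poly hp good_lamCoeff).add
      (hasAnalyticField_poly (m := 5) hp hb)).add (hasAnalyticField_poly (m := 9) hp hrb)).add
        (hasAnalyticField_poly (m := 9) hp hrh)
    rw [Lam_eq_poly hp]
    exact ⟨_, hY₂.sub (hN.mono (Set.subset_univ U))⟩

/-! ### The function `x / (1 + x²)` -/

/-- The dispersion relation. -/
def disp (x : ℝ) : ℝ := x / (1 + x ^ 2)

theorem disp_neg (x : ℝ) : disp (-x) = -disp x := by simp [disp, neg_div]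

theorem disp_pos {x : ℝ} (h : 0 < x) : 0 < disp x := by unfold disp; positivity

theorem abs_disp (x : ℝ) : |disp x| = disp |x| := by
  rw [disp, abs_div, abs_of_pos (by positivity : (0 : ℝ) < 1 + x ^ 2), disp, sq_abs]

theorem disp_le_inv {x : ℝ} (h : 0 < x) : disp x ≤ 1 / x := by
  rw [disp, div_le_div_iff₀ (by positivity) h]
  nlinarith

theorem le_disp {x : ℝ} (h : 1 ≤ x) : 1 / (2 * x) ≤ disp x := by
  rw [disp, div_le_div_iff₀ (by positivity) (by positivity)]
  nlinarith

theorem disp_lt {x y : ℝ} (hx : 1 ≤ x) (hxy : x < y) : disp y < disp x := by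
  rw [disp, disp, div_lt_div_iff₀ (by positivity) (by positivity)]
  nlinarith [mul_pos (sub_pos.2 hxy) (by nlinarith : (0 : ℝ) < x * y - 1)]

theorem disp_anti {x y : ℝ} (hx : 1 ≤ x) (hxy : x ≤ y) : disp y ≤ disp x := by
  rcases hxy.eq_or_lt with h | h
  · rw [h]
  · exact (disp_lt hx h).le

theorem disp_inj {x y : ℝ} (hx : 1 ≤ x) (hy : 1 ≤ y) (h : disp x = disp y) : x = y := by
  rcases lt_trichotomy x y with h1 | h1 | h1
  · exact absurd h (disp_lt hx h1).ne'
  · exact h1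
  · exact absurd h (disp_lt hy h1).ne

theorem tendsto_disp : Filter.Tendsto (fun j : ℤ => disp j) Filter.cofinite (𝓝 0) := by
  have h1 : Filter.Tendsto (fun j : ℤ => ((j : ℝ))⁻¹) Filter.cofinite (𝓝 0) := by
    refine Filter.tendsto_inv₀_cobounded.comp ?_
    rw [Metric.cobounded_eq_cocompact]
    exact Int.tendsto_coe_cofinite
  refine squeeze_zero_norm (fun j => ?_) (tendsto_norm_zero.comp h1)
  rw [Function.comp_apply, Real.norm_eq_abs, norm_inv, Real.norm_eq_abs, abs_disp]
  rcases eq_or_ne j 0 with h | h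
  · simp [h, disp]
  · have : 0 < |(j : ℝ)| := by positivity
    exact (disp_le_inv this).trans_eq (one_div _)

/-! ### Uniform lower bounds -/

theorem exists_pos_le_of_finset {α β : Type*} (s : Finset α) (Q : α → β → Prop) (F : α → β → ℝ)
    (h : ∀ x ∈ s, ∃ ε > 0, ∀ y, Q x y → ε ≤ F x y) :
    ∃ ε > 0, ∀ x ∈ s, ∀ y, Q x y → ε ≤ F x y := by
  classical
  induction s using Finset.induction_on with
  | empty => exact ⟨1, one_pos, by simp⟩
  | insert a s _ ih =>
    obtain ⟨ε₁, h₁, hε₁⟩ := h a (Finset.mem_insert_self a s)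
    obtain ⟨ε₂, h₂, hε₂⟩ := ih fun x hx => h x (Finset.mem_insert_of_mem hx)
    refine ⟨min ε₁ ε₂, lt_min h₁ h₂, fun x hx y hy => ?_⟩
    rcases Finset.mem_insert.1 hx with rfl | hx
    · exact (min_le_left _ _).trans (hε₁ y hy)
    · exact (min_le_right _ _).trans (hε₂ x hx y hy)

theorem exists_pos_le_of_tendsto {f : ℤ → ℝ} {l : ℝ} (hl : l ≠ 0)
    (hf : Filter.Tendsto f Filter.cofinite (𝓝 l)) : ∃ ε > 0, ∀ j, f j ≠ 0 → ε ≤ |f j| := by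
  have hl' : 0 < |l| := abs_pos.2 hl
  have h1 : ∀ᶠ j in Filter.cofinite, |l| / 2 < |f j| := hf.abs.eventually_const_lt (by linarith)
  have hfin : Set.Finite {j | ¬|l| / 2 < |f j|} := h1
  obtain ⟨ε, hε, h⟩ := exists_pos_le_of_finset hfin.toFinset (fun j (_ : Unit) => f j ≠ 0)
    (fun j _ => |f j|) fun j _ => by
      by_cases h0 : f j = 0
      · exact ⟨1, one_pos, fun _ h => absurd h0 h⟩
      · exact ⟨|f j|, abs_pos.2 h0, fun _ _ => le_rfl⟩
  refine ⟨min ε (|l| / 2), lt_min hε (by linarith), fun j hj => ?_⟩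
  by_cases hjs : |l| / 2 < |f j|
  · exact (min_le_right _ _).trans hjs.le
  · exact (min_le_left _ _).trans (h j (hfin.mem_toFinset.2 hjs) () hj)

/-! ### Arithmetic of the resonances -/

theorem eq_of_quadruple_resonance {n a j k : ℤ} (hn : 20 ≤ n) (ha : a ^ 2 = 4 ∨ a ^ 2 = 16)
    (hs : a * n + j + k = 0) (h : a * disp n + disp j + disp k = 0) :
    a ^ 2 = 4 ∧ j = k := by
  set P := j * k with hP
  have hanz : a * n ≠ 0 := by
    rintro h0
    rcases mul_eq_zero.1 h0 with h0 | h0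
    · rcases ha with h1 | h1 <;> simp [h0] at h1
    · omega
  have hsR : (j : ℝ) + k = -(a * n) := by
    have : ((a * n + j + k : ℤ) : ℝ) = 0 := by rw [hs]; simp
    push_cast at this
    linarith
  have hanR : (a : ℝ) * n ≠ 0 := by exact_mod_cast hanz
  have h1 : (1 + (j : ℝ) ^ 2) * (1 + (k : ℝ) ^ 2) = (1 + j * k) * (1 + (n : ℝ) ^ 2) := by
    unfold disp at h
    have d1 : (1 : ℝ) + (j : ℝ) ^ 2 ≠ 0 := by positivity
    have d2 : (1 : ℝ) + (k : ℝ) ^ 2 ≠ 0 := by positivity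
    have d3 : (1 : ℝ) + (n : ℝ) ^ 2 ≠ 0 := by positivity
    field_simp at h
    refine mul_left_cancel₀ hanR ?_
    linear_combination h - (1 + (n : ℝ) ^ 2) * (1 + j * k) * hsR
  have h2 : (1 + j ^ 2) * (1 + k ^ 2) = (1 + j * k) * (1 + n ^ 2) := by exact_mod_cast h1
  have hj : j + k = -(a * n) := by linarith
  have h3 : P ^ 2 - (3 + n ^ 2) * P + (a ^ 2 - 1) * n ^ 2 = 0 := by
    rw [hP]
    linear_combination h2 - (j + k - a * n) * hj
  have hd : (j - k) ^ 2 = a ^ 2 * n ^ 2 - 4 * P := by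
    rw [hP]
    linear_combination (j + k - a * n) * hj
  rcases ha with ha | ha
  · rw [ha] at h3 hd
    have h4 : (P - 3) * (P - n ^ 2) = 0 := by linear_combination h3
    rcases mul_eq_zero.1 h4 with h5 | h5
    · exfalso
      have h6 : (j - k) ^ 2 = 4 * n ^ 2 - 12 := by rw [hd]; linarith
      have h7 : |j - k| < 2 * n := by
        refine abs_lt_of_sq_lt_sq ?_ (by omega)
        nlinarith
      have h8 : |j - k| ^ 2 = 4 * n ^ 2 - 12 := by rw [sq_abs, h6]
      nlinarith [abs_nonneg (j - k)]
    · have h6 : (j - k) ^ 2 = 0 := by rw [hd]; linarith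
      have h7 : j = k := by
        have := pow_eq_zero_iff (two_ne_zero) |>.1 h6
        linarith
      exact ⟨ha, h7⟩
  · exfalso
    rw [ha] at h3
    set q := 2 * P - (3 + n ^ 2) with hq
    have h4 : q ^ 2 = (n ^ 2 - 27) ^ 2 - 720 := by
      rw [hq]
      linear_combination 4 * h3
    have hn2 : 400 ≤ n ^ 2 := by nlinarith
    have h7 : |q| < n ^ 2 - 27 := by
      refine abs_lt_of_sq_lt_sq ?_ (by omega)
      omega
    have h8 : |q| ^ 2 = (n ^ 2 - 27) ^ 2 - 720 := by rw [sq_abs, h4]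
    nlinarith [abs_nonneg q]

/-- For `n₂` large, the net number of `n₁` and `n₂` in a resonance with one more mode. -/
theorem disp_ne_of_single {n₁ n₂ a b j : ℤ} (hn₁ : 1 ≤ n₁) (hn₂ : 200 * n₁ ≤ n₂)
    (hab : |a| + |b| ≤ 9) (hodd : (a + b) % 2 = 1) (hs : a * n₁ + b * n₂ + j = 0)
    (hj : j ≠ n₁ ∧ j ≠ -n₁ ∧ j ≠ n₂ ∧ j ≠ -n₂) : a * disp n₁ + b * disp n₂ + disp j ≠ 0 := by
  have pure : ∀ {n a j : ℤ}, 1 ≤ n → a % 2 = 1 → a * n + j = 0 → j ≠ n → j ≠ -n →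
      a * disp n + disp j ≠ 0 := by
    intro n a j hn ha hs hj1 hj2 h
    have hja : (j : ℝ) = -(a * n) := by
      have : ((a * n + j : ℤ) : ℝ) = 0 := by rw [hs]; simp
      push_cast at this
      linarith
    have hnR : (1 : ℝ) ≤ n := by exact_mod_cast hn
    rw [hja, disp_neg, disp, disp] at h
    have ha0 : (a : ℝ) ≠ 0 := by
      intro h0
      have : a = 0 := by exact_mod_cast h0
      omega
    have d1 : (1 : ℝ) + (n : ℝ) ^ 2 ≠ 0 := by positivity
    have d2 : (1 : ℝ) + ((a : ℝ) * n) ^ 2 ≠ 0 := by positivity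
    have h2 : (a : ℝ) * n * (n ^ 2 * (a ^ 2 - 1)) = 0 := by
      field_simp at h
      linear_combination h
    have hn0 : (n : ℝ) ≠ 0 := by positivity
    have h3 : (a : ℝ) ^ 2 - 1 = 0 := by
      simpa [ha0, hn0] using h2
    have h4 : a ^ 2 = 1 := by
      have : (a : ℝ) ^ 2 = 1 := by linarith
      exact_mod_cast this
    have h4' : (a - 1) * (a + 1) = 0 := by linear_combination h4
    rcases mul_eq_zero.1 h4' with h5 | h5
    · replace h5 : a = 1 := by linarith
      exact hj2 (by rw [h5] at hs; linarith)
    · replace h5 : a = -1 := by linarith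
      exact hj1 (by rw [h5] at hs; linarith)
  by_cases hb : b = 0
  · subst hb
    simpa using pure (j := j) hn₁ (by omega) (by linarith) hj.1 hj.2.1
  by_cases ha : a = 0
  · subst ha
    simpa using pure (j := j) (n := n₂) (by omega) (by omega) (by linarith) hj.2.2.1 hj.2.2.2
  intro h
  have hn₁R : (1 : ℝ) ≤ n₁ := by exact_mod_cast hn₁
  have hn₂R : 200 * (n₁ : ℝ) ≤ n₂ := by exact_mod_cast hn₂
  have ha1 : (1 : ℝ) ≤ |(a : ℝ)| := by exact_mod_cast Int.one_le_abs ha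
  have hb1 : (1 : ℝ) ≤ |(b : ℝ)| := by exact_mod_cast Int.one_le_abs hb
  have habR : |(a : ℝ)| + |(b : ℝ)| ≤ 9 := by exact_mod_cast hab
  have hjR : (j : ℝ) = -(a * n₁ + b * n₂) := by
    have : ((a * n₁ + b * n₂ + j : ℤ) : ℝ) = 0 := by rw [hs]; simp
    push_cast at this
    linarith
  have hjabs : (n₂ : ℝ) / 2 ≤ |(j : ℝ)| := by
    have h1 : |(b : ℝ) * n₂| ≤ |(j : ℝ)| + |(a : ℝ) * n₁| := by
      have : (b : ℝ) * n₂ = -(j + a * n₁) := by rw [hjR]; ring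
      rw [this, abs_neg]
      exact abs_add_le _ _
    rw [abs_mul, abs_mul, abs_of_pos (by linarith : (0 : ℝ) < n₁),
      abs_of_pos (by linarith : (0 : ℝ) < n₂)] at h1
    nlinarith
  have e1 : |disp j| ≤ 2 / n₂ := by
    rw [abs_disp]
    refine (disp_le_inv (by linarith)).trans ?_
    rw [div_le_div_iff₀ (by linarith) (by linarith)]
    linarith
  have e2 : |(b : ℝ) * disp n₂| ≤ 9 / n₂ := by
    rw [abs_mul, abs_of_pos (disp_pos (by linarith : (0 : ℝ) < n₂))]
    calc |(b : ℝ)| * disp n₂ ≤ 9 * (1 / n₂) :=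
          mul_le_mul (by linarith) (disp_le_inv (by linarith)) (disp_pos (by linarith)).le (by norm_num)
      _ = 9 / n₂ := by ring
  have e3 : 1 / (2 * (n₁ : ℝ)) ≤ |(a : ℝ) * disp n₁| := by
    rw [abs_mul, abs_of_pos (disp_pos (by linarith : (0 : ℝ) < n₁))]
    exact (le_disp hn₁R).trans (le_mul_of_one_le_left (disp_pos (by linarith)).le ha1)
  have e4 : |(a : ℝ) * disp n₁| ≤ |(b : ℝ) * disp n₂| + |disp j| := by
    have : (a : ℝ) * disp n₁ = -(b * disp n₂ + disp j) := by linarith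
    rw [this, abs_neg]
    exact abs_add_le _ _
  have e5 : 1 / (2 * (n₁ : ℝ)) ≤ 11 / n₂ := by
    have : (11 : ℝ) / n₂ = 9 / n₂ + 2 / n₂ := by ring
    linarith
  rw [div_le_div_iff₀ (by linarith) (by linarith)] at e5
  linarith

/-- For `n₂` large, the net number of `n₁` and `n₂` in a resonance with two more modes. -/
theorem disp_ne_of_pair {n₁ n₂ a b j k : ℤ} {ε : ℝ} (hn₁ : 20 ≤ n₁) (hn₂ : 200 * n₁ ≤ n₂)
    (hε : ∀ a' : ℤ, a' ≠ 0 → |a'| ≤ 4 → ∀ i : ℤ, a' * disp n₁ + disp i ≠ 0 → ε ≤ |a' * disp n₁ + disp i|)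
    (hεn : 10 < ε * n₂)
    (hab : |a| + |b| ≤ 4) (heven : (a + b) % 2 = 0) (hne : a ≠ 0 ∨ b ≠ 0)
    (hs : a * n₁ + b * n₂ + j + k = 0) (hj0 : j ≠ 0) (hk0 : k ≠ 0)
    (hj : j ≠ n₁ ∧ j ≠ -n₁ ∧ j ≠ n₂ ∧ j ≠ -n₂) (hk : k ≠ n₁ ∧ k ≠ -n₁ ∧ k ≠ n₂ ∧ k ≠ -n₂) :
    a * disp n₁ + b * disp n₂ + disp j + disp k ≠ 0 := by
  have pure : ∀ {n a : ℤ}, 20 ≤ n → |a| ≤ 4 → a ≠ 0 → a % 2 = 0 → a * n + j + k = 0 → j ≠ n →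
      j ≠ -n → a * disp n + disp j + disp k ≠ 0 := by
    intro n a hn ha ha0 ha2 hs hj1 hj2 h
    have ha' : a = 2 ∨ a = -2 ∨ a = 4 ∨ a = -4 := by
      have := abs_le.1 ha
      omega
    have hsq : a ^ 2 = 4 ∨ a ^ 2 = 16 := by
      rcases ha' with h | h | h | h <;> subst h <;> norm_num
    obtain ⟨h1, h2⟩ := eq_of_quadruple_resonance hn hsq hs h
    subst h2
    rcases ha' with h3 | h3 | h3 | h3 <;> subst h3 <;> omega
  by_cases hb : b = 0
  · subst hb
    have := pure (n := n₁) (a := a) hn₁ (by simpa using hab) (by simpa using hne) (by omega)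
      (by linarith) hj.1 hj.2.1
    simpa using this
  by_cases ha : a = 0
  · subst ha
    have := pure (n := n₂) (a := b) (by omega) (by simpa using hab) hb (by omega)
      (by linarith) hj.2.2.1 hj.2.2.2
    simpa using this
  have hn₁R : (20 : ℝ) ≤ n₁ := by exact_mod_cast hn₁
  have hn₂R : 200 * (n₁ : ℝ) ≤ n₂ := by exact_mod_cast hn₂
  have ha1 : (1 : ℝ) ≤ |(a : ℝ)| := by exact_mod_cast Int.one_le_abs ha
  have hb1 : (1 : ℝ) ≤ |(b : ℝ)| := by exact_mod_cast Int.one_le_abs hb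
  have habR : |(a : ℝ)| + |(b : ℝ)| ≤ 4 := by exact_mod_cast hab
  have hp1 : 0 < disp n₁ := disp_pos (by linarith)
  have hp2 : 0 < disp n₂ := disp_pos (by linarith)
  have main : ∀ {j k : ℤ}, a * n₁ + b * n₂ + j + k = 0 → |j| ≤ |k| → j ≠ 0 → k ≠ 0 →
      (j ≠ n₁ ∧ j ≠ -n₁) → (k ≠ n₂ ∧ k ≠ -n₂) →
      a * disp n₁ + b * disp n₂ + disp j + disp k ≠ 0 := by
    intro j k hs hjk hj0 hk0 hj hk h
    have inj : ∀ {i n : ℤ}, i ≠ 0 → 1 ≤ n → |disp i| = disp n → i = n ∨ i = -n := by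
      intro i n hi hn h
      rw [abs_disp] at h
      have h1 : (1 : ℝ) ≤ |(i : ℝ)| := by exact_mod_cast Int.one_le_abs hi
      have h2 : |(i : ℝ)| = n := disp_inj h1 (by exact_mod_cast hn) h
      have h3 : |i| = n := by exact_mod_cast h2
      exact eq_or_eq_neg_of_abs_eq h3
    have hjkR : |(j : ℝ)| ≤ |(k : ℝ)| := by exact_mod_cast hjk
    have hsR : (a : ℝ) * n₁ + b * n₂ + j + k = 0 := by exact_mod_cast hs
    have hbig : |(b : ℝ)| * n₂ ≤ |(a : ℝ)| * n₁ + |(j : ℝ)| + |(k : ℝ)| := by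
      have e : (b : ℝ) * n₂ = -(a * n₁ + j + k) := by linarith
      have e2 : |(b : ℝ) * n₂| ≤ |(a : ℝ) * n₁| + |(j : ℝ)| + |(k : ℝ)| := by
        rw [e, abs_neg]
        exact abs_add_three _ _ _
      rwa [abs_mul, abs_mul, abs_of_pos (by linarith : (0 : ℝ) < n₁),
        abs_of_pos (by linarith : (0 : ℝ) < n₂)] at e2
    have hkbig : (n₂ : ℝ) / 4 ≤ |(k : ℝ)| := by nlinarith
    have e1 : |disp k| ≤ 4 / n₂ := by
      rw [abs_disp]
      refine (disp_le_inv (by linarith)).trans ?_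
      rw [div_le_div_iff₀ (by linarith) (by linarith)]
      linarith
    have e2 : |(b : ℝ) * disp n₂| ≤ 4 / n₂ := by
      rw [abs_mul, abs_of_pos hp2]
      calc |(b : ℝ)| * disp n₂ ≤ 4 * (1 / n₂) :=
            mul_le_mul (by linarith) (disp_le_inv (by linarith)) hp2.le (by norm_num)
        _ = 4 / n₂ := by ring
    have h0 : (a : ℝ) * disp n₁ + disp j = 0 := by
      by_contra hne0
      have h1 := hε a ha (by have := abs_nonneg b; linarith) j hne0
      have h2 : |(a : ℝ) * disp n₁ + disp j| ≤ 4 / n₂ + 4 / n₂ := by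
        have : (a : ℝ) * disp n₁ + disp j = -(b * disp n₂ + disp k) := by linarith
        rw [this, abs_neg]
        exact (abs_add_le _ _).trans (add_le_add e2 e1)
      have h3 : ε ≤ 8 / n₂ := by
        have : (8 : ℝ) / n₂ = 4 / n₂ + 4 / n₂ := by ring
        linarith
      rw [le_div_iff₀ (by linarith)] at h3
      linarith
    have h0' : (b : ℝ) * disp n₂ + disp k = 0 := by linarith
    have hj' : |disp j| = |(a : ℝ)| * disp n₁ := by
      rw [show disp j = -(a * disp n₁) by linarith, abs_neg, abs_mul, abs_of_pos hp1]
    have hk' : |disp k| = |(b : ℝ)| * disp n₂ := by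
      rw [show disp k = -(b * disp n₂) by linarith, abs_neg, abs_mul, abs_of_pos hp2]
    have ha2 : 2 ≤ |a| := by
      by_contra hlt
      have : |a| = 1 := by have := Int.one_le_abs ha; omega
      have hR : |(a : ℝ)| = 1 := by exact_mod_cast this
      rw [hR, one_mul] at hj'
      rcases inj hj0 (by omega) hj' with h | h
      · exact hj.1 h
      · exact hj.2 h
    have hb2 : 2 ≤ |b| := by
      by_contra hlt
      have : |b| = 1 := by have := Int.one_le_abs hb; omega
      have hR : |(b : ℝ)| = 1 := by exact_mod_cast this
      rw [hR, one_mul] at hk'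
      rcases inj hk0 (by omega) hk' with h | h
      · exact hk.1 h
      · exact hk.2 h
    have ha2R : (2 : ℝ) ≤ |(a : ℝ)| := by exact_mod_cast ha2
    have hb2R : (2 : ℝ) ≤ |(b : ℝ)| := by exact_mod_cast hb2
    have hjpos : 0 < |(j : ℝ)| := by
      have : (1 : ℝ) ≤ |(j : ℝ)| := by exact_mod_cast Int.one_le_abs hj0
      linarith
    have hjle : |(j : ℝ)| ≤ n₁ := by
      have h1 : 2 * (1 / (2 * (n₁ : ℝ))) ≤ 1 / |(j : ℝ)| := by
        calc 2 * (1 / (2 * (n₁ : ℝ))) ≤ |(a : ℝ)| * disp n₁ :=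
              mul_le_mul ha2R (le_disp (by linarith)) (by positivity) (abs_nonneg _)
          _ = disp |(j : ℝ)| := by rw [← hj', abs_disp]
          _ ≤ _ := disp_le_inv hjpos
      have h2 : 2 * (1 / (2 * (n₁ : ℝ))) = 1 / n₁ := by field_simp
      rw [h2] at h1
      exact (one_div_le_one_div (by linarith) hjpos).1 h1
    have hkge : (n₂ : ℝ) ≤ |(k : ℝ)| := by nlinarith
    have hfin := disp_anti (x := n₂) (by linarith) hkge
    rw [← abs_disp, hk'] at hfin
    nlinarith
  rcases le_total |j| |k| with hjk | hjk
  · exact main hs hjk hj0 hk0 ⟨hj.1, hj.2.1⟩ ⟨hk.2.2.1, hk.2.2.2⟩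
  · have := main (j := k) (k := j) (by linarith) hjk hk0 hj0 ⟨hk.1, hk.2.1⟩ ⟨hj.2.2.1, hj.2.2.2⟩
    intro h
    exact this (by linarith)

/-! ### Normal tuples -/

/-- The number of components of `J` equal to `a`. -/
def cnt {m : ℕ} (J : Fin m → Zbar) (a : Zbar) : ℕ := (Finset.univ.filter fun i => J i = a).card

theorem neg_ne_self (j : Zbar) : -j ≠ j := fun h => by
  have h1 : -j.1 = j.1 := congrArg Subtype.val h
  have h2 := j.2
  omega

theorem cnt_neg_of_mem_normalSet {m : ℕ} (hm : m % 2 = 0) {J : Fin m → Zbar}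
    (hJ : J ∈ normalSet m) (a : Zbar) : cnt J (-a) = cnt J a := by
  obtain ⟨τ, hτ⟩ := hJ
  have key : ∀ i : Fin m, ∃ k : Fin m, J (τ k) = -J (τ i) ∧
      k.1 = if i.1 % 2 = 0 then i.1 + 1 else i.1 - 1 := by
    intro i
    by_cases hi : i.1 % 2 = 0
    · have h := hτ (i.1 / 2) (by have := i.2; omega)
      refine ⟨⟨i.1 + 1, by have := i.2; omega⟩, ?_, by simp [hi]⟩
      have e1 : (⟨2 * (i.1 / 2), by have := i.2; omega⟩ : Fin m) = i := Fin.ext (by simp; omega)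
      have e2 : (⟨2 * (i.1 / 2) + 1, by have := i.2; omega⟩ : Fin m)
          = ⟨i.1 + 1, by have := i.2; omega⟩ := Fin.ext (by simp; omega)
      rw [e1, e2] at h
      rw [h, neg_neg]
    · have h := hτ (i.1 / 2) (by have := i.2; omega)
      refine ⟨⟨i.1 - 1, by have := i.2; omega⟩, ?_, by simp [hi]⟩
      have e1 : (⟨2 * (i.1 / 2), by have := i.2; omega⟩ : Fin m)
          = ⟨i.1 - 1, by have := i.2; omega⟩ := Fin.ext (by simp; omega)
      have e2 : (⟨2 * (i.1 / 2) + 1, by have := i.2; omega⟩ : Fin m) = i :=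
        Fin.ext (by simp; omega)
      rw [e1, e2] at h
      exact h
  choose σ hσ hσv using key
  have hσσ : ∀ i, σ (σ i) = i := fun i => Fin.ext (by
    rw [hσv, hσv]
    split_ifs <;> omega)
  refine Finset.card_nbij' (fun i => τ (σ (τ.symm i))) (fun i => τ (σ (τ.symm i))) ?_ ?_ ?_ ?_
  · intro i hi
    simp only [Finset.coe_filter, Finset.mem_univ, true_and, Set.mem_ofPred_eq] at hi ⊢
    rw [hσ, Equiv.apply_symm_apply, hi, neg_neg]
  · intro i hi
    simp only [Finset.coe_filter, Finset.mem_univ, true_and, Set.mem_ofPred_eq] at hi ⊢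
    rw [hσ, Equiv.apply_symm_apply, hi]
  · intro i _
    simp [hσσ]
  · intro i _
    simp [hσσ]

theorem mem_normalSet_of_cnt {m : ℕ} {J : Fin m → Zbar} (h : ∀ a, cnt J (-a) = cnt J a) :
    J ∈ normalSet m := by
  have fib : ∀ c : Zbar, Nonempty ({i : {i // 0 < (J i).1} // J i.1 = c} ≃
      {i : {i // ¬0 < (J i).1} // -J i.1 = c}) := by
    intro c
    by_cases hc : 0 < c.1
    · refine ⟨Fintype.equivOfCardEq ?_⟩
      have e1 : {i : {i // 0 < (J i).1} // J i.1 = c} ≃ {i // J i = c} :=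
        Equiv.subtypeSubtypeEquivSubtype (q := fun i => J i = c)
          (fun {i} hi => by rw [hi]; exact hc)
      have e2 : {i : {i // ¬0 < (J i).1} // -J i.1 = c} ≃ {i // J i = -c} :=
        (Equiv.subtypeSubtypeEquivSubtype (q := fun i => -J i = c) (fun {i} hi => by
          have : -(J i).1 = c.1 := congrArg Subtype.val hi
          omega)).trans (Equiv.subtypeEquivRight fun i => neg_eq_iff_eq_neg)
      rw [Fintype.card_congr e1, Fintype.card_congr e2, Fintype.card_subtype,
        Fintype.card_subtype]
      exact (h c).symm
    · have : IsEmpty {i : {i // 0 < (J i).1} // J i.1 = c} :=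
        ⟨fun i => hc (by have h1 := i.1.2; rwa [i.2] at h1)⟩
      have : IsEmpty {i : {i // ¬0 < (J i).1} // -J i.1 = c} :=
        ⟨fun i => hc (by
          have h1 := i.1.2
          have h2 : -(J i.1.1).1 = c.1 := congrArg Subtype.val i.2
          have h3 := (J i.1.1).2
          omega)⟩
      exact ⟨Equiv.equivOfIsEmpty _ _⟩
  have e0 : {e : {i // 0 < (J i).1} ≃ {i // ¬0 < (J i).1} // ∀ i, -J (e i).1 = J i.1} :=
    ⟨Equiv.ofFiberEquiv (f := fun i : {i // 0 < (J i).1} => J i.1)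
      (g := fun i : {i // ¬0 < (J i).1} => -J i.1) fun c => (fib c).some,
      fun i => Equiv.ofFiberEquiv_map (g := fun i : {i // ¬0 < (J i).1} => -J i.1) _ i⟩
  obtain ⟨k, ⟨e1⟩⟩ : ∃ k, Nonempty ({i // 0 < (J i).1} ≃ Fin k) := ⟨_, ⟨Fintype.equivFin _⟩⟩
  let E : Fin k × Fin 2 ≃ Fin m :=
    ((Equiv.prodComm _ _).trans (((finTwoEquiv.prodCongr e1.symm).trans
      (Equiv.boolProdEquivSum _)).trans ((Equiv.refl _).sumCongr e0.1))).trans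
      (Equiv.sumCompl fun i => 0 < (J i).1)
  have hE : ∀ i, J (E (i, 0)) = -J (E (i, 1)) := fun i => (e0.2 (e1.symm i)).symm
  have hm : k * 2 = m := by simpa using Fintype.card_congr E
  subst hm
  refine ⟨finProdFinEquiv.symm.trans E, fun i hi => ?_⟩
  have h0 : finProdFinEquiv.symm (⟨2 * i, by omega⟩ : Fin (k * 2)) = (⟨i, by omega⟩, 0) := by
    rw [Equiv.symm_apply_eq]
    exact Fin.ext (by simp)
  have h1 : finProdFinEquiv.symm (⟨2 * i + 1, hi⟩ : Fin (k * 2)) = (⟨i, by omega⟩, 1) := by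
    rw [Equiv.symm_apply_eq]
    exact Fin.ext (by simp; omega)
  simp only [Equiv.trans_apply, h0, h1, hE]

/-! ### Tuples with few components outside the tangential sites -/

theorem neg_mem_sites {n₁ n₂ : ℕ+} {j : Zbar} (h : j ∈ sites n₁ n₂) : -j ∈ sites n₁ n₂ := by
  rcases h with rfl | rfl | rfl | rfl <;> simp [sites]

theorem neg_mem_sites_iff {n₁ n₂ : ℕ+} {j : Zbar} : -j ∈ sites n₁ n₂ ↔ j ∈ sites n₁ n₂ :=
  ⟨fun h => by simpa using neg_mem_sites h, neg_mem_sites⟩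

open Classical in
/-- The positions at which the tuple `J` is outside the tangential sites. -/
def outs (n₁ n₂ : ℕ+) {m : ℕ} (J : Fin m → Zbar) : Finset (Fin m) :=
  Finset.univ.filter fun i => J i ∉ sites n₁ n₂

theorem mem_outs {n₁ n₂ : ℕ+} {m : ℕ} {J : Fin m → Zbar} {i : Fin m} :
    i ∈ outs n₁ n₂ J ↔ J i ∉ sites n₁ n₂ := by
  simp [outs]

theorem numOutside_eq (n₁ n₂ : ℕ+) {m : ℕ} (J : Fin m → Zbar) :
    numOutside n₁ n₂ J = (outs n₁ n₂ J).card := by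
  rw [numOutside, ← Set.ncard_coe_finset]
  congr 1
  ext i
  simp [mem_outs]

theorem pos_injective : Function.Injective pos := fun a b h => by
  have h1 : ((a : ℕ) : ℤ) = (b : ℕ) := congrArg Subtype.val h
  exact PNat.coe_injective (by exact_mod_cast h1)

theorem pos_ne_neg_pos (a b : ℕ+) : pos a ≠ -pos b := fun h => by
  have h1 : ((a : ℕ) : ℤ) = -(b : ℕ) := congrArg Subtype.val h
  have := a.pos
  have := b.pos
  omega

@[to_additive]
theorem prod_eq_prod_outs {n₁ n₂ : ℕ+} (hne : n₁ ≠ n₂) {m : ℕ} (J : Fin m → Zbar) {M : Type*}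
    [CommMonoid M] (φ : Zbar → M) :
    ∏ i, φ (J i) = (∏ i ∈ outs n₁ n₂ J, φ (J i)) *
      (φ (pos n₁) ^ cnt J (pos n₁) * (φ (-pos n₁) ^ cnt J (-pos n₁) *
      (φ (pos n₂) ^ cnt J (pos n₂) * φ (-pos n₂) ^ cnt J (-pos n₂)))) := by
  classical
  have h12 : pos n₁ ≠ pos n₂ := fun h => hne (pos_injective h)
  have h12' : -pos n₁ ≠ -pos n₂ := fun h => h12 (neg_injective h)
  rw [← Finset.prod_filter_mul_prod_filter_not Finset.univ fun i => J i ∉ sites n₁ n₂]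
  congr 1
  rw [← Finset.prod_fiberwise_of_maps_to
    (t := ({pos n₁, -pos n₁, pos n₂, -pos n₂} : Finset Zbar)) (g := J)
    (fun i hi => by
      simp only [sites, Finset.mem_filter, Finset.mem_univ, true_and, not_not] at hi
      simpa using hi)]
  have key : ∀ a ∈ sites n₁ n₂, ∏ i ∈ (Finset.univ.filter fun i => ¬J i ∉ sites n₁ n₂).filter
      (fun i => J i = a), φ (J i) = φ a ^ cnt J a := by
    intro a ha
    rw [cnt, Finset.filter_filter, ← Finset.prod_const]
    refine Finset.prod_congr ?_ fun i hi => by rw [(Finset.mem_filter.1 hi).2]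
    ext i
    simp only [Finset.mem_filter, Finset.mem_univ, true_and, not_not, and_iff_right_iff_imp]
    rintro rfl
    exact ha
  rw [Finset.prod_insert, Finset.prod_insert, Finset.prod_insert, Finset.prod_singleton,
    key _ (by simp [sites]), key _ (by simp [sites]), key _ (by simp [sites]),
    key _ (by simp [sites])]
  · simp [pos_ne_neg_pos]
  · simp [(pos_ne_neg_pos _ _).symm, h12']
  · simp [pos_ne_neg_pos, h12]

theorem card_outs_add {n₁ n₂ : ℕ+} (hne : n₁ ≠ n₂) {m : ℕ} (J : Fin m → Zbar) :
    (outs n₁ n₂ J).card + (cnt J (pos n₁) + (cnt J (-pos n₁) +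
      (cnt J (pos n₂) + cnt J (-pos n₂)))) = m := by
  have h := sum_eq_sum_outs hne J (fun _ => 1)
  simp only [Finset.sum_const, smul_eq_mul, mul_one, Finset.card_univ, Fintype.card_fin] at h
  exact h.symm

theorem sum_odd_eq {n₁ n₂ : ℕ+} (hne : n₁ ≠ n₂) {m : ℕ} (J : Fin m → Zbar) {M : Type*}
    [AddCommGroup M] (φ : Zbar → M) (hφ : ∀ j, φ (-j) = -φ j) :
    ∑ i, φ (J i) = ((cnt J (pos n₁) : ℤ) - cnt J (-pos n₁)) • φ (pos n₁) +
      ((cnt J (pos n₂) : ℤ) - cnt J (-pos n₂)) • φ (pos n₂) + ∑ i ∈ outs n₁ n₂ J, φ (J i) := by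
  rw [sum_eq_sum_outs hne J φ, hφ, hφ]
  simp only [smul_neg, sub_smul, natCast_zsmul]
  abel

theorem mem_normalSet_of_outs {n₁ n₂ : ℕ+} {m : ℕ} {J : Fin m → Zbar}
    (h₁ : cnt J (pos n₁) = cnt J (-pos n₁)) (h₂ : cnt J (pos n₂) = cnt J (-pos n₂))
    (ho : ∀ a ∉ sites n₁ n₂, cnt J (-a) = cnt J a) : J ∈ normalSet m := by
  refine mem_normalSet_of_cnt fun a => ?_
  by_cases ha : a ∈ sites n₁ n₂
  · rcases ha with rfl | rfl | rfl | rfl <;> simp [h₁, h₂]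
  · exact ho a ha

theorem cnt_eq_card_outs {n₁ n₂ : ℕ+} {m : ℕ} (J : Fin m → Zbar) {a : Zbar}
    (ha : a ∉ sites n₁ n₂) : cnt J a = ((outs n₁ n₂ J).filter fun i => J i = a).card := by
  rw [cnt]
  congr 1
  ext i
  simp only [Finset.mem_filter, Finset.mem_univ, true_and, mem_outs, iff_and_self]
  rintro rfl
  exact ha

theorem outs_eq_empty_of_mem_normalSet {n₁ n₂ : ℕ+} {m : ℕ} (hm : m % 2 = 0) {J : Fin m → Zbar}
    (hJ : J ∈ normalSet m) (h : (outs n₁ n₂ J).card ≤ 1) : outs n₁ n₂ J = ∅ := by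
  by_contra hne
  obtain ⟨i, hi⟩ := Finset.nonempty_iff_ne_empty.2 hne
  have h1 : 0 < cnt J (J i) := Finset.card_pos.2 ⟨i, by simp⟩
  rw [← cnt_neg_of_mem_normalSet hm hJ] at h1
  obtain ⟨k, hk⟩ := Finset.card_pos.1 h1
  have hk' : J k = -J i := by simpa using hk
  have hko : k ∈ outs n₁ n₂ J := by
    rw [mem_outs, hk', neg_mem_sites_iff]
    exact mem_outs.1 hi
  have := Finset.card_le_one.1 h _ hi _ hko
  rw [← this] at hk'
  exact neg_ne_self _ hk'.symm

/-! ### Uniform lower bounds for the divisors -/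

theorem eq_zero_of_mul_add_mul_eq_zero {n₁ n₂ a b : ℤ} (hn₁ : 1 ≤ n₁) (hn₂ : 200 * n₁ ≤ n₂)
    (ha : |a| ≤ 10) (h : a * n₁ + b * n₂ = 0) : a = 0 ∧ b = 0 := by
  have hb : b = 0 := by
    by_contra hb
    have h1 := Int.one_le_abs hb
    have h2 : |b| * n₂ = |a| * n₁ := by
      rw [← abs_of_nonneg (by omega : 0 ≤ n₂), ← abs_of_nonneg (by omega : 0 ≤ n₁), ← abs_mul,
        ← abs_mul, show b * n₂ = -(a * n₁) by linarith, abs_neg]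
    nlinarith
  subst hb
  refine ⟨?_, rfl⟩
  rcases mul_eq_zero.1 (by linarith : a * n₁ = 0) with h | h
  · exact h
  · omega

theorem mul_disp_add_mul_disp_ne_zero {n₁ n₂ a b : ℤ} (hn₁ : 1 ≤ n₁) (hn₂ : 200 * n₁ ≤ n₂)
    (hb : |b| ≤ 10) (h : a ≠ 0 ∨ b ≠ 0) : (a : ℝ) * disp n₁ + b * disp n₂ ≠ 0 := by
  intro h0
  have h1R : (1 : ℝ) ≤ n₁ := by exact_mod_cast hn₁
  have h2R : 200 * (n₁ : ℝ) ≤ n₂ := by exact_mod_cast hn₂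
  have hp1 : 0 < disp n₁ := disp_pos (by linarith)
  have hp2 : 0 < disp n₂ := disp_pos (by linarith)
  by_cases ha : a = 0
  · subst ha
    rcases h with h | h
    · exact h rfl
    · have : (b : ℝ) * disp n₂ = 0 := by simpa using h0
      rcases mul_eq_zero.1 this with h3 | h3
      · exact h (by exact_mod_cast h3)
      · exact hp2.ne' h3
  have ha1 : (1 : ℝ) ≤ |(a : ℝ)| := by exact_mod_cast Int.one_le_abs ha
  have hbR : |(b : ℝ)| ≤ 10 := by exact_mod_cast hb
  have e : |(a : ℝ)| * disp n₁ = |(b : ℝ)| * disp n₂ := by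
    rw [← abs_of_pos hp1, ← abs_of_pos hp2, ← abs_mul, ← abs_mul,
      show (a : ℝ) * disp n₁ = -(b * disp n₂) by linarith, abs_neg]
  have l1 : 1 / (2 * (n₁ : ℝ)) ≤ |(a : ℝ)| * disp n₁ := by
    have := le_disp h1R
    nlinarith
  have l2 : |(b : ℝ)| * disp n₂ ≤ 10 * (1 / n₂) :=
    mul_le_mul hbR (disp_le_inv (by linarith)) hp2.le (by norm_num)
  have l3 : 10 * (1 / (n₂ : ℝ)) < 1 / (2 * (n₁ : ℝ)) := by
    rw [mul_one_div, div_lt_div_iff₀ (by linarith) (by linarith)]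
    linarith
  linarith

theorem exists_pos_le_single (n₁ n₂ : ℤ) : ∃ ε > 0, ∀ a b : ℤ, |a| ≤ 10 → |b| ≤ 10 →
    ∀ j : ℤ, a * n₁ + b * n₂ + j = 0 → a * disp n₁ + b * disp n₂ + disp j ≠ 0 →
    ε ≤ |a * disp n₁ + b * disp n₂ + disp j| := by
  obtain ⟨ε, hε, h⟩ := exists_pos_le_of_finset
    (Finset.Icc (-10 : ℤ) 10 ×ˢ Finset.Icc (-10 : ℤ) 10)
    (fun x (j : ℤ) => x.1 * n₁ + x.2 * n₂ + j = 0 ∧ x.1 * disp n₁ + x.2 * disp n₂ + disp j ≠ 0)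
    (fun x (j : ℤ) => |x.1 * disp n₁ + x.2 * disp n₂ + disp j|) (by
      intro x _
      by_cases h0 : x.1 * disp n₁ + x.2 * disp n₂ + disp ((-(x.1 * n₁ + x.2 * n₂) : ℤ) : ℝ) = 0
      · refine ⟨1, one_pos, fun j hj => absurd ?_ hj.2⟩
        rwa [show j = -(x.1 * n₁ + x.2 * n₂) by linarith [hj.1]]
      · refine ⟨_, abs_pos.2 h0, fun j hj => ?_⟩
        rw [show j = -(x.1 * n₁ + x.2 * n₂) by linarith [hj.1]])
  refine ⟨ε, hε, fun a b ha hb j hj hne => h (a, b) ?_ j ⟨hj, hne⟩⟩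
  simpa using ⟨abs_le.1 ha, abs_le.1 hb⟩

theorem exists_pos_le_pair {n₁ n₂ : ℤ} (hn₁ : 1 ≤ n₁) (hn₂ : 200 * n₁ ≤ n₂) :
    ∃ ε > 0, ∀ a b : ℤ, |a| ≤ 10 → |b| ≤ 10 → (a ≠ 0 ∨ b ≠ 0) →
    ∀ j k : ℤ, a * n₁ + b * n₂ + j + k = 0 → a * disp n₁ + b * disp n₂ + disp j + disp k ≠ 0 →
    ε ≤ |a * disp n₁ + b * disp n₂ + disp j + disp k| := by
  obtain ⟨ε, hε, h⟩ := exists_pos_le_of_finset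
    (((Finset.Icc (-10 : ℤ) 10 ×ˢ Finset.Icc (-10 : ℤ) 10)).filter fun x => x.1 ≠ 0 ∨ x.2 ≠ 0)
    (fun x (y : ℤ × ℤ) => x.1 * n₁ + x.2 * n₂ + y.1 + y.2 = 0 ∧
      x.1 * disp n₁ + x.2 * disp n₂ + disp y.1 + disp y.2 ≠ 0)
    (fun x (y : ℤ × ℤ) => |x.1 * disp n₁ + x.2 * disp n₂ + disp y.1 + disp y.2|) (by
      intro x hx
      simp only [Finset.mem_filter, Finset.mem_product, Finset.mem_Icc] at hx
      have hl := mul_disp_add_mul_disp_ne_zero hn₁ hn₂ (abs_le.2 hx.1.2) hx.2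
      have hinj : Function.Injective fun j : ℤ => -(x.1 * n₁ + x.2 * n₂) - j :=
        sub_right_injective
      have ht : Filter.Tendsto (fun j : ℤ => x.1 * disp n₁ + x.2 * disp n₂ + disp j +
          disp ((-(x.1 * n₁ + x.2 * n₂) - j : ℤ) : ℝ)) Filter.cofinite
          (𝓝 (x.1 * disp n₁ + x.2 * disp n₂)) := by
        have := (tendsto_disp.const_add (x.1 * disp n₁ + x.2 * disp n₂)).add
          (tendsto_disp.comp hinj.tendsto_cofinite)
        simpa using this
      obtain ⟨ε, hε, h⟩ := exists_pos_le_of_tendsto hl ht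
      refine ⟨ε, hε, fun y hy => ?_⟩
      have e : y.2 = -(x.1 * n₁ + x.2 * n₂) - y.1 := by linarith [hy.1]
      have h2 := hy.2
      rw [e] at h2 ⊢
      exact h _ h2)
  refine ⟨ε, hε, fun a b ha hb hab j k hj hne => h (a, b) ?_ (j, k) ⟨hj, hne⟩⟩
  simpa using ⟨⟨abs_le.1 ha, abs_le.1 hb⟩, by tauto⟩

theorem notMem_sites_iff {n₁ n₂ : ℕ+} {j : Zbar} : j ∉ sites n₁ n₂ ↔
    j.1 ≠ (n₁ : ℤ) ∧ j.1 ≠ -(n₁ : ℤ) ∧ j.1 ≠ (n₂ : ℤ) ∧ j.1 ≠ -(n₂ : ℤ) := by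
  have h : ∀ k : Zbar, j = k ↔ j.1 = k.1 := fun k => Subtype.ext_iff
  simp only [sites, Set.mem_insert_iff, Set.mem_singleton_iff, h, not_or]
  rfl

section

variable {n₁ n₂ : ℕ+} {m : ℕ} {J : Fin m → Zbar}

theorem sum_val_eq (hne : n₁ ≠ n₂) (J : Fin m → Zbar) :
    ∑ i, (J i).1 = ((cnt J (pos n₁) : ℤ) - cnt J (-pos n₁)) * (n₁ : ℤ) +
      ((cnt J (pos n₂) : ℤ) - cnt J (-pos n₂)) * (n₂ : ℤ) + ∑ i ∈ outs n₁ n₂ J, (J i).1 :=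
  sum_odd_eq hne J (fun j => j.1) fun _ => rfl

theorem sum_freq_eq (hne : n₁ ≠ n₂) (J : Fin m → Zbar) :
    ∑ i, freq (J i) = (((cnt J (pos n₁) : ℤ) - cnt J (-pos n₁) : ℤ) : ℝ) * disp ((n₁ : ℤ) : ℝ) +
      (((cnt J (pos n₂) : ℤ) - cnt J (-pos n₂) : ℤ) : ℝ) * disp ((n₂ : ℤ) : ℝ) +
      ∑ i ∈ outs n₁ n₂ J, disp (J i).1 := by
  have h := sum_odd_eq hne J freq freq_neg
  simp only [zsmul_eq_mul] at h
  exact h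

theorem mem_normalSet_of_outs_eq_empty (hn : 200 * (n₁ : ℤ) ≤ n₂) (hm : m ≤ 10)
    (hs : ∑ i, (J i).1 = 0) (ho : outs n₁ n₂ J = ∅) : J ∈ normalSet m := by
  have hn₁ : (1 : ℤ) ≤ n₁ := by exact_mod_cast n₁.pos
  have hne : n₁ ≠ n₂ := by rintro rfl; omega
  have hc := card_outs_add hne J
  have h := sum_val_eq hne J
  rw [hs, ho, Finset.sum_empty, add_zero] at h
  obtain ⟨h1, h2⟩ := eq_zero_of_mul_add_mul_eq_zero hn₁ hn (abs_le.2 (by omega)) h.symm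
  refine mem_normalSet_of_outs (n₁ := n₁) (n₂ := n₂) (by omega) (by omega) fun a ha => ?_
  rw [cnt_eq_card_outs J ha, cnt_eq_card_outs J (neg_mem_sites_iff.not.2 ha), ho]
  rfl

theorem exists_pos_le_sum_freq_single (hn : 200 * (n₁ : ℤ) ≤ n₂) :
    ∃ ε > 0, ∀ (m : ℕ) (J : Fin m → Zbar), m ≤ 10 → m % 2 = 0 → ∑ i, (J i).1 = 0 →
      (outs n₁ n₂ J).card = 1 → ε ≤ |∑ i, freq (J i)| := by
  obtain ⟨ε, hε, h⟩ := exists_pos_le_single n₁ n₂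
  refine ⟨ε, hε, fun m J hm hm2 hs ho => ?_⟩
  have hn₁ : (1 : ℤ) ≤ n₁ := by exact_mod_cast n₁.pos
  have hne : n₁ ≠ n₂ := by rintro rfl; omega
  have hc := card_outs_add hne J
  obtain ⟨i, hi⟩ := Finset.card_eq_one.1 ho
  have hio : i ∈ outs n₁ n₂ J := by simp [hi]
  have hsum := sum_val_eq hne J
  rw [hs, hi, Finset.sum_singleton] at hsum
  rw [sum_freq_eq hne, hi, Finset.sum_singleton]
  refine h _ _ (abs_le.2 (by omega)) (abs_le.2 (by omega)) _ hsum.symm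
    (disp_ne_of_single hn₁ hn ?_ (by omega) hsum.symm (notMem_sites_iff.1 (mem_outs.1 hio)))
  rcases abs_cases ((cnt J (pos n₁) : ℤ) - cnt J (-pos n₁)) with h1 | h1 <;>
    rcases abs_cases ((cnt J (pos n₂) : ℤ) - cnt J (-pos n₂)) with h2 | h2 <;> omega

theorem exists_pos_le_sum_freq_pair {ε : ℝ} (hn₁ : 20 ≤ (n₁ : ℤ)) (hn : 200 * (n₁ : ℤ) ≤ n₂)
    (hε : ∀ a : ℤ, a ≠ 0 → |a| ≤ 4 → ∀ i : ℤ, a * disp ((n₁ : ℤ) : ℝ) + disp i ≠ 0 →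
      ε ≤ |a * disp ((n₁ : ℤ) : ℝ) + disp i|)
    (hεn : 10 < ε * ((n₂ : ℤ) : ℝ)) :
    ∃ ε > 0, ∀ J : Fin 6 → Zbar, ∑ i, (J i).1 = 0 → (outs n₁ n₂ J).card = 2 →
      J ∉ normalSet 6 → ε ≤ |∑ i, freq (J i)| := by
  obtain ⟨ε', hε', h⟩ := exists_pos_le_pair (n₁ := n₁) (n₂ := n₂) (by omega) hn
  refine ⟨ε', hε', fun J hs ho hJ => ?_⟩
  have hne : n₁ ≠ n₂ := by rintro rfl; omega
  have hc := card_outs_add hne J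
  obtain ⟨i, k, hik, ho'⟩ := Finset.card_eq_two.1 ho
  have hio : i ∈ outs n₁ n₂ J := by simp [ho']
  have hko : k ∈ outs n₁ n₂ J := by simp [ho']
  have hsum := sum_val_eq hne J
  rw [hs, ho', Finset.sum_pair hik, ← add_assoc] at hsum
  rw [sum_freq_eq hne, ho', Finset.sum_pair hik, ← add_assoc]
  have hab : ((cnt J (pos n₁) : ℤ) - cnt J (-pos n₁)) ≠ 0 ∨
      ((cnt J (pos n₂) : ℤ) - cnt J (-pos n₂)) ≠ 0 := by
    by_contra! hab
    refine hJ (mem_normalSet_of_outs (n₁ := n₁) (n₂ := n₂) (by omega) (by omega) fun a ha => ?_)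
    have hki : J k = -J i := zbar_ext (by
      rw [hab.1, hab.2] at hsum
      have : (-J i).1 = -(J i).1 := rfl
      omega)
    rw [cnt_eq_card_outs J ha, cnt_eq_card_outs J (neg_mem_sites_iff.not.2 ha), ho']
    have e : ∀ a, ((({i, k} : Finset (Fin 6)).filter fun l => J l = a)).card =
        (if J i = a then 1 else 0) + if J k = a then 1 else 0 := by
      intro a
      rw [Finset.card_filter, Finset.sum_pair hik]
    rw [e, e, hki, add_comm]
    simp only [neg_eq_iff_eq_neg, neg_neg]
  refine h _ _ (abs_le.2 (by omega)) (abs_le.2 (by omega)) hab _ _ hsum.symm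
    (disp_ne_of_pair hn₁ hn hε hεn ?_ (by omega) hab hsum.symm (J i).2 (J k).2
      (notMem_sites_iff.1 (mem_outs.1 hio)) (notMem_sites_iff.1 (mem_outs.1 hko)))
  rcases abs_cases ((cnt J (pos n₁) : ℤ) - cnt J (-pos n₁)) with h1 | h1 <;>
    rcases abs_cases ((cnt J (pos n₂) : ℤ) - cnt J (-pos n₂)) with h2 | h2 <;> omega

end

/-- The sites `n₁`, `n₂` admit no small divisors. -/
structure Nonresonant (n₁ n₂ : ℕ+) : Prop where
  ne : n₁ ≠ n₂
  six : ∃ ε > 0, ∀ J : Fin 6 → Zbar, ∑ i, (J i).1 = 0 → J ∈ atMost n₁ n₂ 6 2 \ normalSet 6 →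
    ε ≤ |∑ i, freq (J i)|
  ten : ∃ ε > 0, ∀ J : Fin 10 → Zbar, ∑ i, (J i).1 = 0 → J ∈ atMost n₁ n₂ 10 1 \ normalSet 10 →
    ε ≤ |∑ i, freq (J i)|

theorem exists_nonresonant : ∃ N₁ : ℕ+, ∀ n₁ : ℕ+, N₁ ≤ n₁ → ∃ N₂ : ℕ+, ∀ n₂ : ℕ+, N₂ ≤ n₂ →
    Nonresonant n₁ n₂ := by
  refine ⟨20, fun n₁ hn₁ => ?_⟩
  have hn₁' : (20 : ℤ) ≤ n₁ := by exact_mod_cast (PNat.coe_le_coe _ _).2 hn₁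
  have hd : 0 < disp ((n₁ : ℤ) : ℝ) := disp_pos (by
    have : (20 : ℝ) ≤ ((n₁ : ℤ) : ℝ) := by exact_mod_cast hn₁'
    linarith)
  obtain ⟨ε, hε, h⟩ := exists_pos_le_of_finset ((Finset.Icc (-4 : ℤ) 4).filter fun a => a ≠ 0)
    (fun a (i : ℤ) => a * disp ((n₁ : ℤ) : ℝ) + disp i ≠ 0)
    (fun a (i : ℤ) => |a * disp ((n₁ : ℤ) : ℝ) + disp i|) (by
      intro a ha
      refine exists_pos_le_of_tendsto (l := a * disp ((n₁ : ℤ) : ℝ)) ?_ ?_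
      · exact mul_ne_zero (by exact_mod_cast (Finset.mem_filter.1 ha).2) hd.ne'
      · simpa using tendsto_disp.const_add (a * disp ((n₁ : ℤ) : ℝ)))
  obtain ⟨N, hN⟩ := exists_nat_gt (10 / ε)
  refine ⟨⟨200 * n₁ + N, by positivity⟩, fun n₂ hn₂ => ?_⟩
  have hn₂' : 200 * (n₁ : ℤ) + N ≤ n₂ := by exact_mod_cast (PNat.coe_le_coe _ _).2 hn₂
  have hn : 200 * (n₁ : ℤ) ≤ n₂ := by omega
  have hεn : 10 < ε * ((n₂ : ℤ) : ℝ) := by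
    have h1 : (N : ℝ) ≤ ((n₂ : ℤ) : ℝ) := by
      have : (N : ℤ) ≤ n₂ := by omega
      exact_mod_cast this
    rw [div_lt_iff₀ hε] at hN
    nlinarith
  obtain ⟨ε₁, hε₁, h₁⟩ := exists_pos_le_sum_freq_single hn
  obtain ⟨ε₂, hε₂, h₂⟩ := exists_pos_le_sum_freq_pair hn₁' hn (fun a ha ha4 i => h a (by
    simpa [ha] using abs_le.1 ha4) i) hεn
  refine ⟨by rintro rfl; omega, ⟨min ε₁ ε₂, lt_min hε₁ hε₂, fun J hs hJ => ?_⟩,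
    ⟨ε₁, hε₁, fun J hs hJ => ?_⟩⟩
  · obtain ⟨hJ1, hJ2⟩ := hJ
    change numOutside n₁ n₂ J ≤ 2 at hJ1
    rw [numOutside_eq] at hJ1
    have h0 : (outs n₁ n₂ J).card ≠ 0 := fun h0 =>
      hJ2 (mem_normalSet_of_outs_eq_empty hn (by norm_num) hs (Finset.card_eq_zero.1 h0))
    rcases (by omega : (outs n₁ n₂ J).card = 1 ∨ (outs n₁ n₂ J).card = 2) with h3 | h3
    · exact (min_le_left _ _).trans (h₁ 6 J (by norm_num) (by norm_num) hs h3)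
    · exact (min_le_right _ _).trans (h₂ J hs h3 hJ2)
  · obtain ⟨hJ1, hJ2⟩ := hJ
    change numOutside n₁ n₂ J ≤ 1 at hJ1
    rw [numOutside_eq] at hJ1
    have h0 : (outs n₁ n₂ J).card ≠ 0 := fun h0 =>
      hJ2 (mem_normalSet_of_outs_eq_empty hn (by norm_num) hs (Finset.card_eq_zero.1 h0))
    exact h₁ 10 J (by norm_num) (by norm_num) hs (by omega)

/-! ### Linearity in the coefficients -/

theorem poly_add {p : ℝ} (hp : 0 < p) {m : ℕ} {c d : (Fin m → Zbar) → ℂ} (hc : Good c)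
    (hd : Good d) (z : SeqSpace p) : poly (fun J => c J + d J) z = poly c z + poly d z := by
  rw [poly, poly, poly,
    ← (summable_form hp hc fun _ => z).tsum_add (summable_form hp hd fun _ => z)]
  exact tsum_congr fun J => add_mul _ _ _

theorem poly_const_mul {p : ℝ} {m : ℕ} (a : ℂ) (c : (Fin m → Zbar) → ℂ) (z : SeqSpace p) :
    poly (fun J => a * c J) z = a * poly c z := by
  rw [poly, poly, ← tsum_mul_left]
  exact tsum_congr fun J => mul_assoc _ _ _

/-! ### Reality of coefficients -/

theorem RealCoeff.add {m : ℕ} {c d : (Fin m → Zbar) → ℂ} (hc : RealCoeff c) (hd : RealCoeff d) :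
    RealCoeff fun J => c J + d J := fun J => by
  rw [map_add, ← hc, ← hd]

theorem RealCoeff.half {m : ℕ} {c : (Fin m → Zbar) → ℂ} (hc : RealCoeff c) :
    RealCoeff fun J => 1 / 2 * c J := fun J => by
  rw [map_mul, ← hc, show (1 / 2 : ℂ) = ((1 / 2 : ℝ) : ℂ) by norm_num, Complex.conj_ofReal]

theorem RealCoeff.indicator {m : ℕ} {c : (Fin m → Zbar) → ℂ} (hc : RealCoeff c)
    {s : Set (Fin m → Zbar)} (hs : ∀ J ∈ s, (fun i => -J i) ∈ s) : RealCoeff (s.indicator c) := by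
  intro J
  by_cases h : J ∈ s
  · rw [Set.indicator_of_mem h, Set.indicator_of_mem (hs J h), hc]
  · rw [Set.indicator_of_notMem h, Set.indicator_of_notMem, map_zero]
    intro h'
    exact h (by simpa using hs _ h')

theorem numOutside_neg (n₁ n₂ : ℕ+) {m : ℕ} (J : Fin m → Zbar) :
    numOutside n₁ n₂ (fun i => -J i) = numOutside n₁ n₂ J := by
  simp only [numOutside, neg_mem_sites_iff]

theorem neg_mem_normalSet {m : ℕ} {J : Fin m → Zbar} (h : J ∈ normalSet m) :
    (fun i => -J i) ∈ normalSet m := by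
  obtain ⟨τ, hτ⟩ := h
  exact ⟨τ, fun i hi => congrArg Neg.neg (hτ i hi)⟩

theorem neg_mem_normalSet_iff {m : ℕ} {J : Fin m → Zbar} :
    (fun i => -J i) ∈ normalSet m ↔ J ∈ normalSet m :=
  ⟨fun h => by simpa using neg_mem_normalSet h, neg_mem_normalSet⟩

theorem neg_mem_atMost (n₁ n₂ : ℕ+) {m k : ℕ} {J : Fin m → Zbar} (h : J ∈ atMost n₁ n₂ m k) :
    (fun i => -J i) ∈ atMost n₁ n₂ m k := by
  change numOutside n₁ n₂ _ ≤ k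
  rw [numOutside_neg]
  exact h

theorem neg_mem_atLeast (n₁ n₂ : ℕ+) {m k : ℕ} {J : Fin m → Zbar} (h : J ∈ atLeast n₁ n₂ m k) :
    (fun i => -J i) ∈ atLeast n₁ n₂ m k := by
  change k ≤ numOutside n₁ n₂ _
  rw [numOutside_neg]
  exact h

/-! ### The homological equation -/

/-- The coefficients `-i g_J / (λ_{j_1} + ⋯ + λ_{j_m})`. -/
def homSol {m : ℕ} (g : (Fin m → Zbar) → ℂ) (J : Fin m → Zbar) : ℂ :=
  -Complex.I * (g J / ((∑ i, freq (J i) : ℝ) : ℂ))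

section

variable {m : ℕ} {g : (Fin m → Zbar) → ℂ}

theorem Good.homSol (hg : Good g)
    (h : ∃ ε > 0, ∀ J, g J ≠ 0 → ε ≤ |∑ i, freq (J i)|) : Good (homSol g) := by
  obtain ⟨ε, hε, h⟩ := h
  refine hg.of_le (K := ε⁻¹) fun J => ?_
  by_cases h0 : g J = 0
  · simp [GBBM.homSol, h0]
  · rw [GBBM.homSol, norm_mul, norm_neg, Complex.norm_I, one_mul, norm_div, Complex.norm_real,
      Real.norm_eq_abs, div_eq_inv_mul]
    exact mul_le_mul_of_nonneg_right (inv_anti₀ hε (h J h0)) (norm_nonneg _)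

theorem RealCoeff.homSol (hg : RealCoeff g) : RealCoeff (homSol g) := fun J => by
  simp only [GBBM.homSol, hg J, freq_neg, Finset.sum_neg_distrib, map_mul, map_neg, map_div₀,
    Complex.conj_I, Complex.conj_ofReal, Complex.ofReal_neg, div_neg]
  ring

theorem homSol_eq (h : ∃ ε > 0, ∀ J, g J ≠ 0 → ε ≤ |∑ i, freq (J i)|) (J : Fin m → Zbar) :
    -Complex.I * ((∑ i, freq (J i) : ℝ) : ℂ) * homSol g J = -g J := by
  obtain ⟨ε, hε, h⟩ := h
  by_cases h0 : g J = 0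
  · simp [homSol, h0]
  · have hne : ((∑ i, freq (J i) : ℝ) : ℂ) ≠ 0 := by
      have := hε.trans_le (h J h0)
      exact_mod_cast abs_pos.1 this
    rw [homSol, show -Complex.I * ((∑ i, freq (J i) : ℝ) : ℂ) *
      (-Complex.I * (g J / ((∑ i, freq (J i) : ℝ) : ℂ))) = Complex.I * Complex.I *
      (((∑ i, freq (J i) : ℝ) : ℂ) * (g J / ((∑ i, freq (J i) : ℝ) : ℂ))) by ring,
      mul_div_cancel₀ _ hne, Complex.I_mul_I, neg_one_mul]

end

theorem exists_pos_le_of_indicator {m : ℕ} {c : (Fin m → Zbar) → ℂ} (hc : Good c)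
    {s : Set (Fin m → Zbar)}
    (h : ∃ ε > 0, ∀ J : Fin m → Zbar, ∑ i, (J i).1 = 0 → J ∈ s → ε ≤ |∑ i, freq (J i)|) :
    ∃ ε > 0, ∀ J, s.indicator c J ≠ 0 → ε ≤ |∑ i, freq (J i)| := by
  obtain ⟨ε, hε, h⟩ := h
  refine ⟨ε, hε, fun J hJ => h J ?_ (Set.mem_of_indicator_ne_zero hJ)⟩
  by_contra hs
  exact hJ ((hc.indicator s).eq_zero hs)

/-! ### The coefficients of the Hamiltonian -/

theorem good_gCoeff : Good gCoeff := by
  refine ⟨1 / (120 * Real.pi ^ 2), by positivity, fun J => ?_⟩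
  rw [gCoeff, majorant]
  split_ifs
  · rw [Complex.norm_real, Real.norm_eq_abs, abs_of_nonneg]
    exact mul_nonneg (by positivity) (Finset.prod_nonneg fun i _ => delta_nonneg _)
  · simp

theorem realCoeff_gCoeff : RealCoeff gCoeff := fun J => by
  have h : ∑ i, (-J i).1 = -∑ i, (J i).1 := by
    rw [← Finset.sum_neg_distrib]
    rfl
  simp only [gCoeff, h, neg_eq_zero, delta_neg]
  split_ifs
  · rw [Complex.conj_ofReal]
  · simp

section

variable (n₁ n₂ : ℕ+)

theorem good_gBar : Good (gBar n₁ n₂) := good_gCoeff.indicator _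

theorem good_gTilde : Good (gTilde n₁ n₂) := good_gCoeff.indicator _

theorem good_gHat : Good (gHat n₁ n₂) := good_gCoeff.indicator _

theorem good_gMix : Good (gMix n₁ n₂) :=
  ((good_gBar n₁ n₂).add (good_gHat n₁ n₂)).add ((good_gTilde n₁ n₂).const_mul _)

theorem realCoeff_gTilde : RealCoeff (gTilde n₁ n₂) :=
  realCoeff_gCoeff.indicator fun _ h =>
    ⟨neg_mem_atMost n₁ n₂ h.1, neg_mem_normalSet_iff.not.2 h.2⟩

theorem realCoeff_gBar : RealCoeff (gBar n₁ n₂) :=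
  realCoeff_gCoeff.indicator fun _ h => ⟨neg_mem_atMost n₁ n₂ h.1, neg_mem_normalSet h.2⟩

theorem realCoeff_gHat : RealCoeff (gHat n₁ n₂) :=
  realCoeff_gCoeff.indicator fun _ h => neg_mem_atLeast n₁ n₂ h

theorem realCoeff_gMix : RealCoeff (gMix n₁ n₂) :=
  ((realCoeff_gBar n₁ n₂).add (realCoeff_gHat n₁ n₂)).add (realCoeff_gTilde n₁ n₂).half

theorem realCoeff_rCoeff : RealCoeff (rCoeff n₁ n₂) :=
  (realCoeff_gMix n₁ n₂).bracket (m := 5) (n := 5) (realCoeff_gTilde n₁ n₂).homSol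

theorem gCoeff_eq (J : Fin 6 → Zbar) :
    gCoeff J = gBar n₁ n₂ J + gHat n₁ n₂ J + gTilde n₁ n₂ J := by
  rw [gBar, gHat, gTilde]
  by_cases h1 : J ∈ atLeast n₁ n₂ 6 3
  · have h2 : J ∉ atMost n₁ n₂ 6 2 := fun h => by
      have h3 : numOutside n₁ n₂ J ≤ 2 := h
      have h4 : 3 ≤ numOutside n₁ n₂ J := h1
      omega
    rw [Set.indicator_of_mem h1, Set.indicator_of_notMem fun h => h2 h.1,
      Set.indicator_of_notMem fun h => h2 h.1]
    ring
  · have h2 : J ∈ atMost n₁ n₂ 6 2 := by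
      have h3 : ¬3 ≤ numOutside n₁ n₂ J := h1
      change numOutside n₁ n₂ J ≤ 2
      omega
    rw [Set.indicator_of_notMem h1]
    by_cases h3 : J ∈ normalSet 6
    · rw [Set.indicator_of_mem (Set.mem_inter h2 h3), Set.indicator_of_notMem fun h => h.2 h3]
      ring
    · rw [Set.indicator_of_notMem fun h => h3 h.2, Set.indicator_of_mem (Set.mem_sdiff_of_mem h2 h3)]
      ring

theorem rCoeff_eq (J : Fin 10 → Zbar) :
    rCoeff n₁ n₂ J = rBar n₁ n₂ J + rTilde n₁ n₂ J + rHat n₁ n₂ J := by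
  rw [rBar, rHat, rTilde]
  by_cases h1 : J ∈ atLeast n₁ n₂ 10 2
  · have h4 : 2 ≤ numOutside n₁ n₂ J := h1
    rw [Set.indicator_of_mem h1, Set.indicator_of_notMem, Set.indicator_of_notMem]
    · ring
    · intro h
      have h3 : numOutside n₁ n₂ J ≤ 1 := h.1
      omega
    · intro h
      have h3 : numOutside n₁ n₂ J ≤ 0 := h.1
      omega
  · have h2 : J ∈ atMost n₁ n₂ 10 1 := by
      have h3 : ¬2 ≤ numOutside n₁ n₂ J := h1
      change numOutside n₁ n₂ J ≤ 1
      omega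
    rw [Set.indicator_of_notMem h1]
    by_cases h3 : J ∈ normalSet 10
    · have h5 : J ∈ atMost n₁ n₂ 10 0 := by
        change numOutside n₁ n₂ J ≤ 0
        have h6 : numOutside n₁ n₂ J ≤ 1 := h2
        rw [numOutside_eq] at h6 ⊢
        rw [outs_eq_empty_of_mem_normalSet (by norm_num) h3 h6]
        rfl
      rw [Set.indicator_of_mem (Set.mem_inter h5 h3), Set.indicator_of_notMem fun h => h.2 h3]
      ring
    · rw [Set.indicator_of_notMem fun h => h3 h.2, Set.indicator_of_mem (Set.mem_sdiff_of_mem h2 h3)]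
      ring

end


section

variable {n₁ n₂ : ℕ+}

theorem Nonresonant.good_fCoeff (h : Nonresonant n₁ n₂) : Good (fCoeff n₁ n₂) :=
  (good_gTilde n₁ n₂).homSol (exists_pos_le_of_indicator good_gCoeff h.six)

theorem Nonresonant.good_rCoeff (h : Nonresonant n₁ n₂) : Good (rCoeff n₁ n₂) :=
  (good_gMix n₁ n₂).bracket (m := 5) (n := 5) h.good_fCoeff

theorem Nonresonant.poly_rCoeff (h : Nonresonant n₁ n₂) {p : ℝ} (hp : 0 < p) (z : SeqSpace p) :
    poly (rCoeff n₁ n₂) z = poly (rBar n₁ n₂) z + poly (rTilde n₁ n₂) z + poly (rHat n₁ n₂) z := by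
  have h1 : Good (rBar n₁ n₂) := h.good_rCoeff.indicator _
  have h2 : Good (rTilde n₁ n₂) := h.good_rCoeff.indicator _
  have h3 : Good (rHat n₁ n₂) := h.good_rCoeff.indicator _
  rw [← poly_add hp h1 h2, ← poly_add hp (h1.add h2) h3]
  exact congrArg (fun c => poly c z) (funext (rCoeff_eq n₁ n₂))

theorem Nonresonant.fderiv_gMix (h : Nonresonant n₁ n₂) {p : ℝ} (hp : 0 < p) (z : SeqSpace p) :
    fderiv ℂ (poly (gMix n₁ n₂)) z (incl p (polyField (m := 5) hp h.good_fCoeff z)) =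
      poly (rBar n₁ n₂) z + poly (rTilde n₁ n₂) z + poly (rHat n₁ n₂) z :=
  (fderiv_poly_polyField (m := 5) (n := 5) hp (good_gMix n₁ n₂) h.good_fCoeff z).trans
    (h.poly_rCoeff hp z)

theorem Nonresonant.exists_transformations (h : Nonresonant n₁ n₂) {p : ℝ} (hp : 0 < p) :
    ∃ (Φ₁ Φ₂ : SeqSpace p → SeqSpace p) (V U : Set (SeqSpace p)) (T : SeqSpace p → ℂ),
      IsSymplecticTransformation Φ₁ V ∧
      IsTimeOneMap (polyField (m := 5) hp h.good_fCoeff) Φ₁ V ∧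
      IsSymplecticTransformation Φ₂ U ∧ Set.MapsTo Φ₂ U V ∧
      (∀ z ∈ U, ham (Φ₁ (Φ₂ z)) =
        Lam z + poly (gBar n₁ n₂) z + poly (gHat n₁ n₂) z
          + poly (rBar n₁ n₂) z + poly (rHat n₁ n₂) z + T z) ∧
      Asymptotics.IsBigO (𝓝 (0 : SeqSpace p)) T (fun z => ‖z‖ ^ 14) ∧
      ∃ X : SeqSpace p → SeqSpace (p + 1), HasAnalyticField T X U := by
  have hr := exists_pos_le_of_indicator h.good_rCoeff h.ten
  have hrt : Good (rTilde n₁ n₂) := h.good_rCoeff.indicator _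
  have hrtr : RealCoeff (rTilde n₁ n₂) := (realCoeff_rCoeff n₁ n₂).indicator fun _ h =>
    ⟨neg_mem_atMost n₁ n₂ h.1, neg_mem_normalSet_iff.not.2 h.2⟩
  have hb := (good_gBar n₁ n₂).add (good_gHat n₁ n₂)
  have hg := good_gTilde n₁ n₂
  have hsplit : ∀ z : SeqSpace p,
      poly (bracketCoeff (m := 5) (n := 5) (fun J => gBar n₁ n₂ J + gHat n₁ n₂ J)
        (fCoeff n₁ n₂)) z
      + 1 / 2 * poly (bracketCoeff (m := 5) (n := 5) (gTilde n₁ n₂) (fCoeff n₁ n₂)) z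
      = poly (rBar n₁ n₂) z + poly (rTilde n₁ n₂) z + poly (rHat n₁ n₂) z := by
    intro z
    rw [← h.fderiv_gMix hp z, ← fderiv_poly_polyField (m := 5) (n := 5) hp hb h.good_fCoeff z,
      ← fderiv_poly_polyField (m := 5) (n := 5) hp hg h.good_fCoeff z]
    have e : poly (p := p) (gMix n₁ n₂) = poly (fun J => gBar n₁ n₂ J + gHat n₁ n₂ J) +
        (1 / 2 : ℂ) • poly (gTilde n₁ n₂) := by
      ext z
      rw [Pi.add_apply, Pi.smul_apply, smul_eq_mul, ← poly_const_mul,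
        ← poly_add hp hb (hg.const_mul _)]
      rfl
    have d1 := (analyticAt_poly hp hb z).differentiableAt
    have d2 := (analyticAt_poly hp hg z).differentiableAt
    rw [e, fderiv_add d1 (d2.const_smul _), fderiv_const_smul d2]
    rfl
  obtain ⟨Φ₁, Φ₂, V, U, T, h1, h2, h3, h4, h5, h6, h7⟩ := exists_normalForm hp hb hg
    h.good_fCoeff (h.good_rCoeff.indicator _) hrt (h.good_rCoeff.indicator _)
    (hrt.homSol hr) (realCoeff_gTilde n₁ n₂).homSol hrtr.homSol
    (homSol_eq (exists_pos_le_of_indicator good_gCoeff h.six)) (homSol_eq hr) hsplit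
  refine ⟨Φ₁, Φ₂, V, U, T, h1, h2, h3, h4, fun z hz => ?_, h6, h7⟩
  have hG : ∀ z : SeqSpace p, ham z =
      Lam z + poly (fun J => gBar n₁ n₂ J + gHat n₁ n₂ J) z + poly (gTilde n₁ n₂) z := by
    intro z
    rw [ham, add_assoc, ← poly_add hp hb hg]
    exact congrArg (fun c => Lam z + poly c z) (funext (gCoeff_eq n₁ n₂))
  rw [hG, h5 z hz, poly_add hp (good_gBar n₁ n₂) (good_gHat n₁ n₂), ← add_assoc (Lam z)]
  rfl

end

/-! ### The integrable terms of order ten -/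

theorem outs_eq_empty_of_mem_atMost {n₁ n₂ : ℕ+} {m : ℕ} {J : Fin m → Zbar}
    (h : J ∈ atMost n₁ n₂ m 0) : outs n₁ n₂ J = ∅ := by
  have h1 : numOutside n₁ n₂ J ≤ 0 := h
  rw [numOutside_eq] at h1
  exact Finset.card_eq_zero.1 (by omega)

theorem finite_atMost_zero (n₁ n₂ : ℕ+) (m : ℕ) : (atMost n₁ n₂ m 0).Finite := by
  have hs : (sites n₁ n₂).Finite := by simp [sites]
  refine (Set.Finite.pi' (t := fun _ : Fin m => sites n₁ n₂) fun _ => hs).subset fun J hJ i => ?_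
  by_contra hi
  have := mem_outs.2 hi
  rw [outs_eq_empty_of_mem_atMost hJ] at this
  simp at this

/-- The coefficient of `(z_{n₁} z_{-n₁})^{5-k} (z_{n₂} z_{-n₂})^k`. -/
def barCoeff (n₁ n₂ : ℕ+) (k : ℕ) : ℂ :=
  ∑' J : Fin 10 → Zbar, if cnt J (pos n₂) = k then rBar n₁ n₂ J else 0

theorem cnt_neg_comp {m : ℕ} (J : Fin m → Zbar) (a : Zbar) :
    cnt (fun i => -J i) a = cnt J (-a) := by
  simp only [cnt, neg_eq_iff_eq_neg]

theorem conj_barCoeff (n₁ n₂ : ℕ+) (k : ℕ) :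
    starRingEnd ℂ (barCoeff n₁ n₂ k) = barCoeff n₁ n₂ k := by
  have hr : RealCoeff (rBar n₁ n₂) := (realCoeff_rCoeff n₁ n₂).indicator fun _ h =>
    ⟨neg_mem_atMost n₁ n₂ h.1, neg_mem_normalSet h.2⟩
  rw [barCoeff, Complex.conj_tsum, ← (Equiv.neg (Fin 10 → Zbar)).tsum_eq]
  refine tsum_congr fun J => ?_
  change starRingEnd ℂ (if cnt (fun i => -J i) (pos n₂) = k then rBar n₁ n₂ (fun i => -J i) else 0)
    = _
  rw [apply_ite (starRingEnd ℂ), hr, Complex.conj_conj, map_zero, cnt_neg_comp]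
  by_cases hJ : J ∈ atMost n₁ n₂ 10 0 ∩ normalSet 10
  · rw [cnt_neg_of_mem_normalSet (by norm_num) hJ.2]
  · rw [rBar, Set.indicator_of_notMem hJ]
    simp

theorem prod_eq_of_mem_normalSet {n₁ n₂ : ℕ+} (hne : n₁ ≠ n₂) {p : ℝ} (z : SeqSpace p)
    {J : Fin 10 → Zbar} (h : J ∈ atMost n₁ n₂ 10 0 ∩ normalSet 10) : cnt J (pos n₂) < 6 ∧
    ∏ i, z (J i) = (z (pos n₁) * z (-pos n₁)) ^ (5 - cnt J (pos n₂)) *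
      (z (pos n₂) * z (-pos n₂)) ^ cnt J (pos n₂) := by
  have h0 := outs_eq_empty_of_mem_atMost h.1
  have h1 := cnt_neg_of_mem_normalSet (by norm_num) h.2 (pos n₁)
  have h2 := cnt_neg_of_mem_normalSet (by norm_num) h.2 (pos n₂)
  have hc := card_outs_add hne J
  rw [h0, Finset.card_empty] at hc
  refine ⟨by omega, ?_⟩
  rw [prod_eq_prod_outs hne J fun j => z j, h0, h1, h2,
    show cnt J (pos n₁) = 5 - cnt J (pos n₂) by omega, Finset.prod_empty, mul_pow, mul_pow]
  ring

theorem poly_rBar {n₁ n₂ : ℕ+} (hne : n₁ ≠ n₂) {p : ℝ} (z : SeqSpace p) :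
    poly (rBar n₁ n₂) z = ∑ k : Fin 6, ((barCoeff n₁ n₂ k).re : ℂ) *
      (z (pos n₁) * z (-pos n₁)) ^ (5 - (k : ℕ)) * (z (pos n₂) * z (-pos n₂)) ^ (k : ℕ) := by
  have hz : ∀ J ∉ atMost n₁ n₂ 10 0, rBar n₁ n₂ J = 0 := fun J hJ =>
    Set.indicator_of_notMem (fun h => hJ h.1) _
  have hterm : ∀ J : Fin 10 → Zbar, rBar n₁ n₂ J * ∏ i, z (J i) =
      ∑ k : Fin 6, (if cnt J (pos n₂) = k then rBar n₁ n₂ J else 0) *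
        ((z (pos n₁) * z (-pos n₁)) ^ (5 - (k : ℕ)) * (z (pos n₂) * z (-pos n₂)) ^ (k : ℕ)) := by
    intro J
    by_cases hJ : J ∈ atMost n₁ n₂ 10 0 ∩ normalSet 10
    · obtain ⟨h1, h2⟩ := prod_eq_of_mem_normalSet hne z hJ
      rw [h2, Finset.sum_eq_single ⟨cnt J (pos n₂), h1⟩]
      · simp
      · intro k _ hk
        rw [if_neg, zero_mul]
        exact fun h => hk (Fin.ext h.symm)
      · simp
    · rw [rBar, Set.indicator_of_notMem hJ]
      simp
  have hsum : ∀ k : Fin 6, Summable fun J : Fin 10 → Zbar =>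
      (if cnt J (pos n₂) = k then rBar n₁ n₂ J else 0) *
        ((z (pos n₁) * z (-pos n₁)) ^ (5 - (k : ℕ)) * (z (pos n₂) * z (-pos n₂)) ^ (k : ℕ)) :=
    fun k => summable_of_hasFiniteSupport ((finite_atMost_zero n₁ n₂ 10).subset fun J hJ => by
      by_contra h
      simp [hz J h] at hJ)
  rw [poly, tsum_congr hterm, Summable.tsum_finsetSum fun k _ => hsum k]
  refine Finset.sum_congr rfl fun k _ => ?_
  rw [tsum_mul_right, Complex.conj_eq_iff_re.1 (conj_barCoeff n₁ n₂ k), mul_assoc]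
  rfl

/-! ### The terms of order two in the normal directions -/

theorem norm_poly_rHat_le {n₁ n₂ : ℕ+} (h : Nonresonant n₁ n₂) {p : ℝ} (hp : 0 < p) :
    ∃ K : ℝ, ∀ z : SeqSpace p, ‖poly (rHat n₁ n₂) z‖ ≤ K * (‖z‖ ^ 8 * ‖hat n₁ n₂ z‖ ^ 2) := by
  obtain ⟨C, hC, hc⟩ := h.good_rCoeff
  set B : ℝ≥0∞ := ENNReal.ofReal C * ellConst p ^ 10 with hB
  set P : Finset (Finset (Fin 10)) := Finset.univ.powersetCard 2 with hP
  have hBt : B ≠ ⊤ :=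
    ENNReal.mul_ne_top ENNReal.ofReal_ne_top (ENNReal.pow_ne_top (ellConst_ne_top hp))
  have hPB : (P.card : ℝ≥0∞) * B ≠ ⊤ := ENNReal.mul_ne_top (by simp) hBt
  refine ⟨((P.card : ℝ≥0∞) * B).toReal, fun z => ?_⟩
  set v : Finset (Fin 10) → Fin 10 → SeqSpace p := fun s l => if l ∈ s then hat n₁ n₂ z else z
    with hv
  have hprod : ∀ s ∈ P, ∏ l, ‖v s l‖ₑ = ‖z‖ₑ ^ 8 * ‖hat n₁ n₂ z‖ₑ ^ 2 := by
    intro s hs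
    have hs2 : s.card = 2 := (Finset.mem_powersetCard.1 hs).2
    simp only [hv, apply_ite (fun x : SeqSpace p => ‖x‖ₑ)]
    rw [Finset.prod_ite, Finset.prod_const, Finset.prod_const, Finset.filter_mem_eq_inter,
      Finset.univ_inter, Finset.filter_notMem_eq_sdiff, ← Finset.compl_eq_univ_sdiff,
      Finset.card_compl, hs2, mul_comm]
    rfl
  have hterm : ∀ J, ‖rHat n₁ n₂ J * ∏ l, z (J l)‖ₑ ≤
      ∑ s ∈ P, ‖rCoeff n₁ n₂ J * ∏ l, v s l (J l)‖ₑ := by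
    intro J
    by_cases hJ : J ∈ atLeast n₁ n₂ 10 2
    · have h2 : 2 ≤ numOutside n₁ n₂ J := hJ
      rw [numOutside_eq] at h2
      obtain ⟨s, hs, hs2⟩ := Finset.exists_subset_card_eq h2
      have e : ∀ l, z (J l) = v s l (J l) := by
        intro l
        by_cases hl : l ∈ s
        · simp only [hv, hl, if_true]
          exact (Set.indicator_of_mem (Set.mem_compl (mem_outs.1 (hs hl))) _).symm
        · simp only [hv, hl, if_false]
      rw [rHat, Set.indicator_of_mem hJ]
      simp only [e]
      exact Finset.single_le_sum (f := fun s => ‖rCoeff n₁ n₂ J * ∏ l, v s l (J l)‖ₑ)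
        (fun _ _ => zero_le) (Finset.mem_powersetCard.2 ⟨Finset.subset_univ _, hs2⟩)
    · rw [rHat, Set.indicator_of_notMem hJ]
      simp
  have main : ‖poly (rHat n₁ n₂) z‖ₑ ≤ (P.card : ℝ≥0∞) * B * (‖z‖ₑ ^ 8 * ‖hat n₁ n₂ z‖ₑ ^ 2) := by
    calc ‖poly (rHat n₁ n₂) z‖ₑ ≤ ∑' J, ‖rHat n₁ n₂ J * ∏ l, z (J l)‖ₑ :=
          enorm_tsum_le_tsum_enorm
      _ ≤ ∑' J, ∑ s ∈ P, ‖rCoeff n₁ n₂ J * ∏ l, v s l (J l)‖ₑ := ENNReal.tsum_le_tsum hterm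
      _ = ∑ s ∈ P, ∑' J, ‖rCoeff n₁ n₂ J * ∏ l, v s l (J l)‖ₑ :=
          Summable.tsum_finsetSum fun _ _ => ENNReal.summable
      _ ≤ ∑ s ∈ P, B * (‖z‖ₑ ^ 8 * ‖hat n₁ n₂ z‖ₑ ^ 2) := Finset.sum_le_sum fun s hs => by
          rw [← hprod s hs]
          exact tsum_enorm_coeff_le hC hc (v s)
      _ = _ := by rw [Finset.sum_const, nsmul_eq_mul, ← mul_assoc]
  have h3 := ENNReal.toReal_mono (ENNReal.mul_ne_top hPB
    (ENNReal.mul_ne_top (ENNReal.pow_ne_top enorm_ne_top) (ENNReal.pow_ne_top enorm_ne_top))) main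
  simpa only [ENNReal.toReal_mul, ENNReal.toReal_pow, toReal_enorm] using h3

end GBBM

end

open GBBM
theorem proposition3p4 :
    ∃ N₁ : ℕ+, ∀ n₁ : ℕ+, N₁ ≤ n₁ → ∃ N₂ : ℕ+, ∀ n₂ : ℕ+, N₂ ≤ n₂ →
    ∃ R : Fin 6 → ℝ, ∀ p : ℝ, 0 < p →
    ∃ (XF : SeqSpace p → SeqSpace (p + 1)) (Φ₁ Φ₂ : SeqSpace p → SeqSpace p) (V U : Set (SeqSpace p))
      (T : SeqSpace p → ℂ),
      -- `Φ₁` is the time-one map of the Hamiltonian flow of `F`, defined near the origin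
      HasAnalyticField (poly (fCoeff n₁ n₂)) XF Set.univ ∧
      IsSymplecticTransformation Φ₁ V ∧ IsTimeOneMap XF Φ₁ V ∧
      -- the splitting of the terms of order ten
      (∀ z : SeqSpace p, DifferentiableAt ℂ (poly (p := p) (gMix n₁ n₂)) z ∧
        fderiv ℂ (poly (gMix n₁ n₂)) z (incl p (XF z)) =
          poly (rBar n₁ n₂) z + poly (rTilde n₁ n₂) z + poly (rHat n₁ n₂) z) ∧
      -- the transformation `Φ₂` and the normal form
      IsSymplecticTransformation Φ₂ U ∧ Set.MapsTo Φ₂ U V ∧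
      (∀ z ∈ U, ham (Φ₁ (Φ₂ z)) =
        Lam z + poly (gBar n₁ n₂) z + poly (gHat n₁ n₂) z
          + poly (rBar n₁ n₂) z + poly (rHat n₁ n₂) z + T z) ∧
      -- the form of `R̄`, on all of `h_p` and on the real subspace
      (∀ z : SeqSpace p, poly (rBar n₁ n₂) z =
        ∑ k : Fin 6, (R k : ℂ) * (z (pos n₁) * z (-pos n₁)) ^ (5 - (k : ℕ))
          * (z (pos n₂) * z (-pos n₂)) ^ (k : ℕ)) ∧
      (∀ z : SeqSpace p, IsReal z → poly (rBar n₁ n₂) z =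
        ((R 0 * ‖z (pos n₁)‖ ^ 10
          + R 1 * ‖z (pos n₁)‖ ^ 8 * ‖z (pos n₂)‖ ^ 2
          + R 2 * ‖z (pos n₁)‖ ^ 6 * ‖z (pos n₂)‖ ^ 4
          + R 3 * ‖z (pos n₁)‖ ^ 4 * ‖z (pos n₂)‖ ^ 6
          + R 4 * ‖z (pos n₁)‖ ^ 2 * ‖z (pos n₂)‖ ^ 8
          + R 5 * ‖z (pos n₂)‖ ^ 10 : ℝ) : ℂ)) ∧
      -- the estimates of `R̂` and `T`
      Asymptotics.IsBigO (𝓝 (0 : SeqSpace p)) (poly (rHat n₁ n₂))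
        (fun z => ‖z‖ ^ 8 * ‖hat n₁ n₂ z‖ ^ 2) ∧
      Asymptotics.IsBigO (𝓝 (0 : SeqSpace p)) T (fun z => ‖z‖ ^ 14) ∧
      -- regularity of the vector fields
      (∃ X : SeqSpace p → SeqSpace (p + 1), HasAnalyticField (poly (rBar n₁ n₂)) X Set.univ) ∧
      (∃ X : SeqSpace p → SeqSpace (p + 1), HasAnalyticField (poly (rHat n₁ n₂)) X Set.univ) ∧
      (∃ X : SeqSpace p → SeqSpace (p + 1), HasAnalyticField T X U) := by
  obtain ⟨N₁, h⟩ := exists_nonresonant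
  refine ⟨N₁, fun n₁ hn₁ => ?_⟩
  obtain ⟨N₂, h⟩ := h n₁ hn₁
  refine ⟨N₂, fun n₂ hn₂ => ⟨fun k => (barCoeff n₁ n₂ k).re, fun p hp => ?_⟩⟩
  have hn := h n₂ hn₂
  obtain ⟨Φ₁, Φ₂, V, U, T, h1, h2, h3, h4, h5, h6, h7⟩ := hn.exists_transformations hp
  obtain ⟨K, hK⟩ := norm_poly_rHat_le hn hp
  have hbar := fun z : SeqSpace p => poly_rBar hn.ne z
  refine ⟨polyField (m := 5) hp hn.good_fCoeff, Φ₁, Φ₂, V, U, T,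
    hasAnalyticField_poly (m := 5) hp hn.good_fCoeff, h1, h2,
    fun z => ⟨(analyticAt_poly hp (good_gMix n₁ n₂) z).differentiableAt, hn.fderiv_gMix hp z⟩,
    h3, h4, h5, hbar, fun z hz => ?_, ?_, h6,
    ⟨_, hasAnalyticField_poly (m := 9) hp (hn.good_rCoeff.indicator _)⟩,
    ⟨_, hasAnalyticField_poly (m := 9) hp (hn.good_rCoeff.indicator _)⟩, h7⟩
  · rw [hbar z, hz, hz, Complex.mul_conj', Complex.mul_conj']
    simp only [Fin.sum_univ_six]
    push_cast
    simp only [Fin.val_zero, Fin.val_one, Fin.val_two]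
    norm_num
    ring
  · refine Asymptotics.IsBigO.of_bound K (Filter.Eventually.of_forall fun z => ?_)
    rw [Real.norm_of_nonneg (by positivity)]
    exact hK z
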